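/- Write $\mathcal D$ for the complex-valued compactly supported smooth functions on $\mathbb R^d$ with its usual (LF) topology, $\mathcal D'$ for its dual, $\mathcal D(K)$ for the $\varphi\in\mathcal D$ with support in the compact set $K$, and $\phi_j=2^{jd}\phi(2^j\,\cdot)$ for $\phi\in\mathcal D$, $j\in\mathbb N=\{0,1,2,\dots\}$. A solid translation-invariant Banach function space (TIBF) of bounded type is a non-trivial complex Banach space $E$ with continuous inclusion $E\subseteq L^1_{\mathrm{loc}}(\mathbb R^d)$ such that $E$ is invariant under all translations $T_xf=f(\cdot-x)$; there is $C_0>0$ with $\|T_xf\|_E\le C_0\|f\|_E$ for all $x\in\mathbb R^d$, $f\in E$; $E*C_{\mathrm c}(\mathbb R^d)\subseteq E$; and $f\in E$, $g\in L^1_{\mathrm{loc}}$, $|g|\le|f|$ a.e. imply $g\in E$ and $\|g\|_E\le\|f\|_E$. Its semi-local space $E_{\mathrm{sl}}$ consists of all $f\in L^1_{\mathrm{loc}}$ such that $1_Kf\in E$ for every compact $K$ and $\|f\|_{E_{\mathrm{sl}}}:=\sup_{R>0}\|1_{\overline B(0,R)}f\|_E<\infty$. Let $L^0$ be the subspace of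 those $f\in L^\infty(\mathbb R^d)$ such that for each $\varepsilon>0$ there is a compact $K$ with $|f|\le\varepsilon$ a.e. outside $K$. A weight function system is a sequence $\mathcal W=(w_n)_{n\in\mathbb N}$ of measurable, locally bounded functions $w_n:\mathbb R^d\to[1,\infty)$ with $w_n\le w_{n+1}$. It satisfies (wM) if for every $n$ there are $m\ge n$ and $C>0$ with $w_n(x+y)\le C\,w_m(x)$ for all $x\in\mathbb R^d$, $|y|\le1$. For a function space $X$ as above and a weight $\omega>0$, let $X^n_\omega$ be the space of all $f\in C^n(\mathbb R^d)$ with $f^{(\alpha)}\omega\in X$ for all $|\alpha|\le n$, normed by $\max_{|\alpha|\le n}\|f^{(\alpha)}\omega\|_X$; put $X^\infty_{\mathcal W}=\bigcap_nX^n_{w_n}$ and $\dot{\mathcal B}_{\mathcal V}=(L^0)^\infty_{\mathcal V}$. Let $$\mathcal O_M(\dot{\mathcal B}_{\mathcal V},E^\infty_{\mathcal W})=\{f\in\mathcal D' : f\cdot\varphi\in E^\infty_{\mathcal W}\text{ for all }\varphi\in\dot{\mathcal B}_{\mathcal V}\}.$$ A pair $(\chi^0,\chi^1)\in\mathcal D\times\mathcal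 D$ has the momentwise decomposition factorization property (MDFP) if there is a compact set $K\subset\mathbb R^d$ with non-empty interior such that for every $L\in\mathbb N$ there are non-trivial pairs $(\varphi^\ell,\psi^\ell)\in\mathcal D(K)\times\mathcal D(K)$, $\ell\in\{0,1\}$, with $\int x^\alpha\psi^\ell(x)\,dx=0$ for all $|\alpha|<L$ and $\ell\in\{0,1\}$, $2^d\varphi^0(2\,\cdot)-\varphi^0=\Delta\psi^0$, $\int\varphi^0=1$, $\varphi^0=\chi^0*\varphi^0+\chi^1*\varphi^1$ and $\psi^0=\chi^0*\psi^0+\chi^1*\psi^1$. Theorem. Let $E$ be a solid TIBF of bounded type on $\mathbb R^d$, let $\mathcal V=(v_n)$ and $\mathcal W=(w_n)$ be weight function systems satisfying (wM), and suppose that $(\chi^0,\chi^1)\in\mathcal D\times\mathcal D$ has the MDFP. For any $f\in\mathcal D'$ the following are equivalent: (i) $f\in\mathcal O_M(\dot{\mathcal B}_{\mathcal V},E^\infty_{\mathcal W})$; (ii) for any $\phi\in\mathcal D$ and $n\in\mathbb N$ there is $m\in\mathbb N$ such that $\{f*\phi_j : j\in\mathbb N\}$ is bounded in $(E_{\mathrm{sl}})^n_{w_n/v_m}$;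 (iii) for any $\phi\in\mathcal D$ there is $r>0$ such that for every $n\in\mathbb N$ there is $m\in\mathbb N$ such that $\{2^{-rj}(f*\phi_j) : j\in\mathbb N\}$ is bounded in $(E_{\mathrm{sl}})^n_{w_n/v_m}$; (iv) there is $r>0$ such that for every $n\in\mathbb N$ there is $m\in\mathbb N$ such that $\{2^{-rj}(f*\chi^\ell_j) : j\in\mathbb N,\ \ell=0,1\}$ is bounded in $(E_{\mathrm{sl}})^n_{w_n/v_m}$. -/

import Mathlib

open MeasureTheory Distributions
open scoped ENNReal NNReal ContDiff Convolution

noncomputable section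

namespace MollifierOM

/-! ### Derivatives, test functions, distributions -/

/-- The Euclidean space `ℝ^d`. -/
abbrev Rd (d : ℕ) := EuclideanSpace ℝ (Fin d)

/-- The space `𝒟` of complex-valued compactly supported smooth functions on `ℝ^d`, with Mathlib's
canonical (LF) topology. -/
abbrev Test (d : ℕ) := TestFunction (⊤ : TopologicalSpace.Opens (Rd d)) ℂ ⊤

/-- The space `𝒟'` of complex distributions on `ℝ^d`: continuous `ℂ`-linear forms on `𝒟`. -/
abbrev Distr (d : ℕ) := Test d →L[ℂ] ℂ

variable {d : ℕ}

/-- The partial derivative `∂_i f`. -/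
def partialDeriv (i : Fin d) (f : Rd d → ℂ) : Rd d → ℂ :=
  fun x => fderiv ℝ f x (EuclideanSpace.single i 1)

/-- The iterated partial derivative `f^(α) = ∂_1^{α_1} ⋯ ∂_d^{α_d} f`. -/
def multiDeriv (α : Fin d → ℕ) (f : Rd d → ℂ) : Rd d → ℂ :=
  (List.finRange d).foldr (fun i g => (partialDeriv i)^[α i] g) f

/-- The test function `y ↦ φ (x - y)`. -/
def reflTranslate (x : Rd d) (φ : Test d) : Test d where
  toFun y := φ (x - y)
  contDiff' := φ.contDiff.comp (contDiff_const.sub contDiff_id)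
  hasCompactSupport' :=
    φ.hasCompactSupport.comp_homeomorph (Homeomorph.subLeft x)
  tsupport_subset' := Set.subset_univ _

/-- The test function `φ_j = 2^{jd} φ(2^j ·)`. -/
def dilate (j : ℕ) (φ : Test d) : Test d where
  toFun y := (2 : ℂ) ^ (j * d) * φ ((2 : ℝ) ^ j • y)
  contDiff' := contDiff_const.mul (φ.contDiff.comp (contDiff_const_smul _))
  hasCompactSupport' :=
    (φ.hasCompactSupport.comp_homeomorph
      (Homeomorph.smulOfNeZero ((2 : ℝ) ^ j) (by positivity))).mul_left
  tsupport_subset' := Set.subset_univ _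

/-- The product of a smooth function and a test function. -/
def smoothMul (g : Rd d → ℂ) (hg : ContDiff ℝ ∞ g) (φ : Test d) : Test d where
  toFun y := g y * φ y
  contDiff' := hg.mul φ.contDiff
  hasCompactSupport' := φ.hasCompactSupport.mul_left
  tsupport_subset' := Set.subset_univ _

/-- The convolution `(f * φ)(x) = ⟨f, φ(x - ·)⟩` of a distribution and a test function. -/
def distConv (f : Distr d) (φ : Test d) : Rd d → ℂ :=
  fun x => f (reflTranslate x φ)

/-- The convolution `(g * h)(x) = ∫ g(t) h(x - t) dt` of two functions. -/
def conv (g h : Rd d → ℂ) : Rd d → ℂ :=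
  g ⋆[ContinuousLinearMap.mul ℂ ℂ, volume] h

/-! ### Translation-invariant Banach function spaces -/

/-- A solid translation-invariant Banach function space (TIBF) of bounded type on `ℝ^d`.
The Banach space is `E`, and `incl` is its inclusion into `L¹_loc`, functions being taken modulo
equality almost everywhere. -/
structure SolidTIBF (d : ℕ) (E : Type*) [NormedAddCommGroup E] [NormedSpace ℂ E]
    [CompleteSpace E] where
  /-- The inclusion of `E` into the (classes of) measurable functions. -/
  incl : E →ₗ[ℂ] (Rd d →ₘ[volume] ℂ)
  incl_injective : Function.Injective incl
  nontrivial : ∃ e : E, e ≠ 0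
  /-- `E ⊆ L¹_loc`. -/
  locallyIntegrable : ∀ e, LocallyIntegrable (incl e) volume
  /-- The inclusion `E ⊆ L¹_loc` is continuous. -/
  incl_continuous : ∀ K : Set (Rd d), IsCompact K →
    ∃ C : ℝ, ∀ e, ∫ x in K, ‖incl e x‖ ≤ C * ‖e‖
  /-- (A.1) `E` is translation-invariant. -/
  translate : ∀ (x : Rd d) (e : E), ∃ e' : E, incl e' =ᵐ[volume] fun t => incl e (t - x)
  /-- (A.2) Translations are uniformly bounded on `E`. -/
  translate_bound : ∃ C₀ : ℝ, 0 < C₀ ∧ ∀ (x : Rd d) (e e' : E),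
    incl e' =ᵐ[volume] (fun t => incl e (t - x)) → ‖e'‖ ≤ C₀ * ‖e‖
  /-- (A.3) `E * C_c ⊆ E`. -/
  conv_mem : ∀ (e : E) (φ : Rd d → ℂ), Continuous φ → HasCompactSupport φ →
    ∃ e' : E, incl e' =ᵐ[volume] conv (incl e) φ
  /-- Solidity. -/
  solid : ∀ (e : E) (g : Rd d → ℂ), LocallyIntegrable g volume →
    (∀ᵐ x, ‖g x‖ ≤ ‖incl e x‖) → ∃ e' : E, incl e' =ᵐ[volume] g ∧ ‖e'‖ ≤ ‖e‖

/-- A normed space of functions on `ℝ^d`, given by its membership predicate and its norm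
(only the values of the norm on members matter). It is used to write `E`, `E_sl` and `L⁰` in
the same way as base spaces of `X^n_ρ` and `X^∞_𝒲`. -/
structure FunSpace (d : ℕ) where
  Mem : (Rd d → ℂ) → Prop
  norm : (Rd d → ℂ) → ℝ≥0∞

section

variable {E : Type*} [NormedAddCommGroup E] [NormedSpace ℂ E] [CompleteSpace E]

/-- `E` itself. As the inclusion is injective, the infimum runs over at most one element, and it
is `∞` outside `E`. -/
def SolidTIBF.space (B : SolidTIBF d E) : FunSpace d where
  Mem g := ∃ e : E, B.incl e =ᵐ[volume] g
  norm g := ⨅ (e : E) (_ : B.incl e =ᵐ[volume] g), ‖e‖ₑ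

/-- The norm `‖g‖_{E_sl} = sup_{R > 0} ‖1_{B̄(0,R)} g‖_E`. -/
def SolidTIBF.slNorm (B : SolidTIBF d E) (g : Rd d → ℂ) : ℝ≥0∞ :=
  ⨆ (R : ℝ) (_ : 0 < R), B.space.norm ((Metric.closedBall 0 R).indicator g)

/-- The semi-local space `E_sl`. -/
def SolidTIBF.semiLocal (B : SolidTIBF d E) : FunSpace d where
  Mem g := LocallyIntegrable g volume ∧
    (∀ K : Set (Rd d), IsCompact K → B.space.Mem (K.indicator g)) ∧ B.slNorm g < ⊤
  norm := B.slNorm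

end

/-- The space `L⁰` of all `L^∞` functions that vanish at infinity. -/
def Lzero (d : ℕ) : FunSpace d where
  Mem g := MemLp g ⊤ volume ∧
    ∀ ε : ℝ, 0 < ε → ∃ K : Set (Rd d), IsCompact K ∧ ∀ᵐ x, x ∉ K → ‖g x‖ ≤ ε
  norm g := eLpNorm g ⊤ volume

/-- Membership in `X^n_ρ`: `f ∈ C^n` and `f^(α) ρ ∈ X` for all `|α| ≤ n`. -/
def FunSpace.MemCn (X : FunSpace d) (n : ℕ) (ρ : Rd d → ℝ) (f : Rd d → ℂ) : Prop :=
  ContDiff ℝ n f ∧ ∀ α : Fin d → ℕ, ∑ i, α i ≤ n → X.Mem fun x => multiDeriv α f x * (ρ x : ℂ)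

/-- The norm `max_{|α| ≤ n} ‖f^(α) ρ‖_X` of `X^n_ρ`. -/
def FunSpace.normCn (X : FunSpace d) (n : ℕ) (ρ : Rd d → ℝ) (f : Rd d → ℂ) : ℝ≥0∞ :=
  ⨆ (α : Fin d → ℕ) (_ : ∑ i, α i ≤ n), X.norm fun x => multiDeriv α f x * (ρ x : ℂ)

/-- `S` is a bounded subset of the normed space `X^n_ρ`. -/
def FunSpace.BoundedCn (X : FunSpace d) (n : ℕ) (ρ : Rd d → ℝ) (S : Set (Rd d → ℂ)) : Prop :=
  (∀ g ∈ S, X.MemCn n ρ g) ∧ ∃ M : ℝ≥0, ∀ g ∈ S, X.normCn n ρ g ≤ M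

/-- Membership in `X^∞_𝒲 = ⋂_n X^n_{w_n}`. -/
def FunSpace.MemInfty (X : FunSpace d) (w : ℕ → Rd d → ℝ) (f : Rd d → ℂ) : Prop :=
  ∀ n : ℕ, X.MemCn n (w n) f

theorem FunSpace.MemInfty.contDiff {X : FunSpace d} {w : ℕ → Rd d → ℝ} {f : Rd d → ℂ}
    (h : X.MemInfty w f) : ContDiff ℝ ∞ f :=
  contDiff_infty.2 fun n => (h n).1

/-! ### Weight function systems -/

/-- A weight function system: an increasing sequence of (Lebesgue) measurable, locally bounded
functions `ℝ^d → [1, ∞)`. -/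
structure IsWeightSystem (w : ℕ → Rd d → ℝ) : Prop where
  one_le : ∀ n x, 1 ≤ w n x
  measurable : ∀ n, AEMeasurable (w n) volume
  locallyBounded : ∀ n, ∀ K : Set (Rd d), IsCompact K → ∃ C : ℝ, ∀ x ∈ K, w n x ≤ C
  mono : ∀ n x, w n x ≤ w (n + 1) x

/-- Condition (wM). -/
def WeakModerate (w : ℕ → Rd d → ℝ) : Prop :=
  ∀ n : ℕ, ∃ m : ℕ, n ≤ m ∧ ∃ C : ℝ, 0 < C ∧
    ∀ x y : Rd d, ‖y‖ ≤ 1 → w n (x + y) ≤ C * w m x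

/-! ### The multiplier space -/

/-- `f ∈ O_M(Ḃ_𝒱, E^∞_𝒲)`: for every `φ ∈ Ḃ_𝒱 = (L⁰)^∞_𝒱` the distribution `f · φ` is (given by)
an element `g` of `E^∞_𝒲`. -/
def MemOM {E : Type*} [NormedAddCommGroup E] [NormedSpace ℂ E] [CompleteSpace E]
    (B : SolidTIBF d E) (v w : ℕ → Rd d → ℝ) (f : Distr d) : Prop :=
  ∀ (φ : Rd d → ℂ) (hφ : (Lzero d).MemInfty v φ), ∃ g : Rd d → ℂ, B.space.MemInfty w g ∧
    ∀ θ : Test d, f (smoothMul φ hφ.contDiff θ) = ∫ x, g x * θ x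

/-! ### The momentwise decomposition factorization property -/

/-- `φ ∈ 𝒟(K)`. -/
def SuppIn (K : Set (Rd d)) (φ : Test d) : Prop := tsupport φ ⊆ K

/-- All moments of `ψ` of order less than `L` vanish. -/
def VanishingMoments (L : ℕ) (ψ : Test d) : Prop :=
  ∀ α : Fin d → ℕ, ∑ i, α i < L → ∫ x : Rd d, ((∏ i, x i ^ α i : ℝ) : ℂ) * ψ x = 0

/-- The momentwise decomposition factorization property of a pair of windows `(χ⁰, χ¹)`. -/
def HasMDFP (χ : Fin 2 → Test d) : Prop :=
  ∃ K : Set (Rd d), IsCompact K ∧ (interior K).Nonempty ∧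
    ∀ L : ℕ, ∃ φ ψ : Fin 2 → Test d,
      (∀ ℓ, SuppIn K (φ ℓ) ∧ SuppIn K (ψ ℓ) ∧ VanishingMoments L (ψ ℓ) ∧
        (φ ℓ, ψ ℓ) ≠ (0, 0)) ∧
      (∀ x : Rd d, (2 : ℂ) ^ d * φ 0 ((2 : ℝ) • x) - φ 0 x = Laplacian.laplacian (⇑(ψ 0)) x) ∧
      ∫ x, φ 0 x = 1 ∧
      (⇑(φ 0) = conv (χ 0) (φ 0) + conv (χ 1) (φ 1)) ∧
      (⇑(ψ 0) = conv (χ 0) (ψ 0) + conv (χ 1) (ψ 1))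

end MollifierOM

end

noncomputable section

namespace MollifierOM

variable {d : ℕ}

/-! All four conditions say that f is a smooth function F in the class `IsMultiplier`: for each n
there is m with F^(α) w_n / v_m in E_sl for all |α| ≤ n.

The estimates rest on `exists_wsl_le_of_sup`. A function controlled by local suprema of smooth
functions is controlled, by the Sobolev inequality, by local L¹ averages of their derivatives of up
to d further orders. Averaging is bounded on E (`exists_average_le`), and (wM) absorbs the shift of
the weights. Since φ_j has a support shrinking with j and an L¹ norm independent of j, this applies
to F^(α) * φ_j uniformly in j, which gives (ii). Rescaling then gives (iii) and (iv).

From (iv) back to a multiplier (`isMultiplier_of_bounded`): as 2^d φ⁰(2·) - φ⁰ = Δψ⁰, one has f *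
φ⁰_{j+1} - f * φ⁰_j = 4^{-j} Δ(f * ψ⁰_j), and the factorization gives f * ψ⁰_j = Σ_ℓ (f * χ^ℓ_j) *
ψ^ℓ_j. The L vanishing moments of ψ^ℓ trade L derivatives of f * χ^ℓ_j for a factor 2^{-jL}, which
beats the growth 2^{rj} once L ≥ r + 1. Because r does not depend on n, one L serves all n. The
telescoping series converges in every weighted norm, and its sum is f because ∫ φ⁰ = 1.

A multiplier satisfies (i) because E_sl · L⁰ ⊆ E (`norm_mul_lt_top`) and by the product rule.
Conversely, under (i), dividing f · φ₀ by a nowhere vanishing φ₀ in Ḃ_𝒱 shows that f is a smooth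
function F. If some derivative failed to satisfy the bound for every m, a gliding hump
(`exists_wsl_lt_top`) would build φ in Ḃ_𝒱, decaying slowly along suitable annuli, for which the
product leaves E. -/

/-! ### Iterated partial derivatives along lists of directions -/

/-- The iterated partial derivative along a list of coordinate directions. -/
def dl (l : List (Fin d)) (f : Rd d → ℂ) : Rd d → ℂ := l.foldr partialDeriv f

@[simp] theorem dl_nil (f : Rd d → ℂ) : dl [] f = f := rfl

@[simp] theorem dl_cons (i : Fin d) (l : List (Fin d)) (f : Rd d → ℂ) :
    dl (i :: l) f = partialDeriv i (dl l f) := rfl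

theorem dl_append (k l : List (Fin d)) (f : Rd d → ℂ) : dl (k ++ l) f = dl k (dl l f) := by
  simp [dl, List.foldr_append]

theorem contDiff_partialDeriv {f : Rd d → ℂ} (hf : ContDiff ℝ ∞ f) (i : Fin d) :
    ContDiff ℝ ∞ (partialDeriv i f) := by
  unfold partialDeriv
  exact (hf.fderiv_right (m := ∞) (by simp)).clm_apply contDiff_const

theorem contDiff_dl {f : Rd d → ℂ} (hf : ContDiff ℝ ∞ f) (l : List (Fin d)) :
    ContDiff ℝ ∞ (dl l f) := by
  induction l with
  | nil => exact hf
  | cons i l ih => exact contDiff_partialDeriv ih i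

theorem eq_sum_single (v : Rd d) : v = ∑ i, v i • EuclideanSpace.single i (1 : ℝ) := by
  ext j
  simp [Pi.single_apply]

theorem fderiv_apply_eq_sum (f : Rd d → ℂ) (x v : Rd d) :
    fderiv ℝ f x v = ∑ i, (v i : ℂ) * partialDeriv i f x := by
  conv_lhs => rw [eq_sum_single v]
  simp [partialDeriv, map_sum]

/-- The linear form `v ↦ ∑ i, v i * c i`. -/
def coordForm (c : Fin d → ℂ) : Rd d →L[ℝ] ℂ :=
  ∑ i, (EuclideanSpace.proj i : Rd d →L[ℝ] ℝ).smulRight (c i)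

theorem coordForm_apply (c : Fin d → ℂ) (v : Rd d) : coordForm c v = ∑ i, (v i : ℂ) * c i := by
  simp [coordForm]

theorem coordForm_single (c : Fin d → ℂ) (i : Fin d) :
    coordForm c (EuclideanSpace.single i 1) = c i := by
  have : ∀ x, ((if x = i then (1 : ℝ) else 0 : ℝ) : ℂ) * c x = if x = i then c x else 0 := by
    intro x; split_ifs <;> simp
  simp [coordForm_apply, this]

theorem fderiv_eq_coordForm (f : Rd d → ℂ) (x : Rd d) :
    fderiv ℝ f x = coordForm fun i => partialDeriv i f x := by
  ext v
  rw [fderiv_apply_eq_sum, coordForm_apply]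

theorem norm_coordForm_le (c : Fin d → ℂ) : ‖coordForm c‖ ≤ ∑ i, ‖c i‖ := by
  refine ContinuousLinearMap.opNorm_le_bound _ (Finset.sum_nonneg fun _ _ => norm_nonneg _) ?_
  intro v
  rw [coordForm_apply, Finset.sum_mul]
  refine (norm_sum_le _ _).trans (Finset.sum_le_sum fun i _ => ?_)
  rw [norm_mul, mul_comm, Complex.norm_real]
  exact mul_le_mul_of_nonneg_left (PiLp.norm_apply_le v i) (norm_nonneg _)

theorem partialDeriv_of_hasFDerivAt {f : Rd d → ℂ} {c : Fin d → ℂ} {x : Rd d}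
    (h : HasFDerivAt f (coordForm c) x) (i : Fin d) : partialDeriv i f x = c i := by
  rw [partialDeriv, h.fderiv, coordForm_single]

section Family

variable {G : List (Fin d) → Rd d → ℂ}

/-- The derivative of each member is assembled from members of the family, so induction on the order
gives smoothness. This serves both for f * φ and for limits of sequences of smooth functions. -/
theorem contDiff_of_family (hG : ∀ l x, HasFDerivAt (G l) (coordForm fun i => G (i :: l) x) x)
    (l : List (Fin d)) : ContDiff ℝ ∞ (G l) := by
  rw [contDiff_infty]
  intro n
  induction n generalizing l with
  | zero =>
    exact contDiff_zero.2 (continuous_iff_continuousAt.2 fun x => (hG l x).continuousAt)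
  | succ n ih =>
    rw [show ((n + 1 : ℕ) : WithTop ℕ∞) = (n : WithTop ℕ∞) + 1 by push_cast; rfl,
      contDiff_succ_iff_fderiv]
    refine ⟨fun x => (hG l x).differentiableAt, by simp, ?_⟩
    have : fderiv ℝ (G l) = fun x => ∑ i, (EuclideanSpace.proj i : Rd d →L[ℝ] ℝ).smulRight
        (G (i :: l) x) := funext fun x => (hG l x).fderiv
    rw [this]
    exact ContDiff.sum fun i _ => contDiff_const.smulRight (ih _)

theorem dl_family (hG : ∀ l x, HasFDerivAt (G l) (coordForm fun i => G (i :: l) x) x)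
    (k l : List (Fin d)) : dl k (G l) = G (k ++ l) := by
  induction k with
  | nil => rfl
  | cons i k ih =>
    rw [dl_cons, ih]
    exact funext fun x => partialDeriv_of_hasFDerivAt (hG _ x) i

end Family

theorem hasFDerivAt_coordForm {f : Rd d → ℂ} (hf : ContDiff ℝ ∞ f) (x : Rd d) :
    HasFDerivAt f (coordForm fun i => partialDeriv i f x) x := by
  rw [← fderiv_eq_coordForm]
  exact (hf.differentiable (by simp) x).hasFDerivAt

theorem partialDeriv_comm {f : Rd d → ℂ} (hf : ContDiff ℝ ∞ f) (i j : Fin d) :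
    partialDeriv i (partialDeriv j f) = partialDeriv j (partialDeriv i f) := by
  have h2 : Differentiable ℝ (fderiv ℝ f) :=
    (hf.fderiv_right (m := ∞) (by simp)).differentiable (by simp)
  have key : ∀ (i j : Fin d) (x : Rd d), partialDeriv i (partialDeriv j f) x =
      fderiv ℝ (fderiv ℝ f) x (EuclideanSpace.single i 1) (EuclideanSpace.single j 1) := by
    intro i j x
    have : HasFDerivAt (partialDeriv j f)
        ((fderiv ℝ (fderiv ℝ f) x).flip (EuclideanSpace.single j 1)) x :=
      ((ContinuousLinearMap.apply ℝ ℂ (EuclideanSpace.single j (1 : ℝ))).hasFDerivAt.comp x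
        (h2 x).hasFDerivAt)
    rw [partialDeriv, this.fderiv]
    rfl
  ext x
  rw [key, key]
  exact (hf.contDiffAt.isSymmSndFDerivAt (by simp; exact WithTop.coe_le_coe.2 le_top)) _ _

theorem dl_perm {f : Rd d → ℂ} (hf : ContDiff ℝ ∞ f) {k l : List (Fin d)} (h : k.Perm l) :
    dl k f = dl l f := by
  induction h with
  | nil => rfl
  | cons i _ ih => simp [ih]
  | swap i j l => exact partialDeriv_comm (contDiff_dl hf l) _ _
  | trans _ _ h1 h2 => exact h1.trans h2

/-- The list of directions of a multi-index. -/
def indexList (α : Fin d → ℕ) : List (Fin d) :=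
  (List.finRange d).flatMap fun i => List.replicate (α i) i

theorem dl_replicate (n : ℕ) (i : Fin d) (f : Rd d → ℂ) :
    dl (List.replicate n i) f = (partialDeriv i)^[n] f := by
  induction n with
  | zero => rfl
  | succ n ih => rw [List.replicate_succ, dl_cons, ih, Function.iterate_succ_apply']

theorem multiDeriv_eq_dl (α : Fin d → ℕ) (f : Rd d → ℂ) :
    multiDeriv α f = dl (indexList α) f := by
  unfold multiDeriv indexList
  induction List.finRange d with
  | nil => rfl
  | cons i l ih => rw [List.foldr_cons, List.flatMap_cons, dl_append, dl_replicate, ← ih]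

theorem length_indexList (α : Fin d → ℕ) : (indexList α).length = ∑ i, α i := by
  simp [indexList, List.length_flatMap, ← List.ofFn_eq_map, List.sum_ofFn]

theorem count_indexList (α : Fin d → ℕ) (i : Fin d) : (indexList α).count i = α i := by
  rw [indexList, List.count_flatMap]
  have : (List.count i ∘ fun j => List.replicate (α j) j) = fun j => if j = i then α j else 0 := by
    ext j
    simp [List.count_replicate]
  rw [this, ← List.ofFn_eq_map, List.sum_ofFn]
  simp

/-- The multi-index of a list of directions. -/
def listIndex (l : List (Fin d)) : Fin d → ℕ := fun i => l.count i

theorem sum_listIndex (l : List (Fin d)) : ∑ i, listIndex l i = l.length := by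
  rw [← length_indexList]
  exact (List.perm_iff_count.2 fun i => by rw [count_indexList]; rfl).length_eq

/-- Second derivatives are symmetric, so only the multiplicity of each direction matters. Lists are
kept as the working notation because composing derivatives is then concatenation. -/
theorem dl_eq_multiDeriv {f : Rd d → ℂ} (hf : ContDiff ℝ ∞ f) (l : List (Fin d)) :
    dl l f = multiDeriv (listIndex l) f := by
  rw [multiDeriv_eq_dl]
  exact dl_perm hf (List.perm_iff_count.2 fun i => by rw [count_indexList]; rfl)

/-! ### Rules for partial derivatives -/

theorem differentiable_of_smooth {f : Rd d → ℂ} (hf : ContDiff ℝ ∞ f) : Differentiable ℝ f :=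
  hf.differentiable (by simp)

theorem partialDeriv_add {f g : Rd d → ℂ} (hf : ContDiff ℝ ∞ f) (hg : ContDiff ℝ ∞ g)
    (i : Fin d) : partialDeriv i (f + g) = partialDeriv i f + partialDeriv i g := by
  ext x
  simp [partialDeriv, fderiv_add (differentiable_of_smooth hf x) (differentiable_of_smooth hg x)]

theorem partialDeriv_const_smul {f : Rd d → ℂ} (hf : ContDiff ℝ ∞ f) (c : ℂ)
    (i : Fin d) : partialDeriv i (c • f) = c • partialDeriv i f := by
  ext x
  simp [partialDeriv, fderiv_const_smul (differentiable_of_smooth hf x)]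

theorem partialDeriv_mul {f g : Rd d → ℂ} (hf : ContDiff ℝ ∞ f) (hg : ContDiff ℝ ∞ g)
    (i : Fin d) : partialDeriv i (f * g) = partialDeriv i f * g + f * partialDeriv i g := by
  ext x
  simp [partialDeriv, fderiv_mul (differentiable_of_smooth hf x) (differentiable_of_smooth hg x)]
  ring

theorem dl_add {f g : Rd d → ℂ} (hf : ContDiff ℝ ∞ f) (hg : ContDiff ℝ ∞ g)
    (l : List (Fin d)) : dl l (f + g) = dl l f + dl l g := by
  induction l with
  | nil => rfl
  | cons i l ih => simp [ih, partialDeriv_add (contDiff_dl hf l) (contDiff_dl hg l)]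

theorem dl_const_smul {f : Rd d → ℂ} (hf : ContDiff ℝ ∞ f) (c : ℂ)
    (l : List (Fin d)) : dl l (c • f) = c • dl l f := by
  induction l with
  | nil => rfl
  | cons i l ih => simp [ih, partialDeriv_const_smul (contDiff_dl hf l)]

theorem dl_sub {f g : Rd d → ℂ} (hf : ContDiff ℝ ∞ f) (hg : ContDiff ℝ ∞ g)
    (l : List (Fin d)) : dl l (f - g) = dl l f - dl l g := by
  have : f - g = f + (-1 : ℂ) • g := by simp [sub_eq_add_neg]
  rw [this, dl_add hf (by fun_prop), dl_const_smul hg]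
  simp [sub_eq_add_neg]

theorem dl_sum {ι : Type*} (s : Finset ι) {f : ι → Rd d → ℂ} (hf : ∀ i, ContDiff ℝ ∞ (f i))
    (l : List (Fin d)) : dl l (∑ i ∈ s, f i) = ∑ i ∈ s, dl l (f i) := by
  classical
  induction s using Finset.induction_on with
  | empty =>
    simp only [Finset.sum_empty]
    have := dl_const_smul (f := (0 : Rd d → ℂ)) contDiff_const 0 l
    simpa using this
  | insert a s ha ih =>
    rw [Finset.sum_insert ha, Finset.sum_insert ha, dl_add (hf a) _ l, ih]
    have : ContDiff ℝ ∞ (fun x => ∑ i ∈ s, f i x) := ContDiff.sum fun i _ => hf i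
    convert this using 1
    ext x; simp

/-! ### A pointwise Sobolev inequality -/

/-- The lists of directions of length `n`. -/
def listsEQ (d n : ℕ) : Finset (List (Fin d)) :=
  (Finset.univ : Finset (Fin n → Fin d)).image List.ofFn

theorem mem_listsEQ {n : ℕ} {l : List (Fin d)} : l ∈ listsEQ d n ↔ l.length = n := by
  constructor
  · intro h
    obtain ⟨a, -, rfl⟩ := Finset.mem_image.1 h
    simp
  · rintro rfl
    exact Finset.mem_image.2 ⟨l.get, Finset.mem_univ _, List.ofFn_get l⟩

/-- The lists of directions of length at most `n`. -/
def listsLE (d n : ℕ) : Finset (List (Fin d)) := (Finset.range (n + 1)).biUnion (listsEQ d)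

theorem mem_listsLE {n : ℕ} {l : List (Fin d)} : l ∈ listsLE d n ↔ l.length ≤ n := by
  simp [listsLE, mem_listsEQ]

/-- The fundamental theorem of calculus gives |g(y)| ≤ |g(s)| + ∫|g'| for every s; averaging over s
in an interval of length one gives the claim. -/
theorem enorm_le_lintegral_unitInterval {g g' : ℝ → ℂ} (hg : ∀ s, HasDerivAt g (g' s) s)
    (hg' : Continuous g') {y : ℝ} (hy : y ∈ Set.Icc (0 : ℝ) 1) :
    ‖g y‖ₑ ≤ ∫⁻ s in Set.Icc (0 : ℝ) 1, (‖g s‖ₑ + ‖g' s‖ₑ) := by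
  have hgc : Continuous g := continuous_iff_continuousAt.2 fun s => (hg s).continuousAt
  have key : ∀ s ∈ Set.Icc (0 : ℝ) 1,
      ‖g y‖ₑ ≤ ‖g s‖ₑ + ∫⁻ t in Set.Icc (0 : ℝ) 1, ‖g' t‖ₑ := by
    intro s hs
    have h1 : ∫ t in s..y, g' t = g y - g s :=
      intervalIntegral.integral_eq_sub_of_hasDerivAt (fun t _ => hg t)
        (hg'.intervalIntegrable _ _)
    have h2 : ‖g y - g s‖ₑ ≤ ∫⁻ t in Set.Icc (0 : ℝ) 1, ‖g' t‖ₑ := by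
      rw [← h1, ← ofReal_norm, intervalIntegral.norm_intervalIntegral_eq, ofReal_norm]
      refine (enorm_integral_le_lintegral_enorm _).trans (lintegral_mono_set ?_)
      exact Set.uIoc_subset_uIcc.trans (Set.uIcc_subset_Icc hs hy)
    calc ‖g y‖ₑ = ‖g s + (g y - g s)‖ₑ := by rw [add_sub_cancel]
      _ ≤ _ := (enorm_add_le _ _).trans (by gcongr)
  have h3 : ∫⁻ _ in Set.Icc (0 : ℝ) 1, ‖g y‖ₑ ≤ ∫⁻ s in Set.Icc (0 : ℝ) 1,
      (‖g s‖ₑ + ∫⁻ t in Set.Icc (0 : ℝ) 1, ‖g' t‖ₑ) :=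
    setLIntegral_mono' measurableSet_Icc key
  rw [lintegral_add_left (by fun_prop), setLIntegral_const, setLIntegral_const] at h3
  rw [lintegral_add_left (by fun_prop)]
  simpa using h3

/-- The sublists arising in the Sobolev inequality. -/
def sobolevLists : List (Fin d) → List (List (Fin d))
  | [] => [[]]
  | i :: l => sobolevLists l ++ (sobolevLists l).map (· ++ [i])

theorem length_le_of_mem_sobolevLists {l k : List (Fin d)} (h : k ∈ sobolevLists l) :
    k.length ≤ l.length := by
  induction l generalizing k with
  | nil => simp_all [sobolevLists]
  | cons i l ih =>
    simp only [sobolevLists, List.mem_append, List.mem_map] at h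
    rcases h with h | ⟨k', h, rfl⟩
    · exact (ih h).trans (by simp)
    · simpa using ih h

/-- The sum of the moduli of the derivatives along the Sobolev lists. -/
def sobolevSum (l : List (Fin d)) (u : Rd d → ℂ) (x : Rd d) : ℝ≥0∞ :=
  ((sobolevLists l).map fun k => ‖dl k u x‖ₑ).sum

theorem sobolevSum_cons (i : Fin d) (l : List (Fin d)) (u : Rd d → ℂ) (x : Rd d) :
    sobolevSum (i :: l) u x = sobolevSum l u x + sobolevSum l (partialDeriv i u) x := by
  simp only [sobolevSum, sobolevLists, List.map_append, List.sum_append, List.map_map]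
  congr 3
  ext k
  simp [dl_append]

theorem continuous_list_sum_enorm {u : Rd d → ℂ} (hu : ContDiff ℝ ∞ u) (L : List (List (Fin d))) :
    Continuous fun x => (L.map fun k => ‖dl k u x‖ₑ).sum := by
  induction L with
  | nil => simpa using continuous_const
  | cons k L ih =>
    simp only [List.map_cons, List.sum_cons]
    exact (contDiff_dl hu k).continuous.enorm.add ih

theorem sobolevSum_le {u : Rd d → ℂ} (l : List (Fin d)) (x : Rd d) :
    sobolevSum l u x ≤ (sobolevLists l).length * ∑ k ∈ listsLE d l.length, ‖dl k u x‖ₑ := by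
  unfold sobolevSum
  refine (List.sum_le_card_nsmul _ (∑ k ∈ listsLE d l.length, ‖dl k u x‖ₑ) ?_).trans ?_
  · intro a ha
    obtain ⟨k, hk, rfl⟩ := List.mem_map.1 ha
    exact Finset.single_le_sum (f := fun k => ‖dl k u x‖ₑ) (fun _ _ => zero_le)
      (mem_listsLE.2 (length_le_of_mem_sobolevLists hk))
  · simp

open Function in
theorem toLp_update (y : Fin d → ℝ) (i : Fin d) (s : ℝ) :
    (WithLp.toLp 2 (update y i s) : Rd d) =
      WithLp.toLp 2 y + (s - y i) • EuclideanSpace.single i 1 := by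
  ext j
  rcases eq_or_ne j i with rfl | h
  · simp
  · simp [h]

-- The one-dimensional inequality is applied in one coordinate after another. Each direction is used
-- once, so no derivative of order above the length of `l` appears; the marginal integral keeps the
-- untreated coordinates frozen at `y`.
open Function in
theorem enorm_le_lmarginal {l : List (Fin d)} (hl : l.Nodup) {u : Rd d → ℂ}
    (hu : ContDiff ℝ ∞ u) (x : Rd d) {y : Fin d → ℝ} (hy : ∀ i, y i ∈ Set.Icc (0 : ℝ) 1) :
    ‖u (x + WithLp.toLp 2 y)‖ₑ ≤
      (∫⋯∫⁻_l.toFinset, (fun y => sobolevSum l u (x + WithLp.toLp 2 y))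
        ∂(fun _ => (volume : Measure ℝ).restrict (Set.Icc 0 1))) y := by
  induction l generalizing u y with
  | nil => simp [sobolevSum, sobolevLists]
  | cons i l ih =>
    have hmeas : ∀ {u : Rd d → ℂ} (_ : ContDiff ℝ ∞ u) (l : List (Fin d)),
        Measurable fun y : Fin d → ℝ => sobolevSum l u (x + WithLp.toLp 2 y) := by
      intro u hu l
      refine Continuous.measurable ?_
      exact (continuous_list_sum_enorm hu (sobolevLists l)).comp
        (continuous_const.add (PiLp.continuous_toLp 2 _))
    rw [List.nodup_cons] at hl
    rw [List.toFinset_cons, lmarginal_insert _ (hmeas hu _) (by simpa using hl.1)]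
    have hder : ∀ s, HasDerivAt (fun s => u (x + WithLp.toLp 2 (update y i s)))
        (partialDeriv i u (x + WithLp.toLp 2 (update y i s))) s := by
      intro s
      have h1 : HasDerivAt (fun s : ℝ => x + (WithLp.toLp 2 (update y i s) : Rd d))
          (EuclideanSpace.single i 1) s := by
        simp_rw [toLp_update]
        have := (((hasDerivAt_id s).sub_const (y i)).smul_const
          (EuclideanSpace.single i (1 : ℝ) : Rd d)).const_add (WithLp.toLp 2 y) |>.const_add x
        simpa using this
      exact (differentiable_of_smooth hu _).hasFDerivAt.comp_hasDerivAt s h1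
    have hcont : Continuous fun s => partialDeriv i u (x + WithLp.toLp 2 (update y i s)) := by
      refine (contDiff_partialDeriv hu i).continuous.comp (continuous_const.add ?_)
      exact (PiLp.continuous_toLp 2 _).comp (continuous_const.update i continuous_id)
    have h2 := enorm_le_lintegral_unitInterval hder hcont (hy i)
    simp only [update_eq_self] at h2
    refine h2.trans (setLIntegral_mono' measurableSet_Icc fun s hs => ?_)
    have hy' : ∀ j, update y i s j ∈ Set.Icc (0 : ℝ) 1 := by
      intro j
      rcases eq_or_ne j i with rfl | h
      · simpa using hs
      · simpa [h] using hy j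
    refine (add_le_add (ih hl.2 hu hy') (ih hl.2 (contDiff_partialDeriv hu i) hy')).trans ?_
    simp only [lmarginal]
    rw [← lintegral_add_left]
    · simp_rw [sobolevSum_cons]
      exact le_rfl
    · exact (hmeas hu l).comp measurable_updateFinset

theorem norm_toLp_le {y : Fin d → ℝ} (hy : ∀ i, y i ∈ Set.Icc (0 : ℝ) 1) :
    ‖(WithLp.toLp 2 y : Rd d)‖ ≤ d := by
  rw [eq_sum_single (WithLp.toLp 2 y : Rd d)]
  refine (norm_sum_le _ _).trans ?_
  refine (Finset.sum_le_card_nsmul _ _ 1 fun i _ => ?_).trans (by simp)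
  have := hy i
  simp [norm_smul, abs_le]
  constructor <;> linarith [this.1, this.2]

/-- The constant of the Sobolev inequality. -/
def sobolevConst (d : ℕ) : ℕ := (sobolevLists (List.finRange d)).length

/-- The pointwise Sobolev inequality with derivatives of order at most `d` in `L¹`. -/
theorem enorm_le_lintegral_ball {u : Rd d → ℂ} (hu : ContDiff ℝ ∞ u) (x : Rd d) :
    ‖u x‖ₑ ≤ sobolevConst d *
      ∑ k ∈ listsLE d d, ∫⁻ y in Metric.closedBall x d, ‖dl k u y‖ₑ := by
  have h0 := enorm_le_lmarginal (List.nodup_finRange d) hu x (y := 0) (fun i => by simp)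
  have hfin : (List.finRange d).toFinset = Finset.univ := by ext; simp
  rw [hfin, lmarginal_univ, ← Measure.restrict_pi_pi, ← volume_pi] at h0
  simp only [WithLp.toLp_zero, add_zero] at h0
  refine h0.trans ?_
  set S : Set (Fin d → ℝ) := Set.univ.pi fun _ => Set.Icc (0 : ℝ) 1
  have hS : MeasurableSet S := MeasurableSet.univ_pi fun _ => measurableSet_Icc
  have hmeasE : Measurable fun z : Rd d => ∑ k ∈ listsLE d d, ‖dl k u z‖ₑ :=
    Finset.measurable_sum _ fun k _ => (contDiff_dl hu k).continuous.enorm.measurable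
  -- The cube x + [0,1]^d lies in the ball of radius d about x. Cutting off to that ball allows
  -- integration over the whole space, where translation and the change to the Euclidean structure
  -- preserve the measure.
  set H : Rd d → ℝ≥0∞ := (Metric.closedBall x d).indicator
    fun z => ∑ k ∈ listsLE d d, ‖dl k u z‖ₑ with hH
  have hHm : Measurable H := hmeasE.indicator measurableSet_closedBall
  have hH' : Measurable fun z => H (x + z) := hHm.comp (measurable_const_add x)
  calc ∫⁻ y in S, sobolevSum (List.finRange d) u (x + WithLp.toLp 2 y)
      ≤ ∫⁻ y in S, sobolevConst d * H (x + WithLp.toLp 2 y) := by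
        refine setLIntegral_mono' hS fun y hy => ?_
        have hmem : x + WithLp.toLp 2 y ∈ Metric.closedBall x (d : ℝ) := by
          simpa using norm_toLp_le fun i => hy i (Set.mem_univ i)
        rw [hH, Set.indicator_of_mem hmem]
        simpa [sobolevConst] using
          sobolevSum_le (u := u) (List.finRange d) (x + WithLp.toLp 2 y)
    _ ≤ ∫⁻ y : Fin d → ℝ, sobolevConst d * H (x + WithLp.toLp 2 y) := setLIntegral_le_lintegral _ _
    _ = ∫⁻ z : Rd d, sobolevConst d * H (x + z) :=
        (PiLp.volume_preserving_toLp (Fin d)).lintegral_comp (hH'.const_mul _)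
    _ = sobolevConst d * ∫⁻ z : Rd d, H z := by
        rw [lintegral_const_mul _ hH', lintegral_add_left_eq_self]
    _ = _ := by
        rw [hH, lintegral_indicator measurableSet_closedBall, lintegral_finsetSum]
        exact fun k _ => (contDiff_dl hu k).continuous.enorm.measurable

/-! ### Convolution of functions -/

theorem conv_apply (g h : Rd d → ℂ) (x : Rd d) : conv g h x = ∫ t, g t * h (x - t) := rfl

theorem conv_apply_swap (g h : Rd d → ℂ) (x : Rd d) : conv g h x = ∫ t, g (x - t) * h t := by
  rw [conv, convolution_eq_swap]
  rfl

theorem hasCompactSupport_partialDeriv {φ : Rd d → ℂ} (h : HasCompactSupport φ) (i : Fin d) :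
    HasCompactSupport (partialDeriv i φ) :=
  h.fderiv_apply (𝕜 := ℝ) _

theorem hasCompactSupport_dl {φ : Rd d → ℂ} (h : HasCompactSupport φ) (l : List (Fin d)) :
    HasCompactSupport (dl l φ) := by
  induction l with
  | nil => exact h
  | cons i l ih => exact hasCompactSupport_partialDeriv ih i

section Conv

variable {g φ : Rd d → ℂ}

theorem contDiff_conv (hg : LocallyIntegrable g volume) (hφ : ContDiff ℝ ∞ φ)
    (hc : HasCompactSupport φ) : ContDiff ℝ ∞ (conv g φ) :=
  hc.contDiff_convolution_right (𝕜 := ℝ) ((ContinuousLinearMap.mul ℝ ℂ)) hg hφ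

theorem partialDeriv_conv (hg : LocallyIntegrable g volume) (hφ : ContDiff ℝ ∞ φ)
    (hc : HasCompactSupport φ) (i : Fin d) :
    partialDeriv i (conv g φ) = conv g (partialDeriv i φ) := by
  ext x
  have h1 := hc.hasFDerivAt_convolution_right (𝕜 := ℝ) (ContinuousLinearMap.mul ℝ ℂ) hg
    (hφ.of_le (by simp)) x
  have h2 : HasFDerivAt (conv g φ) _ x := h1
  rw [partialDeriv, h2.fderiv, convolution_precompR_apply _ hg (hc.fderiv (𝕜 := ℝ))
    (hφ.continuous_fderiv (by simp))]
  rfl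

theorem dl_conv (hg : LocallyIntegrable g volume) (hφ : ContDiff ℝ ∞ φ)
    (hc : HasCompactSupport φ) (l : List (Fin d)) : dl l (conv g φ) = conv g (dl l φ) := by
  induction l with
  | nil => rfl
  | cons i l ih =>
    rw [dl_cons, ih, partialDeriv_conv hg (contDiff_dl hφ l) (hasCompactSupport_dl hc l), dl_cons]

theorem hasCompactSupport_refl (hc : HasCompactSupport φ) (x : Rd d) :
    HasCompactSupport fun t => φ (x - t) :=
  hc.comp_homeomorph (Homeomorph.subLeft x)

theorem integrable_mul_refl (hg : Continuous g) (hφ : Continuous φ) (hc : HasCompactSupport φ)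
    (x : Rd d) : Integrable fun t => g t * φ (x - t) :=
  Continuous.integrable_of_hasCompactSupport (by fun_prop) (hasCompactSupport_refl hc x).mul_left

theorem conv_partialDeriv (hg : ContDiff ℝ ∞ g) (hφ : ContDiff ℝ ∞ φ)
    (hc : HasCompactSupport φ) (i : Fin d) :
    conv g (partialDeriv i φ) = conv (partialDeriv i g) φ := by
  ext x
  have hd : ∀ t, HasFDerivAt (fun t => φ (x - t)) (-fderiv ℝ φ (x - t)) t := by
    intro t
    have := (differentiable_of_smooth hφ (x - t)).hasFDerivAt.comp t
      ((hasFDerivAt_id t).const_sub x)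
    rw [ContinuousLinearMap.comp_neg] at this
    exact this
  have he : ∀ t, fderiv ℝ (fun t => φ (x - t)) t (EuclideanSpace.single i 1) =
      -partialDeriv i φ (x - t) := by
    intro t
    rw [(hd t).fderiv]
    rfl
  have h := integral_mul_fderiv_eq_neg_fderiv_mul_of_integrable (μ := volume) (f := g)
    (g := fun t => φ (x - t)) (v := EuclideanSpace.single i (1 : ℝ))
    (integrable_mul_refl (contDiff_partialDeriv hg i).continuous hφ.continuous hc x) (by
      simp_rw [he]
      simpa using (integrable_mul_refl hg.continuous (contDiff_partialDeriv hφ i).continuous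
        (hasCompactSupport_partialDeriv hc i) x).neg)
    (integrable_mul_refl hg.continuous hφ.continuous hc x)
    (fun t _ => differentiable_of_smooth hg t) (fun t _ => (hd t).differentiableAt)
  simp_rw [he, mul_neg, integral_neg, neg_inj] at h
  exact h

/-- Integration by parts moves all derivatives onto `g`. Derivatives falling on φ_j would cost a
factor 2^j each and destroy uniformity in j. -/
theorem dl_conv_left (hg : ContDiff ℝ ∞ g) (hφ : ContDiff ℝ ∞ φ)
    (hc : HasCompactSupport φ) (l : List (Fin d)) : dl l (conv g φ) = conv (dl l g) φ := by
  induction l with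
  | nil => rfl
  | cons i l ih =>
    have hl := contDiff_dl hg l
    rw [dl_cons, ih, partialDeriv_conv hl.continuous.locallyIntegrable hφ hc,
      conv_partialDeriv hl hφ hc, dl_cons]

theorem exists_norm_conv_le (hφ : Continuous φ) (hc : HasCompactSupport φ) :
    ∃ A R : ℝ, 0 ≤ A ∧ 0 ≤ R ∧ ∀ (g : Rd d → ℂ) (x : Rd d) (M : ℝ),
      (∀ z, ‖z - x‖ ≤ R → ‖g z‖ ≤ M) → ‖conv g φ x‖ ≤ A * M := by
  obtain ⟨R, hR⟩ := hc.isCompact.isBounded.subset_closedBall 0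
  refine ⟨∫ t, ‖φ t‖, max R 0, by positivity, le_max_right _ _, fun g x M h => ?_⟩
  rw [conv_apply_swap, ← integral_mul_const]
  refine norm_integral_le_of_norm_le
    ((hφ.integrable_of_hasCompactSupport hc).norm.mul_const _) (.of_forall fun t => ?_)
  rw [norm_mul, mul_comm]
  by_cases ht : φ t = 0
  · simp [ht]
  · refine mul_le_mul_of_nonneg_left (h _ ?_) (norm_nonneg _)
    have := hR (subset_tsupport _ ht)
    rw [mem_closedBall_zero_iff] at this
    simpa using Or.inl this

end Conv

/-! ### Dilations -/

theorem dilate_apply (j : ℕ) (φ : Test d) (y : Rd d) :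
    dilate j φ y = (2 : ℂ) ^ (j * d) * φ ((2 : ℝ) ^ j • y) := rfl

theorem conv_dilate (g : Rd d → ℂ) (j : ℕ) (φ : Test d) (x : Rd d) :
    conv g (dilate j φ) x = ∫ t, g (x - ((2 : ℝ) ^ j)⁻¹ • t) * φ t := by
  rw [conv_apply_swap]
  have h := Measure.integral_comp_smul (volume : Measure (Rd d))
    (fun t => g (x - ((2 : ℝ) ^ j)⁻¹ • t) * φ t) ((2 : ℝ) ^ j)
  have h2 : ((2 : ℝ) ^ j) ≠ 0 := by positivity
  simp only [smul_smul, inv_mul_cancel₀ h2, one_smul, finrank_euclideanSpace_fin] at h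
  rw [abs_of_pos (by positivity)] at h
  calc ∫ t, g (x - t) * dilate j φ t
      = ∫ t, (2 : ℂ) ^ (j * d) * (g (x - t) * φ ((2 : ℝ) ^ j • t)) := by
        refine integral_congr_ae (.of_forall fun t => ?_)
        simp only [dilate_apply]
        ring
    _ = _ := by
        rw [integral_const_mul, h, Complex.real_smul, ← mul_assoc]
        convert one_mul _
        push_cast
        rw [pow_mul]
        field_simp

/-- After the substitution t ↦ 2^j t the kernel is φ itself and the displacement is 2^{-j} t, no
longer than t. Hence neither constant depends on j. -/
theorem exists_norm_conv_dilate_le (φ : Test d) :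
    ∃ A R : ℝ, 0 ≤ A ∧ 0 ≤ R ∧ ∀ (j : ℕ) (g : Rd d → ℂ) (x : Rd d) (M : ℝ),
      (∀ z, ‖z - x‖ ≤ R → ‖g z‖ ≤ M) → ‖conv g (dilate j φ) x‖ ≤ A * M := by
  obtain ⟨R, hR⟩ := φ.hasCompactSupport.isCompact.isBounded.subset_closedBall 0
  refine ⟨∫ t, ‖φ t‖, max R 0, by positivity, le_max_right _ _, fun j g x M h => ?_⟩
  rw [conv_dilate, ← integral_mul_const]
  refine norm_integral_le_of_norm_le ((φ.continuous.integrable_of_hasCompactSupport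
    φ.hasCompactSupport).norm.mul_const _) (.of_forall fun t => ?_)
  rw [norm_mul, mul_comm]
  by_cases ht : φ t = 0
  · simp [ht]
  · refine mul_le_mul_of_nonneg_left (h _ ?_) (norm_nonneg _)
    have := hR (subset_tsupport _ ht)
    rw [mem_closedBall_zero_iff] at this
    have h1 : ((2 : ℝ) ^ j)⁻¹ ≤ 1 := inv_le_one_of_one_le₀ (one_le_pow₀ (by norm_num))
    rw [sub_sub_cancel_left, norm_neg, norm_smul, Real.norm_of_nonneg (by positivity)]
    calc ((2 : ℝ) ^ j)⁻¹ * ‖t‖ ≤ 1 * ‖t‖ := by gcongr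
      _ ≤ max R 0 := by rw [one_mul]; exact this.trans (le_max_left _ _)

/-! ### Vanishing moments -/

/-- The monomial of a list of directions. -/
def listMonomial (l : List (Fin d)) (x : Rd d) : ℂ := (l.map fun i => (x i : ℂ)).prod

theorem listMonomial_eq (l : List (Fin d)) (x : Rd d) :
    listMonomial l x = ((∏ i, x i ^ listIndex l i : ℝ) : ℂ) := by
  rw [listMonomial, Finset.prod_list_map_count]
  push_cast
  refine Finset.prod_subset (Finset.subset_univ _) fun i _ hi => ?_
  rw [List.count_eq_zero_of_not_mem (by simpa using hi), pow_zero]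

/-- Induction on L replaces Taylor's formula. The derivative in the scale s of ∫ u(x - s t) ψ(t) dt
is -Σ_i ∫ ∂_i u(x - s t) t_i ψ(t) dt, and t_i ψ has one vanishing moment order less than ψ. At s = 0
the integral vanishes since ψ has mean zero, so the mean value inequality on [0, ε] yields the
missing factor ε. -/
theorem exists_norm_integral_le_pow (L : ℕ) {ψ : Rd d → ℂ} (hψ : Continuous ψ) {R : ℝ}
    (hR : 0 ≤ R) (hs : ∀ t, ψ t ≠ 0 → ‖t‖ ≤ R)
    (hm : ∀ l : List (Fin d), l.length < L → ∫ t, listMonomial l t * ψ t = 0) :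
    ∃ A : ℝ, 0 ≤ A ∧ ∀ {u : Rd d → ℂ} (_ : ContDiff ℝ ∞ u) (x : Rd d) (ε M : ℝ),
      0 ≤ ε → ε ≤ 1 → 0 ≤ M → (∀ l : List (Fin d), l.length = L → ∀ z, ‖z - x‖ ≤ R → ‖dl l u z‖ ≤ M) →
      ‖∫ t, u (x - ε • t) * ψ t‖ ≤ A * M * ε ^ L := by
  have hcomp : ∀ {ψ : Rd d → ℂ}, (∀ t, ψ t ≠ 0 → ‖t‖ ≤ R) → HasCompactSupport ψ := by
    intro ψ hs
    refine HasCompactSupport.intro (isCompact_closedBall 0 R) fun t ht => ?_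
    by_contra h
    exact ht (mem_closedBall_zero_iff.2 (hs t h))
  induction L generalizing ψ with
  | zero =>
    refine ⟨∫ t, ‖ψ t‖, by positivity, fun {u} _ x ε M h0 h1 hM h => ?_⟩
    rw [pow_zero, mul_one, ← integral_mul_const]
    refine norm_integral_le_of_norm_le ((hψ.integrable_of_hasCompactSupport
      (hcomp hs)).norm.mul_const _) (.of_forall fun t => ?_)
    rw [norm_mul, mul_comm]
    by_cases ht : ψ t = 0
    · simp [ht]
    · refine mul_le_mul_of_nonneg_left (h [] rfl _ ?_) (norm_nonneg _)
      rw [sub_sub_cancel_left, norm_neg, norm_smul, Real.norm_of_nonneg h0]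
      exact (mul_le_of_le_one_left (norm_nonneg _) h1).trans (hs t ht)
  | succ L ih =>
    have hcoord : ∀ i : Fin d, Continuous fun t : Rd d => (t i : ℂ) * ψ t := fun i =>
      (Complex.continuous_ofReal.comp (EuclideanSpace.proj (𝕜 := ℝ) i).continuous).mul hψ
    have hcs : ∀ (i : Fin d) (t : Rd d), (t i : ℂ) * ψ t ≠ 0 → ‖t‖ ≤ R := fun i t ht =>
      hs t (right_ne_zero_of_mul ht)
    have hstep : ∀ i : Fin d, ∃ A : ℝ, 0 ≤ A ∧ ∀ {u : Rd d → ℂ} (_ : ContDiff ℝ ∞ u) (x : Rd d)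
        (ε M : ℝ), 0 ≤ ε → ε ≤ 1 → 0 ≤ M →
        (∀ l : List (Fin d), l.length = L → ∀ z, ‖z - x‖ ≤ R → ‖dl l u z‖ ≤ M) →
        ‖∫ t, u (x - ε • t) * ((t i : ℂ) * ψ t)‖ ≤ A * M * ε ^ L := by
      intro i
      refine ih (hcoord i) (hcs i) fun l hl => ?_
      rw [← hm (i :: l) (by simpa using hl)]
      refine integral_congr_ae (.of_forall fun t => ?_)
      simp [listMonomial]
      ring
    choose A hA0 hA using hstep
    refine ⟨∑ i, A i, Finset.sum_nonneg fun i _ => hA0 i, fun {u} hu x ε M h0 h1 hM h => ?_⟩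
    have hψi : Integrable ψ := hψ.integrable_of_hasCompactSupport (hcomp hs)
    set F' : ℝ → Rd d → ℂ := fun s t =>
      -∑ i, partialDeriv i u (x - s • t) * ((t i : ℂ) * ψ t) with hF'
    have hint : ∀ (s : ℝ) (i : Fin d),
        Integrable fun t => partialDeriv i u (x - s • t) * ((t i : ℂ) * ψ t) := fun s i =>
      Continuous.integrable_of_hasCompactSupport
        (((contDiff_partialDeriv hu i).continuous.comp (by fun_prop)).mul (hcoord i))
        (hcomp (hcs i)).mul_left
    have hderiv : ∀ s : ℝ, HasDerivAt (fun s : ℝ => ∫ t, u (x - s • t) * ψ t)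
        (∫ t, F' s t) s := by
      intro s
      -- This ball contains x - s' t for all s' within distance 1 of s and all t in the support of
      -- ψ, so Q dominates the derivative near s.
      obtain ⟨Q, hQ⟩ := (isCompact_closedBall x ((|s| + 1) * R)).exists_bound_of_continuousOn
        (f := fun z => ∑ i, ‖partialDeriv i u z‖) (by
          refine Continuous.continuousOn (continuous_finsetSum _ fun i _ => ?_)
          exact (contDiff_partialDeriv hu i).continuous.norm)
      refine (hasDerivAt_integral_of_dominated_loc_of_deriv_le (Metric.ball_mem_nhds s one_pos)
        (F := fun (s : ℝ) t => u (x - s • t) * ψ t) (F' := F')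
        (bound := fun t => Q * R * ‖ψ t‖) ?_ ?_ ?_ ?_ (hψi.norm.const_mul _) ?_).2
      · exact .of_forall fun s => ((hu.continuous.comp (by fun_prop)).mul hψ).aestronglyMeasurable
      · exact Continuous.integrable_of_hasCompactSupport
          ((hu.continuous.comp (by fun_prop)).mul hψ) (hcomp hs).mul_left
      · exact (integrable_finsetSum _ fun i _ => hint s i).neg.aestronglyMeasurable
      · refine .of_forall fun t s' hs' => ?_
        by_cases ht : ψ t = 0
        · simp [hF', ht]
        · have htR := hs t ht
          have hmem : x - s' • t ∈ Metric.closedBall x ((|s| + 1) * R) := by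
            rw [mem_closedBall_iff_norm, sub_sub_cancel_left, norm_neg, norm_smul,
              Real.norm_eq_abs]
            have : |s'| ≤ |s| + 1 := by
              rw [Metric.mem_ball, Real.dist_eq] at hs'
              have := abs_sub_abs_le_abs_sub s' s
              linarith
            gcongr
          have hQ' := hQ _ hmem
          rw [Real.norm_of_nonneg (Finset.sum_nonneg fun i _ => norm_nonneg _)] at hQ'
          rw [hF', norm_neg]
          calc ‖∑ i, partialDeriv i u (x - s' • t) * ((t i : ℂ) * ψ t)‖
              ≤ ∑ i, ‖partialDeriv i u (x - s' • t)‖ * (R * ‖ψ t‖) := by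
                refine (norm_sum_le _ _).trans (Finset.sum_le_sum fun i _ => ?_)
                rw [norm_mul, norm_mul, Complex.norm_real]
                gcongr
                exact (PiLp.norm_apply_le t i).trans htR
            _ ≤ Q * R * ‖ψ t‖ := by
                rw [← Finset.sum_mul, mul_assoc]
                gcongr
      · refine .of_forall fun t s' _ => ?_
        have hl : HasDerivAt (fun s : ℝ => x - s • t) (-t) s' := by
          simpa using ((hasDerivAt_id s').smul_const t).const_sub x
        have := ((differentiable_of_smooth hu _).hasFDerivAt.comp_hasDerivAt s' hl).mul_const (ψ t)
        have he : fderiv ℝ u (x - s' • t) (-t) * ψ t = F' s' t := by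
          rw [fderiv_apply_eq_sum, hF', Finset.sum_mul]
          beta_reduce
          rw [← Finset.sum_neg_distrib]
          refine Finset.sum_congr rfl fun i _ => ?_
          simp
          ring
        rw [he] at this
        exact this
    have hbound : ∀ s ∈ Set.Ico (0 : ℝ) ε, ‖∫ t, F' s t‖ ≤ (∑ i, A i) * M * ε ^ L := by
      intro s hs'
      rw [hF', integral_neg, norm_neg, integral_finsetSum _ fun i _ => hint s i, Finset.sum_mul,
        Finset.sum_mul]
      refine (norm_sum_le _ _).trans (Finset.sum_le_sum fun i _ => ?_)
      refine (hA i (contDiff_partialDeriv hu i) x s M hs'.1 (hs'.2.le.trans h1) hM ?_).trans ?_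
      · intro l hl z hz
        have := h (l ++ [i]) (by simp [hl]) z hz
        rwa [dl_append] at this
      · have := hA0 i
        have := hs'.1
        have := hs'.2.le
        gcongr
    have hmv := norm_image_sub_le_of_norm_deriv_le_segment' (a := 0) (b := ε)
      (fun s _ => (hderiv s).hasDerivWithinAt) hbound ε ⟨h0, le_rfl⟩
    have hzero : ∫ t, u (x - (0 : ℝ) • t) * ψ t = 0 := by
      simp only [zero_smul, sub_zero]
      rw [integral_const_mul]
      have := hm [] (by simp)
      simp only [listMonomial, List.map_nil, List.prod_nil, one_mul] at this
      rw [this, mul_zero]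
    rw [hzero, sub_zero, sub_zero] at hmv
    rw [pow_succ, ← mul_assoc]
    exact hmv

theorem exists_norm_conv_dilate_le_of_vanishingMoments (L : ℕ) {ψ : Test d}
    (hψ : VanishingMoments L ψ) :
    ∃ A R : ℝ, 0 ≤ A ∧ 0 ≤ R ∧ ∀ (j : ℕ) {u : Rd d → ℂ} (_ : ContDiff ℝ ∞ u) (x : Rd d) (M : ℝ),
      0 ≤ M → (∀ l : List (Fin d), l.length = L → ∀ z, ‖z - x‖ ≤ R → ‖dl l u z‖ ≤ M) →
      ‖conv u (dilate j ψ) x‖ ≤ A * M * (((2 : ℝ) ^ j)⁻¹) ^ L := by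
  obtain ⟨R, hR⟩ := ψ.hasCompactSupport.isCompact.isBounded.subset_closedBall 0
  obtain ⟨A, hA0, hA⟩ := exists_norm_integral_le_pow L ψ.continuous (le_max_right R 0)
    (fun t ht => by
      have := hR (subset_tsupport _ ht)
      rw [mem_closedBall_zero_iff] at this
      exact this.trans (le_max_left _ _))
    (fun l hl => by
      rw [← hψ (listIndex l) (by rwa [sum_listIndex])]
      simp_rw [listMonomial_eq])
  refine ⟨A, max R 0, hA0, le_max_right _ _, fun j {u} hu x M hM h => ?_⟩
  rw [conv_dilate]
  exact hA hu x _ M (by positivity)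
    (inv_le_one_of_one_le₀ (one_le_pow₀ (by norm_num))) hM h

/-! ### Test functions -/

/-- A compactly supported smooth function as a test function. -/
def mkTest (φ : Rd d → ℂ) (hφ : ContDiff ℝ ∞ φ) (hc : HasCompactSupport φ) : Test d where
  toFun := φ
  contDiff' := hφ
  hasCompactSupport' := hc
  tsupport_subset' := Set.subset_univ _

theorem smooth_test (φ : Test d) : ContDiff ℝ ∞ φ := φ.contDiff

/-- The iterated partial derivative of a test function. -/
def dlTest (l : List (Fin d)) (φ : Test d) : Test d :=
  mkTest (dl l φ) (contDiff_dl (smooth_test φ) l) (hasCompactSupport_dl φ.hasCompactSupport l)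

@[simp] theorem coe_dlTest (l : List (Fin d)) (φ : Test d) : ⇑(dlTest l φ) = dl l φ := rfl

@[simp] theorem coe_reflTranslate (x : Rd d) (φ : Test d) :
    ⇑(reflTranslate x φ) = fun y => φ (x - y) := rfl

theorem partialDeriv_refl {φ : Rd d → ℂ} (hφ : ContDiff ℝ ∞ φ) (x : Rd d) (c : ℂ) (i : Fin d) :
    partialDeriv i (fun y => c * φ (x - y)) = fun y => (c * -1) * partialDeriv i φ (x - y) := by
  ext y
  have h := ((differentiable_of_smooth hφ (x - y)).hasFDerivAt.comp y
      ((hasFDerivAt_id y).const_sub x)).const_mul c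
  rw [ContinuousLinearMap.comp_neg] at h
  have h' : HasFDerivAt (fun y => c * φ (x - y)) _ y := h
  rw [partialDeriv, h'.fderiv]
  simp [partialDeriv]

theorem dl_refl {φ : Rd d → ℂ} (hφ : ContDiff ℝ ∞ φ) (x : Rd d) (l : List (Fin d)) :
    dl l (fun y => φ (x - y)) = fun y => (-1) ^ l.length * dl l φ (x - y) := by
  induction l with
  | nil => simp
  | cons i l ih => rw [dl_cons, ih, partialDeriv_refl (contDiff_dl hφ l), List.length_cons,
      pow_succ, dl_cons]

/-- The total derivative is a sum of fixed linear maps applied to the partial derivatives, so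
induction compares the seminorms defining the topology of 𝒟 with the partial derivatives used here.
-/
theorem exists_norm_iteratedFDeriv_le (n : ℕ) :
    ∃ A : ℝ, 0 ≤ A ∧ ∀ {φ : Rd d → ℂ} (_ : ContDiff ℝ ∞ φ) (M : ℝ) (x : Rd d),
      (∀ l : List (Fin d), l.length = n → ‖dl l φ x‖ ≤ M) →
        ‖iteratedFDeriv ℝ n φ x‖ ≤ A * M := by
  induction n with
  | zero =>
    refine ⟨1, zero_le_one, fun {φ} _ M x h => ?_⟩
    rw [norm_iteratedFDeriv_zero, one_mul]
    exact h [] rfl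
  | succ n ih =>
    obtain ⟨A, hA0, hA⟩ := ih
    set T : Fin d → ℂ →L[ℝ] (Rd d →L[ℝ] ℂ) := fun i =>
      ContinuousLinearMap.smulRightL ℝ (Rd d) ℂ (EuclideanSpace.proj i : Rd d →L[ℝ] ℝ) with hT
    refine ⟨∑ i, ‖T i‖ * A, by positivity, fun {φ} hφ M x h => ?_⟩
    have h1 : fderiv ℝ φ = fun y => ∑ i, (T i ∘ partialDeriv i φ) y := by
      ext y : 1
      rw [fderiv_eq_coordForm]
      rfl
    have h2 : ∀ i, ContDiff ℝ ∞ (T i ∘ partialDeriv i φ) := fun i =>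
      (T i).contDiff.comp (contDiff_partialDeriv hφ i)
    rw [← norm_iteratedFDeriv_fderiv, h1, iteratedFDeriv_fun_sum_apply
      fun i _ => ((h2 i).of_le (by exact_mod_cast le_top)).contDiffAt, Finset.sum_mul]
    refine (norm_sum_le _ _).trans (Finset.sum_le_sum fun i _ => ?_)
    rw [mul_assoc]
    refine ((T i).norm_iteratedFDeriv_comp_left (contDiff_partialDeriv hφ i).contDiffAt
      (by exact_mod_cast le_top)).trans ?_
    gcongr
    refine hA (contDiff_partialDeriv hφ i) M x fun l hl => ?_
    have := h (l ++ [i]) (by simp [hl])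
    rwa [dl_append] at this

/-- A distribution has finite order on compact sets: its restriction to 𝒟(K) is continuous, hence
dominated by finitely many of the defining seminorms. -/
theorem exists_distr_bound (f : Distr d) {K : Set (Rd d)} (hK : IsCompact K) :
    ∃ (N : ℕ) (C : ℝ), 0 ≤ C ∧ ∀ (θ : Test d) (M : ℝ), (∀ x, θ x ≠ 0 → x ∈ K) → 0 ≤ M →
      (∀ l : List (Fin d), l.length ≤ N → ∀ x, ‖dl l θ x‖ ≤ M) → ‖f θ‖ ≤ C * M := by
  set K' : TopologicalSpace.Compacts (Rd d) := ⟨K, hK⟩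
  have hK' : (K' : Set (Rd d)) ⊆ (⊤ : TopologicalSpace.Opens (Rd d)) := Set.subset_univ _
  set g := f.comp (TestFunction.ofSupportedInCLM ℂ hK')
  set q : Seminorm ℂ _ := (normSeminorm ℂ ℂ).comp g.toLinearMap with hq
  obtain ⟨s, C, -, hC⟩ := Seminorm.bound_of_continuous
    (ContDiffMapSupportedIn.withSeminorms ℂ (Rd d) ℂ ⊤ K') q (continuous_norm.comp g.continuous)
  choose A hA0 hA using fun n => exists_norm_iteratedFDeriv_le (d := d) n
  refine ⟨s.sup id, C * ∑ n ∈ s, A n,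
    mul_nonneg C.2 (Finset.sum_nonneg fun n _ => hA0 n), fun θ M hθ hM h => ?_⟩
  set θ' : ContDiffMapSupportedIn (Rd d) ℂ ⊤ K' :=
    ContDiffMapSupportedIn.of_support_subset (smooth_test θ) hθ
  have h1 := hC θ'
  have h2 : q θ' = ‖f θ‖ := rfl
  rw [h2, smul_apply] at h1
  refine h1.trans ?_
  rw [mul_assoc]
  refine mul_le_mul_of_nonneg_left ?_ C.2
  refine Seminorm.finset_sup_apply_le
    (mul_nonneg (Finset.sum_nonneg fun n _ => hA0 n) hM) fun n hn => ?_
  rw [ContDiffMapSupportedIn.seminorm_top_le_iff ℂ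
    (mul_nonneg (Finset.sum_nonneg fun n _ => hA0 n) hM)]
  intro x _
  refine (hA n (smooth_test θ) M x fun l hl =>
    h l (hl.le.trans (Finset.le_sup (f := id) hn)) x).trans ?_
  gcongr
  exact Finset.single_le_sum (f := A) (fun n _ => hA0 n) hn

theorem exists_support_bound (φ : Test d) : ∃ R : ℝ, 0 ≤ R ∧ ∀ x, φ x ≠ 0 → ‖x‖ ≤ R := by
  obtain ⟨R, hR⟩ := φ.hasCompactSupport.isCompact.isBounded.subset_closedBall 0
  refine ⟨max R 0, le_max_right _ _, fun x hx => ?_⟩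
  have := hR (subset_tsupport _ hx)
  rw [mem_closedBall_zero_iff] at this
  exact this.trans (le_max_left _ _)

/-! ### Smoothness of the convolution of a distribution and a test function -/

theorem exists_taylor_bound (φ : Test d) : ∃ Q : ℝ, 0 ≤ Q ∧ ∀ z h : Rd d,
    ‖φ (z + h) - φ z - ∑ i, (h i : ℂ) * partialDeriv i φ z‖ ≤ Q * ‖h‖ ^ 2 := by
  have h1 : ContDiff ℝ 1 (fderiv ℝ φ) :=
    ((smooth_test φ).fderiv_right (m := ∞) (by simp)).of_le (by simp)
  obtain ⟨Q, hQ⟩ := h1.lipschitzWith_of_hasCompactSupport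
    (φ.hasCompactSupport.fderiv (𝕜 := ℝ)) one_ne_zero
  refine ⟨Q, Q.2, fun z h => ?_⟩
  have := (convex_closedBall z ‖h‖).norm_image_sub_le_of_norm_fderiv_le' (𝕜 := ℝ) (f := φ)
    (φ := fderiv ℝ φ z) (C := Q * ‖h‖) (x := z) (y := z + h)
    (fun x _ => differentiable_of_smooth (smooth_test φ) x) (fun x hx => ?_)
    (by simp) (by simp)
  · rw [add_sub_cancel_left, fderiv_apply_eq_sum] at this
    rw [pow_two, ← mul_assoc]
    exact this
  · refine (hQ.norm_sub_le x z).trans ?_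
    rw [mem_closedBall_iff_norm] at hx
    gcongr

/-- The remainder of the first order Taylor expansion of a translate. -/
def taylorRemainder (φ : Test d) (x h : Rd d) : Test d :=
  reflTranslate (x + h) φ - reflTranslate x φ -
    ∑ i, (h i : ℂ) • reflTranslate x (dlTest [i] φ)

theorem taylorRemainder_apply (φ : Test d) (x h y : Rd d) :
    taylorRemainder φ x h y =
      φ (x - y + h) - φ (x - y) - ∑ i, (h i : ℂ) * partialDeriv i φ (x - y) := by
  have : ∀ s : Finset (Fin d), (∑ i ∈ s, (h i : ℂ) • reflTranslate x (dlTest [i] φ) : Test d) y =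
      ∑ i ∈ s, (h i : ℂ) * partialDeriv i φ (x - y) := by
    intro s
    classical
    induction s using Finset.induction_on with
    | empty => rfl
    | insert a s ha ih =>
      rw [Finset.sum_insert ha, Finset.sum_insert ha, ← ih]
      rfl
  rw [← this, ← add_sub_right_comm]
  rfl

/-- Differentiation commutes with taking Taylor remainders, up to the sign coming from the
reflection. The second order bound thus holds for every derivative of the remainder. -/
theorem dl_taylorRemainder (φ : Test d) (x h : Rd d) (l : List (Fin d)) (y : Rd d) :
    dl l (taylorRemainder φ x h) y = (-1) ^ l.length * taylorRemainder (dlTest l φ) x h y := by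
  have hs : ∀ i, ContDiff ℝ ∞ fun y => partialDeriv i φ (x - y) := fun i =>
    (contDiff_partialDeriv (smooth_test φ) i).comp (contDiff_const.sub contDiff_id)
  have h1 : ⇑(taylorRemainder φ x h) = (fun y => φ (x + h - y)) - (fun y => φ (x - y)) -
      ∑ i, (h i : ℂ) • fun y => partialDeriv i φ (x - y) := by
    ext y
    rw [taylorRemainder_apply, ← add_sub_right_comm]
    simp
  have hφ := smooth_test φ
  have ha : ∀ z, ContDiff ℝ ∞ fun y => φ (z - y) := fun z =>
    hφ.comp (contDiff_const.sub contDiff_id)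
  have hb : ContDiff ℝ ∞ (∑ i, (h i : ℂ) • fun y => partialDeriv i φ (x - y)) := by
    have : ContDiff ℝ ∞ fun y => ∑ i, ((h i : ℂ) • fun y => partialDeriv i φ (x - y)) y :=
      ContDiff.sum fun i _ => (hs i).const_smul (h i : ℂ)
    convert this using 1
    ext; simp
  have hc : ∀ i, ContDiff ℝ ∞ ((h i : ℂ) • fun y => partialDeriv i φ (x - y)) := fun i =>
    (hs i).const_smul (h i : ℂ)
  have hab : ContDiff ℝ ∞ ((fun y => φ (x + h - y)) - fun y => φ (x - y)) := (ha _).sub (ha _)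
  rw [h1, dl_sub hab hb, dl_sub (ha _) (ha _),
    dl_sum _ hc, dl_refl hφ, dl_refl hφ,
    taylorRemainder_apply]
  simp only [Pi.sub_apply, Finset.sum_apply, dl_const_smul (hs _), Pi.smul_apply, smul_eq_mul,
    dl_refl (contDiff_partialDeriv hφ _), coe_dlTest, mul_sub, Finset.mul_sum]
  rw [← add_sub_right_comm]
  congr 1
  refine Finset.sum_congr rfl fun i _ => ?_
  have : dl l (partialDeriv i φ) = partialDeriv i (dl l φ) := by
    have h3 := dl_perm hφ (k := l ++ [i]) (l := i :: l) (by simp)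
    rwa [dl_append, dl_cons] at h3
  rw [this]
  ring

/-- The linearization error of f * φ at x is f applied to the Taylor remainder. This remainder is
O(|h|²) together with its derivatives, with supports in one compact set, so finite order of f gives
the derivative. -/
theorem hasFDerivAt_distConv (f : Distr d) (φ : Test d) (x : Rd d) :
    HasFDerivAt (distConv f φ) (coordForm fun i => distConv f (dlTest [i] φ) x) x := by
  obtain ⟨R, hR0, hR⟩ := exists_support_bound φ
  -- The additional 1 leaves room for the translations by h with |h| ≤ 1.
  obtain ⟨N, C, hC0, hC⟩ := exists_distr_bound f (isCompact_closedBall x (R + 1))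
  choose Q hQ0 hQ using fun l : List (Fin d) => exists_taylor_bound (dlTest l φ)
  set Q' := ∑ l ∈ listsLE d N, Q l
  have hQ'0 : 0 ≤ Q' := Finset.sum_nonneg fun l _ => hQ0 l
  have hf : ∀ h : Rd d, f (taylorRemainder φ x h) = distConv f φ (x + h) - distConv f φ x -
      coordForm (fun i => distConv f (dlTest [i] φ) x) h := by
    intro h
    rw [coordForm_apply, taylorRemainder, map_sub, map_sub, map_sum]
    simp only [map_smul]
    rfl
  have hbd : ∀ h : Rd d, ‖h‖ ≤ 1 → ‖f (taylorRemainder φ x h)‖ ≤ C * Q' * ‖h‖ ^ 2 := by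
    intro h hh
    rw [mul_assoc]
    refine hC _ _ (fun y hy => ?_) (by positivity) fun l hl y => ?_
    · by_contra hy'
      rw [mem_closedBall_iff_norm, not_le, ← norm_neg, neg_sub] at hy'
      apply hy
      have h0 : ∀ z, R < ‖z‖ → φ z = 0 := fun z hz => by
        by_contra h'
        exact absurd (hR z h') (not_le.2 hz)
      have h3 : φ =ᶠ[nhds (x - y)] fun _ => 0 := by
        filter_upwards [(isOpen_lt continuous_const continuous_norm).mem_nhds
          (show R < ‖x - y‖ by linarith)] with z hz using h0 z hz
      have h4 : R < ‖x - y + h‖ := by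
        have := norm_sub_le (x - y + h) h
        rw [add_sub_cancel_right] at this
        linarith
      rw [taylorRemainder_apply, h0 _ h4, h3.self_of_nhds]
      have h5 : ∀ i, partialDeriv i φ (x - y) = 0 := by
        intro i
        rw [partialDeriv, h3.fderiv_eq]
        simp
      simp [h5]
    · rw [dl_taylorRemainder, norm_mul, norm_pow, norm_neg, norm_one, one_pow, one_mul,
        taylorRemainder_apply]
      refine (hQ l (x - y) h).trans ?_
      gcongr
      exact Finset.single_le_sum (f := Q) (fun l _ => hQ0 l) (mem_listsLE.2 hl)
  rw [hasFDerivAt_iff_isLittleO_nhds_zero]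
  simp_rw [← hf]
  refine Asymptotics.IsBigO.trans_isLittleO (g := fun h : Rd d => ‖h‖ ^ 2) ?_
    (Asymptotics.isLittleO_norm_pow_id one_lt_two)
  refine Asymptotics.IsBigO.of_bound (C * Q') ?_
  filter_upwards [Metric.closedBall_mem_nhds (0 : Rd d) one_pos] with h hh
  rw [norm_pow, norm_norm]
  exact hbd h (mem_closedBall_zero_iff.1 hh)

theorem contDiff_distConv (f : Distr d) (φ : Test d) : ContDiff ℝ ∞ (distConv f φ) :=
  contDiff_of_family (G := fun l => distConv f (dlTest l φ))
    (fun _ x => hasFDerivAt_distConv f _ x) []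

theorem dl_distConv (f : Distr d) (φ : Test d) (l : List (Fin d)) :
    dl l (distConv f φ) = distConv f (dlTest l φ) := by
  have := dl_family (G := fun l => distConv f (dlTest l φ))
    (fun _ x => hasFDerivAt_distConv f _ x) l []
  rwa [List.append_nil] at this

/-! ### Pairing of the convolution with a test function -/

theorem hasCompactSupport_conv {φ θ : Rd d → ℂ} (hφ : HasCompactSupport φ)
    (hθ : HasCompactSupport θ) : HasCompactSupport (conv φ θ) :=
  HasCompactSupport.convolution _ hφ hθ

/-- The test function `y ↦ ∫ φ(x - y) θ(x) dx`. -/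
def corr (φ θ : Test d) : Test d :=
  mkTest (conv θ (reflTranslate 0 φ))
    (contDiff_conv θ.continuous.locallyIntegrable (smooth_test _)
      (reflTranslate 0 φ).hasCompactSupport)
    (hasCompactSupport_conv θ.hasCompactSupport (reflTranslate 0 φ).hasCompactSupport)

theorem coe_corr (φ θ : Test d) : ⇑(corr φ θ) = conv θ (reflTranslate 0 φ) := rfl

theorem dl_corr (φ θ : Test d) (l : List (Fin d)) (y : Rd d) :
    dl l (corr φ θ) y = ∫ x, θ x * ((-1) ^ l.length * dl l φ (x - y)) := by
  rw [coe_corr, dl_conv θ.continuous.locallyIntegrable (smooth_test _)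
    (reflTranslate 0 φ).hasCompactSupport, coe_reflTranslate, dl_refl (smooth_test φ), conv_apply]
  simp

/-- All derivatives of order at most `N` of a test function. -/
def jetMap (d N : ℕ) :
    Test d →ₗ[ℂ] ({l : List (Fin d) // l ∈ listsLE d N} → BoundedContinuousFunction (Rd d) ℂ) where
  toFun θ l := (dlTest l.1 θ : BoundedContinuousFunction (Rd d) ℂ)
  map_add' θ θ' := by
    ext l x
    exact congrFun (dl_add (smooth_test θ) (smooth_test θ') l.1) x
  map_smul' c θ := by
    ext l x
    exact congrFun (dl_const_smul (smooth_test θ) c l.1) x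

theorem jetMap_apply {N : ℕ} (θ : Test d) (l : {l : List (Fin d) // l ∈ listsLE d N})
    (x : Rd d) : jetMap d N θ l x = dl l.1 θ x := rfl

/-- Finite order makes f bounded on the jets of functions in 𝒟(K), and Hahn–Banach extends it to a
Banach space of tuples of bounded continuous functions. There f can be interchanged with a Bochner
integral, which is the purpose of the extension. -/
theorem exists_extension (f : Distr d) {K : Set (Rd d)} (hK : IsCompact K) :
    ∃ (N : ℕ) (F : ({l : List (Fin d) // l ∈ listsLE d N} →
        BoundedContinuousFunction (Rd d) ℂ) →L[ℂ] ℂ),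
      ∀ θ : Test d, (∀ x, θ x ≠ 0 → x ∈ K) → f θ = F (jetMap d N θ) := by
  obtain ⟨N, C, hC0, hC⟩ := exists_distr_bound f hK
  set D : Submodule ℂ (Test d) :=
    { carrier := {θ | ∀ x, θ x ≠ 0 → x ∈ K}
      add_mem' := by
        intro a b ha hb x hx
        by_contra hxK
        apply hx
        have h1 : a x = 0 := by_contra fun h => hxK (ha x h)
        have h2 : b x = 0 := by_contra fun h => hxK (hb x h)
        change a x + b x = 0
        rw [h1, h2, add_zero]
      zero_mem' := fun x hx => absurd rfl hx
      smul_mem' := by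
        intro c a ha x hx
        exact ha x fun h => hx (by change c * a x = 0; rw [h, mul_zero]) }
  set J := (jetMap d N).comp D.subtype
  have hJ : Function.Injective J := by
    intro a b hab
    have h1 := congrFun hab ⟨[], mem_listsLE.2 (by simp)⟩
    refine Subtype.ext (TestFunction.ext fun x => ?_)
    exact DFunLike.congr_fun h1 x
  set e := LinearEquiv.ofInjective J hJ
  have hb : ∀ z, ‖(f.toLinearMap.comp (D.subtype.comp e.symm.toLinearMap)) z‖ ≤ C * ‖z‖ := by
    intro z
    obtain ⟨θ, rfl⟩ := e.surjective z
    have : (f.toLinearMap.comp (D.subtype.comp e.symm.toLinearMap)) (e θ) = f θ.1 := by simp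
    rw [this]
    refine hC θ.1 _ θ.2 (norm_nonneg _) fun l hl x => ?_
    calc ‖dl l θ.1 x‖ = ‖jetMap d N θ.1 ⟨l, mem_listsLE.2 hl⟩ x‖ := rfl
      _ ≤ ‖jetMap d N θ.1 ⟨l, mem_listsLE.2 hl⟩‖ :=
        BoundedContinuousFunction.norm_coe_le_norm _ _
      _ ≤ ‖jetMap d N θ.1‖ := norm_le_pi_norm _ _
  obtain ⟨F, hF, -⟩ := exists_extension_norm_eq _ (LinearMap.mkContinuous _ C hb)
  refine ⟨N, F, fun θ hθ => ?_⟩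
  have := hF (e ⟨θ, hθ⟩)
  simp only [LinearMap.mkContinuous_apply, LinearMap.comp_apply, LinearEquiv.coe_coe,
    LinearEquiv.symm_apply_apply] at this
  exact this.symm

theorem continuous_jetMap_reflTranslate (N : ℕ) (φ : Test d) :
    Continuous fun x => jetMap d N (reflTranslate x φ) := by
  refine continuous_pi fun l => ?_
  have h1 : ContDiff ℝ 1 (dl l.1 φ) := (contDiff_dl (smooth_test φ) l.1).of_le (by simp)
  obtain ⟨Q, hQ⟩ := h1.lipschitzWith_of_hasCompactSupport
    (hasCompactSupport_dl φ.hasCompactSupport l.1) one_ne_zero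
  refine (LipschitzWith.of_dist_le_mul (K := Q) fun x x' => ?_).continuous
  rw [BoundedContinuousFunction.dist_le (by positivity)]
  intro y
  rw [jetMap_apply, jetMap_apply, coe_reflTranslate, coe_reflTranslate, dl_refl (smooth_test φ),
    dl_refl (smooth_test φ), dist_eq_norm, ← mul_sub, norm_mul, norm_pow, norm_neg, norm_one,
    one_pow, one_mul]
  refine (hQ.norm_sub_le _ _).trans ?_
  rw [sub_sub_sub_cancel_right, dist_eq_norm]

/-- Both sides are the extended functional applied to the Bochner integral of x ↦ θ(x) times the jet
of φ(x - ·). Evaluation at points commutes with the integral and identifies it with the jet of `corr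
φ θ`. -/
theorem integral_distConv_mul (f : Distr d) (φ θ : Test d) :
    ∫ x, distConv f φ x * θ x = f (corr φ θ) := by
  obtain ⟨R, hR0, hR⟩ := exists_support_bound φ
  obtain ⟨S, hS0, hS⟩ := exists_support_bound θ
  -- If θ(x) and φ(x - y) are both nonzero then |y| ≤ R + S.
  obtain ⟨N, F, hF⟩ := exists_extension f (isCompact_closedBall (0 : Rd d) (R + S))
  have hΦ : ∀ x, distConv f φ x * θ x = F (θ x • jetMap d N (reflTranslate x φ)) := by
    intro x
    rw [← map_smul, ← hF, map_smul, smul_eq_mul, mul_comm]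
    · rfl
    · intro y hy
      have h1 : θ x * φ (x - y) ≠ 0 := hy
      have h2 := hS x (left_ne_zero_of_mul h1)
      have h3 := hR _ (right_ne_zero_of_mul h1)
      rw [mem_closedBall_zero_iff]
      have := norm_sub_le x (x - y)
      rw [sub_sub_cancel] at this
      linarith
  have hint : Integrable fun x => θ x • jetMap d N (reflTranslate x φ) :=
    (θ.continuous.smul (continuous_jetMap_reflTranslate N φ)).integrable_of_hasCompactSupport
      θ.hasCompactSupport.smul_right
  simp_rw [hΦ]
  rw [F.integral_comp_comm hint, hF (corr φ θ)]
  · congr 1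
    ext l y
    rw [jetMap_apply, dl_corr]
    set ev := (BoundedContinuousFunction.evalCLM ℂ y).comp
      (ContinuousLinearMap.proj (R := ℂ) (φ := fun _ : {l : List (Fin d) // l ∈ listsLE d N} =>
        BoundedContinuousFunction (Rd d) ℂ) l)
    have := ev.integral_comp_comm hint
    refine this.symm.trans (integral_congr_ae (.of_forall fun x => ?_))
    change θ x * jetMap d N (reflTranslate x φ) l y = _
    rw [jetMap_apply, coe_reflTranslate, dl_refl (smooth_test φ)]
  · intro y hy
    rw [mem_closedBall_zero_iff]
    by_contra hlt
    apply hy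
    have := dl_corr φ θ [] y
    simp only [dl_nil, List.length_nil, pow_zero, one_mul] at this
    rw [this]
    refine integral_eq_zero_of_ae (.of_forall fun x => ?_)
    by_contra h1
    have h2 := hS x (left_ne_zero_of_mul h1)
    have h3 := hR _ (right_ne_zero_of_mul h1)
    have := norm_sub_le x (x - y)
    rw [sub_sub_cancel] at this
    exact hlt (by linarith)

/-- Associativity (f * φ) * ψ = f * (φ * ψ) is the pairing formula with the test function ψ(x - ·).
-/
theorem conv_distConv (f : Distr d) (φ ψ η : Test d) (h : ⇑η = conv φ ψ) :
    conv (distConv f φ) ψ = distConv f η := by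
  ext x
  have h1 := integral_distConv_mul f φ (reflTranslate x ψ)
  rw [conv_apply]
  refine h1.trans ?_
  rw [distConv]
  congr 1
  refine TestFunction.ext fun y => ?_
  rw [coe_reflTranslate, h, coe_corr, conv_apply]
  beta_reduce
  rw [conv_apply_swap]
  simp only [coe_reflTranslate, zero_sub, neg_sub]
  rw [← integral_sub_left_eq_self _ volume x]
  refine integral_congr_ae (.of_forall fun t => ?_)
  simp only [sub_sub_cancel]
  rw [mul_comm, sub_right_comm]

/-! ### Linearity and dilation rules -/

/-- `φ ↦ φ (x - ·)` as a linear map. -/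
def reflLM (x : Rd d) : Test d →ₗ[ℂ] Test d where
  toFun := reflTranslate x
  map_add' _ _ := rfl
  map_smul' _ _ := rfl

theorem distConv_eq (f : Distr d) (φ : Test d) (x : Rd d) : distConv f φ x = f (reflLM x φ) := rfl

theorem distConv_add (f : Distr d) (φ ψ : Test d) :
    distConv f (φ + ψ) = distConv f φ + distConv f ψ := by
  ext x
  simp [distConv_eq]

theorem distConv_smul_sum (f : Distr d) {ι : Type*} (s : Finset ι) (c : ℂ) (φ : ι → Test d) :
    distConv f (c • ∑ i ∈ s, φ i) = c • ∑ i ∈ s, distConv f (φ i) := by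
  ext x
  simp [distConv_eq]

theorem conv_dilate_dilate (j : ℕ) (φ ψ : Test d) (x : Rd d) :
    conv (dilate j φ) (dilate j ψ) x = (2 : ℂ) ^ (j * d) * conv φ ψ ((2 : ℝ) ^ j • x) := by
  rw [conv_dilate, conv_apply_swap, ← integral_const_mul]
  refine integral_congr_ae (.of_forall fun t => ?_)
  have h2 : ((2 : ℝ) ^ j) ≠ 0 := by positivity
  simp only [dilate_apply, smul_sub, smul_smul, mul_inv_cancel₀ h2, one_smul]
  ring

/-- The convolution of two test functions as a test function. -/
def convTest (φ ψ : Test d) : Test d :=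
  mkTest (conv φ ψ)
    (contDiff_conv φ.continuous.locallyIntegrable (smooth_test _) ψ.hasCompactSupport)
    (hasCompactSupport_conv φ.hasCompactSupport ψ.hasCompactSupport)

theorem coe_convTest (φ ψ : Test d) : ⇑(convTest φ ψ) = conv φ ψ := rfl

theorem distConv_dilate_factor (f : Distr d) (j : ℕ) {χ ψ : Fin 2 → Test d} {η : Test d}
    (h : ⇑η = conv (χ 0) (ψ 0) + conv (χ 1) (ψ 1)) :
    distConv f (dilate j η) = ∑ ℓ, conv (distConv f (dilate j (χ ℓ))) (dilate j (ψ ℓ)) := by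
  have h1 : dilate j η = convTest (dilate j (χ 0)) (dilate j (ψ 0)) +
      convTest (dilate j (χ 1)) (dilate j (ψ 1)) := by
    refine TestFunction.ext fun x => ?_
    change _ = conv (dilate j (χ 0)) (dilate j (ψ 0)) x +
      conv (dilate j (χ 1)) (dilate j (ψ 1)) x
    rw [conv_dilate_dilate, conv_dilate_dilate, dilate_apply, h, ← mul_add]
    rfl
  rw [h1, distConv_add, Fin.sum_univ_two, conv_distConv f _ _ _ (coe_convTest _ _),
    conv_distConv f _ _ _ (coe_convTest _ _)]

theorem partialDeriv_dilate {ψ : Rd d → ℂ} (hψ : ContDiff ℝ ∞ ψ) (c : ℂ) (s : ℝ) (i : Fin d) :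
    partialDeriv i (fun y => c * ψ (s • y)) = fun y => (c * s) * partialDeriv i ψ (s • y) := by
  ext y
  have h : HasFDerivAt (fun y => c * ψ (s • y)) _ y :=
    ((differentiable_of_smooth hψ (s • y)).hasFDerivAt.comp y
      ((hasFDerivAt_id y).const_smul s)).const_mul c
  rw [partialDeriv, h.fderiv]
  simp [partialDeriv]
  ring

theorem laplacian_eq_sum {ψ : Rd d → ℂ} (hψ : ContDiff ℝ ∞ ψ) (x : Rd d) :
    Laplacian.laplacian ψ x = ∑ i, dl [i, i] ψ x := by
  rw [InnerProductSpace.laplacian_eq_iteratedFDeriv_orthonormalBasis ψ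
    (EuclideanSpace.basisFun (Fin d) ℝ)]
  refine Finset.sum_congr rfl fun i _ => ?_
  have h2 : Differentiable ℝ (fderiv ℝ ψ) :=
    (hψ.fderiv_right (m := ∞) (by simp)).differentiable (by simp)
  have h3 : HasFDerivAt (partialDeriv i ψ)
      ((ContinuousLinearMap.apply ℝ ℂ (EuclideanSpace.single i (1 : ℝ))).comp
        (fderiv ℝ (fderiv ℝ ψ) x)) x :=
    (ContinuousLinearMap.apply ℝ ℂ (EuclideanSpace.single i (1 : ℝ))).hasFDerivAt.comp x
      (h2 x).hasFDerivAt
  rw [iteratedFDeriv_two_apply, dl_cons, dl_cons, dl_nil, partialDeriv, h3.fderiv]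
  simp

/-- The dilation of the refinement identity; the factor 4^{-j} appears because Δ(ψ_j) = 4^j (Δψ)_j.
-/
theorem dilate_succ_eq {φ ψ : Test d}
    (h : ∀ x : Rd d, (2 : ℂ) ^ d * φ ((2 : ℝ) • x) - φ x = Laplacian.laplacian (⇑ψ) x) (j : ℕ) :
    dilate (j + 1) φ =
      dilate j φ + ((4 : ℂ) ^ j)⁻¹ • ∑ i, dlTest [i, i] (dilate j ψ) := by
  refine TestFunction.ext fun y => ?_
  have hsum : ∀ s : Finset (Fin d), (∑ i ∈ s, dlTest [i, i] (dilate j ψ) : Test d) y =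
      ∑ i ∈ s, dl [i, i] (dilate j ψ) y := by
    intro s
    classical
    induction s using Finset.induction_on with
    | empty => rfl
    | insert a s ha ih =>
      rw [Finset.sum_insert ha, Finset.sum_insert ha, ← ih]
      rfl
  have h1 : ∀ i, dl [i, i] (dilate j ψ) y =
      (4 : ℂ) ^ j * ((2 : ℂ) ^ (j * d) * dl [i, i] ψ ((2 : ℝ) ^ j • y)) := by
    intro i
    have hc : ⇑(dilate j ψ) = fun y => (2 : ℂ) ^ (j * d) * ψ ((2 : ℝ) ^ j • y) := rfl
    rw [dl_cons, dl_cons, dl_nil, hc, partialDeriv_dilate (smooth_test ψ),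
      partialDeriv_dilate (contDiff_partialDeriv (smooth_test ψ) i)]
    have h4 : (4 : ℂ) ^ j = 2 ^ j * 2 ^ j := by rw [← mul_pow]; norm_num
    rw [h4, dl_cons, dl_cons, dl_nil]
    push_cast
    ring
  change _ = dilate j φ y + ((4 : ℂ) ^ j)⁻¹ * (∑ i, dlTest [i, i] (dilate j ψ) : Test d) y
  rw [hsum]
  simp_rw [h1]
  rw [← Finset.mul_sum, ← Finset.mul_sum, inv_mul_cancel_left₀ (pow_ne_zero _ (by norm_num)),
    ← laplacian_eq_sum (smooth_test ψ), ← h, dilate_apply, dilate_apply, smul_smul, pow_succ' 2 j,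
    add_mul, one_mul, pow_add]
  ring

theorem distConv_dilate_succ (f : Distr d) {φ ψ : Test d}
    (h : ∀ x : Rd d, (2 : ℂ) ^ d * φ ((2 : ℝ) • x) - φ x = Laplacian.laplacian (⇑ψ) x) (j : ℕ) :
    distConv f (dilate (j + 1) φ) = distConv f (dilate j φ) +
      ((4 : ℂ) ^ j)⁻¹ • ∑ i, dl [i, i] (distConv f (dilate j ψ)) := by
  simp_rw [dilate_succ_eq h, distConv_add, distConv_smul_sum, dl_distConv]

/-! ### Approximation of a distribution -/

/-- By the pairing formula f is tested on `corr (dilate j φ) θ`, which tends to θ: the supports stay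
in one ball, and since ∫ φ = 1 and each derivative of θ is Lipschitz, every derivative converges
uniformly at rate 2^{-j}. -/
theorem tendsto_integral_distConv (f : Distr d) {φ : Test d} (hφ : ∫ x, φ x = 1) (θ : Test d) :
    Filter.Tendsto (fun j => ∫ x, distConv f (dilate j φ) x * θ x) Filter.atTop
      (nhds (f θ)) := by
  simp_rw [integral_distConv_mul]
  obtain ⟨R, hR0, hR⟩ := exists_support_bound φ
  obtain ⟨S, hS0, hS⟩ := exists_support_bound θ
  obtain ⟨N, C, hC0, hC⟩ := exists_distr_bound f (isCompact_closedBall (0 : Rd d) (R + S))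
  have hlip : ∀ l : List (Fin d), ∃ Q : ℝ≥0, LipschitzWith Q (dl l θ) := fun l =>
    ((contDiff_dl (smooth_test θ) l).of_le (by simp)).lipschitzWith_of_hasCompactSupport
      (𝕂 := ℝ) (n := 1) (hasCompactSupport_dl θ.hasCompactSupport l) one_ne_zero
  choose Q hQ using hlip
  set Q' : ℝ := ∑ l ∈ listsLE d N, (Q l : ℝ) with hQ'
  have hQ'0 : 0 ≤ Q' := Finset.sum_nonneg fun l _ => (Q l).2
  have hφi : Integrable fun t => φ t := φ.continuous.integrable_of_hasCompactSupport
    φ.hasCompactSupport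
  have hrefl : ∀ j, reflTranslate 0 (dilate j φ) = dilate j (reflTranslate 0 φ) := by
    intro j
    refine TestFunction.ext fun y => ?_
    simp [dilate_apply]
  have hval : ∀ (j : ℕ) (l : List (Fin d)) (y : Rd d), dl l (corr (dilate j φ) θ) y =
      ∫ t, dl l θ (y + ((2 : ℝ) ^ j)⁻¹ • t) * φ t := by
    intro j l y
    rw [coe_corr, dl_conv_left (smooth_test θ) (smooth_test _)
      (reflTranslate 0 (dilate j φ)).hasCompactSupport, hrefl, conv_dilate]
    rw [← integral_neg_eq_self]
    simp
  have h2 : ∀ j : ℕ, ((2 : ℝ) ^ j)⁻¹ ≤ 1 := fun j =>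
    inv_le_one_of_one_le₀ (one_le_pow₀ (by norm_num))
  have hdiff : ∀ j : ℕ, ‖f (corr (dilate j φ) θ) - f θ‖ ≤
      C * (Q' * R * (∫ t, ‖φ t‖) * ((2 : ℝ) ^ j)⁻¹) := by
    intro j
    rw [← map_sub]
    refine hC _ _ ?_ (by positivity) ?_
    · intro y hy
      rw [mem_closedBall_zero_iff]
      by_contra! hlt
      apply hy
      change corr (dilate j φ) θ y - θ y = 0
      have hθ : θ y = 0 := by
        by_contra h
        have := hS y h
        linarith
      have h0 := hval j [] y
      simp only [dl_nil] at h0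
      rw [hθ, sub_zero, h0]
      refine integral_eq_zero_of_ae (.of_forall fun t => ?_)
      by_contra h1
      have h3 := hS _ (left_ne_zero_of_mul h1)
      have h4 := hR _ (right_ne_zero_of_mul h1)
      have h5 := norm_sub_le (y + ((2 : ℝ) ^ j)⁻¹ • t) (((2 : ℝ) ^ j)⁻¹ • t)
      rw [add_sub_cancel_right, norm_smul, Real.norm_of_nonneg (by positivity)] at h5
      have := mul_le_of_le_one_left (norm_nonneg t) (h2 j)
      linarith
    · intro l hl y
      have h0 : dl l (corr (dilate j φ) θ - θ : Test d) y =
          ∫ t, (dl l θ (y + ((2 : ℝ) ^ j)⁻¹ • t) - dl l θ y) * φ t := by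
        have := congrFun (dl_sub (smooth_test (corr (dilate j φ) θ)) (smooth_test θ) l) y
        refine this.trans ?_
        rw [Pi.sub_apply, hval]
        simp_rw [sub_mul]
        rw [integral_sub, integral_const_mul, hφ, mul_one]
        · refine Continuous.integrable_of_hasCompactSupport ?_ φ.hasCompactSupport.mul_left
          exact ((contDiff_dl (smooth_test θ) l).continuous.comp (by fun_prop)).mul φ.continuous
        · exact hφi.const_mul _
      rw [h0]
      calc _ ≤ ∫ t, Q' * (((2 : ℝ) ^ j)⁻¹ * R) * ‖φ t‖ := by
            refine norm_integral_le_of_norm_le (hφi.norm.const_mul _) (.of_forall fun t => ?_)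
            rw [norm_mul]
            by_cases ht : φ t = 0
            · simp [ht]
            refine mul_le_mul_of_nonneg_right ?_ (norm_nonneg _)
            refine ((hQ l).norm_sub_le _ _).trans ?_
            rw [add_sub_cancel_left, norm_smul, Real.norm_of_nonneg (by positivity)]
            have := hR t ht
            have hQl : (Q l : ℝ) ≤ Q' :=
              Finset.single_le_sum (f := fun l => (Q l : ℝ)) (fun l _ => (Q l).2)
                (mem_listsLE.2 hl)
            gcongr
        _ = _ := by rw [integral_const_mul]; ring
  rw [tendsto_iff_norm_sub_tendsto_zero]
  refine squeeze_zero (fun _ => norm_nonneg _) hdiff ?_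
  have : Filter.Tendsto (fun j : ℕ => ((2 : ℝ) ^ j)⁻¹) Filter.atTop (nhds 0) := by
    simp_rw [← inv_pow]
    exact tendsto_pow_atTop_nhds_zero_of_lt_one (by norm_num) (by norm_num)
  simpa using (this.const_mul (Q' * R * ∫ t, ‖φ t‖)).const_mul C

section Space

variable {E : Type*} [NormedAddCommGroup E] [NormedSpace ℂ E] [CompleteSpace E]
variable (B : SolidTIBF d E)

/-! ### The extended norm of a solid TIBF -/

theorem space_norm_eq {g : Rd d → ℂ} {e : E} (h : B.incl e =ᵐ[volume] g) :
    B.space.norm g = ‖e‖ₑ := by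
  refine le_antisymm (iInf₂_le e h) (le_iInf₂ fun e' h' => ?_)
  have : e' = e := B.incl_injective (AEEqFun.ext (h'.trans h.symm))
  rw [this]

theorem space_mem_iff {g : Rd d → ℂ} : B.space.Mem g ↔ B.space.norm g < ⊤ := by
  constructor
  · rintro ⟨e, he⟩
    rw [space_norm_eq B he]
    exact enorm_lt_top
  · intro h
    by_contra hn
    refine h.ne (iInf₂_eq_top.2 fun e he => absurd ⟨e, he⟩ hn)

theorem exists_of_norm_lt_top {g : Rd d → ℂ} (h : B.space.norm g < ⊤) :
    ∃ e : E, B.incl e =ᵐ[volume] g ∧ ‖e‖ₑ = B.space.norm g := by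
  obtain ⟨e, he⟩ := (space_mem_iff B).2 h
  exact ⟨e, he, (space_norm_eq B he).symm⟩

theorem aestronglyMeasurable_of_norm_lt_top {g : Rd d → ℂ} (h : B.space.norm g < ⊤) :
    AEStronglyMeasurable g volume := by
  obtain ⟨e, he, -⟩ := exists_of_norm_lt_top B h
  exact (B.incl e).aestronglyMeasurable.congr he

theorem norm_mono {g h : Rd d → ℂ} (hg : AEStronglyMeasurable g volume)
    (hle : ∀ᵐ x, ‖g x‖ ≤ ‖h x‖) : B.space.norm g ≤ B.space.norm h := by
  rcases eq_or_lt_of_le (le_top : B.space.norm h ≤ ⊤) with htop | hlt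
  · rw [htop]
    exact le_top
  obtain ⟨e, he, hn⟩ := exists_of_norm_lt_top B hlt
  have hle' : ∀ᵐ x, ‖g x‖ ≤ ‖B.incl e x‖ := by
    filter_upwards [hle, he] with x h1 h2
    rwa [h2]
  obtain ⟨e', he', hn'⟩ := B.solid e g ((B.locallyIntegrable e).mono hg hle') hle'
  rw [space_norm_eq B he', ← hn, enorm_le_iff_norm_le]
  exact hn'

theorem exists_lintegral_le {K : Set (Rd d)} (hK : IsCompact K) :
    ∃ C : ℝ≥0, ∀ g : Rd d → ℂ, ∫⁻ x in K, ‖g x‖ₑ ≤ C * B.space.norm g := by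
  obtain ⟨C, hC⟩ := B.incl_continuous K hK
  refine ⟨C.toNNReal + 1, fun g => ?_⟩
  rcases eq_or_lt_of_le (le_top : B.space.norm g ≤ ⊤) with htop | hlt
  · rw [htop, ENNReal.mul_top (by simp)]
    exact le_top
  obtain ⟨e, he, hn⟩ := exists_of_norm_lt_top B hlt
  have h1 : ∫⁻ x in K, ‖g x‖ₑ = ∫⁻ x in K, ‖B.incl e x‖ₑ :=
    lintegral_congr_ae (ae_restrict_of_ae (he.mono fun x hx => by simp [hx]))
  rw [h1, ← hn, ← ofReal_integral_norm_eq_lintegral_enorm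
    ((B.locallyIntegrable e).integrableOn_isCompact hK)]
  refine (ENNReal.ofReal_le_ofReal (hC e)).trans ?_
  rw [← ofReal_norm, ENNReal.ofReal_mul' (norm_nonneg _)]
  gcongr
  rw [ENNReal.coe_add]
  exact le_self_add

theorem exists_lintegral_incl_le {K : Set (Rd d)} (hK : IsCompact K) :
    ∃ C : ℝ≥0, ∀ e : E, ∫⁻ x in K, ‖B.incl e x‖ₑ ≤ C * ‖e‖ₑ := by
  obtain ⟨C, hC⟩ := exists_lintegral_le B hK
  refine ⟨C, fun e => ?_⟩
  have := hC (B.incl e)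
  rwa [space_norm_eq B (ae_eq_refl _)] at this

/-- Convergence in E implies L¹ convergence on balls, hence almost everywhere convergence of a
subsequence of partial sums. The partial sums increase, so each of them lies below the limit. -/
theorem ae_norm_sum_le {e : ℕ → E} (hs : Summable e) {a : ℕ → Rd d → ℝ≥0}
    (ha : ∀ k, B.incl (e k) =ᵐ[volume] fun x => ((a k x : ℝ) : ℂ)) :
    ∀ᵐ x, ∀ n, ((∑ k ∈ Finset.range n, a k x : ℝ≥0) : ℝ) ≤ ‖B.incl (∑' k, e k) x‖ := by
  have hpart : ∀ n, B.incl (∑ k ∈ Finset.range n, e k) =ᵐ[volume]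
      fun x => (((∑ k ∈ Finset.range n, a k x : ℝ≥0) : ℝ) : ℂ) := by
    intro n
    induction n with
    | zero =>
      rw [Finset.sum_range_zero, map_zero]
      filter_upwards [AEEqFun.coeFn_zero (α := Rd d) (β := ℂ) (μ := volume)] with x hx
      simp
    | succ n ih =>
      rw [Finset.sum_range_succ, map_add]
      filter_upwards [AEEqFun.coeFn_add (B.incl (∑ k ∈ Finset.range n, e k)) (B.incl (e n)), ih,
        ha n] with x h1 h2 h3
      rw [h1, Pi.add_apply, h2, h3, Finset.sum_range_succ]
      push_cast
      rfl
  have hball : ∀ R : ℕ, ∀ᵐ x, x ∈ Metric.closedBall (0 : Rd d) R →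
      ∀ n, ((∑ k ∈ Finset.range n, a k x : ℝ≥0) : ℝ) ≤ ‖B.incl (∑' k, e k) x‖ := by
    intro R
    rw [← ae_restrict_iff' measurableSet_closedBall]
    set K := Metric.closedBall (0 : Rd d) R
    obtain ⟨C, hC⟩ := exists_lintegral_incl_le B (isCompact_closedBall (0 : Rd d) R)
    have hlim : Filter.Tendsto (fun n => eLpNorm (⇑(B.incl (∑ k ∈ Finset.range n, e k)) -
        ⇑(B.incl (∑' k, e k))) 1 (volume.restrict K)) Filter.atTop (nhds 0) := by
      have hb : ∀ n, eLpNorm (⇑(B.incl (∑ k ∈ Finset.range n, e k)) -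
          ⇑(B.incl (∑' k, e k))) 1 (volume.restrict K) ≤
          C * ‖∑ k ∈ Finset.range n, e k - ∑' k, e k‖ₑ := by
        intro n
        rw [eLpNorm_one_eq_lintegral_enorm]
        refine le_trans (le_of_eq ?_) (hC _)
        refine lintegral_congr_ae (ae_restrict_of_ae ?_)
        rw [map_sub]
        filter_upwards [AEEqFun.coeFn_sub (B.incl (∑ k ∈ Finset.range n, e k))
          (B.incl (∑' k, e k))] with x hx
        rw [hx]
      refine tendsto_of_tendsto_of_tendsto_of_le_of_le tendsto_const_nhds ?_
        (fun _ => zero_le) hb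
      have h1 := tendsto_iff_norm_sub_tendsto_zero.1 hs.hasSum.tendsto_sum_nat
      have h2 : Filter.Tendsto (fun n => ‖∑ k ∈ Finset.range n, e k - ∑' k, e k‖ₑ)
          Filter.atTop (nhds 0) := by
        simp_rw [← ofReal_norm]
        simpa using ENNReal.tendsto_ofReal h1
      simpa using ENNReal.Tendsto.const_mul h2 (Or.inr ENNReal.coe_ne_top)
    obtain ⟨ns, hns, hae⟩ := (tendstoInMeasure_of_tendsto_eLpNorm one_ne_zero
      (fun n => (B.incl _).aestronglyMeasurable.restrict)
      (B.incl _).aestronglyMeasurable.restrict hlim).exists_seq_tendsto_ae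
    have hpart' : ∀ᵐ x ∂(volume.restrict K), ∀ n, B.incl (∑ k ∈ Finset.range n, e k) x =
        (((∑ k ∈ Finset.range n, a k x : ℝ≥0) : ℝ) : ℂ) :=
      ae_restrict_of_ae (ae_all_iff.2 hpart)
    filter_upwards [hae, hpart'] with x h1 h2 n
    refine ge_of_tendsto h1.norm ?_
    filter_upwards [Filter.eventually_ge_atTop n] with i hi
    rw [h2, Complex.norm_real, NNReal.norm_eq]
    exact_mod_cast Finset.sum_le_sum_of_subset
      (Finset.range_subset_range.2 (hi.trans (hns.id_le i)))
  filter_upwards [ae_all_iff.2 hball] with x hx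
  obtain ⟨R, hR⟩ := exists_nat_ge ‖x‖
  exact hx R (mem_closedBall_zero_iff.2 hR)

/-- The Riesz–Fischer argument: by solidity the moduli |g_k| belong to E with no larger norms, and
their absolutely convergent sum in E dominates the pointwise sum. -/
theorem exists_dominating {g : ℕ → Rd d → ℂ} (hlt : ∑' k, B.space.norm (g k) < ⊤) :
    ∃ e : E, (∀ᵐ x, ∑' k, ‖g k x‖ₑ ≤ ‖B.incl e x‖ₑ) ∧ ‖e‖ₑ ≤ ∑' k, B.space.norm (g k) := by
  have hfin : ∀ k, B.space.norm (g k) < ⊤ := fun k => (ENNReal.le_tsum k).trans_lt hlt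
  have habs : ∀ k, B.space.norm (fun x => ((‖g k x‖₊ : ℝ) : ℂ)) ≤ B.space.norm (g k) := by
    intro k
    refine norm_mono B ?_ (.of_forall fun x => by simp)
    have := (aestronglyMeasurable_of_norm_lt_top B (hfin k)).norm
    exact Complex.continuous_ofReal.comp_aestronglyMeasurable this
  choose e he hne using fun k => exists_of_norm_lt_top B ((habs k).trans_lt (hfin k))
  have hsum : ∑' k, ‖e k‖ₑ ≤ ∑' k, B.space.norm (g k) :=
    ENNReal.tsum_le_tsum fun k => (hne k).trans_le (habs k)
  have hs : Summable fun k => ‖e k‖₊ := by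
    rw [← ENNReal.tsum_coe_ne_top_iff_summable]
    exact (hsum.trans_lt hlt).ne
  refine ⟨∑' k, e k, ?_, le_trans ?_ hsum⟩
  · filter_upwards [ae_norm_sum_le B (Summable.of_nnnorm hs) he] with x h1
    rw [ENNReal.tsum_eq_iSup_nat]
    refine iSup_le fun n => ?_
    have h3 := h1 n
    simp_rw [enorm_eq_nnnorm]
    rw [← ENNReal.ofNNReal_finsetSum, ENNReal.coe_le_coe]
    exact_mod_cast h3
  · calc ‖∑' k, e k‖ₑ ≤ ((∑' k, ‖e k‖₊ : ℝ≥0) : ℝ≥0∞) := by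
          rw [enorm_eq_nnnorm, ENNReal.coe_le_coe]
          exact nnnorm_tsum_le hs
      _ = _ := ENNReal.coe_tsum hs

/-- Countable subadditivity of the extended norm. -/
theorem norm_le_tsum {h : Rd d → ℂ} {g : ℕ → Rd d → ℂ} (hh : AEStronglyMeasurable h volume)
    (hle : ∀ᵐ x, ‖h x‖ₑ ≤ ∑' k, ‖g k x‖ₑ) :
    B.space.norm h ≤ ∑' k, B.space.norm (g k) := by
  rcases eq_or_lt_of_le (le_top : ∑' k, B.space.norm (g k) ≤ ⊤) with htop | hlt
  · rw [htop]
    exact le_top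
  obtain ⟨e, he, hn⟩ := exists_dominating B hlt
  refine le_trans ?_ hn
  rw [← space_norm_eq B (ae_eq_refl (B.incl e))]
  refine norm_mono B hh ?_
  filter_upwards [he, hle] with x h1 h2
  exact enorm_le_iff_norm_le.1 (h2.trans h1)

theorem norm_zero_fun : B.space.norm (0 : Rd d → ℂ) = 0 := by
  rw [space_norm_eq B (e := 0) (by rw [map_zero]; exact AEEqFun.coeFn_zero)]
  simp

theorem norm_le_sum {ι : Type*} (s : Finset ι) {h : Rd d → ℂ} {g : ι → Rd d → ℂ}
    (hh : AEStronglyMeasurable h volume) (hle : ∀ᵐ x, ‖h x‖ₑ ≤ ∑ k ∈ s, ‖g k x‖ₑ) :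
    B.space.norm h ≤ ∑ k ∈ s, B.space.norm (g k) := by
  set e := s.equivFin
  set g' : ℕ → Rd d → ℂ := fun k =>
    if hk : k < s.card then g (e.symm ⟨k, hk⟩) else 0 with hg'
  have key : ∀ F : (Rd d → ℂ) → ℝ≥0∞, F 0 = 0 → ∑' k, F (g' k) = ∑ k ∈ s, F (g k) := by
    intro F hF
    rw [tsum_eq_sum (s := Finset.range s.card)]
    · rw [← Finset.sum_coe_sort s, ← e.symm.sum_comp, ← Fin.sum_univ_eq_sum_range
        (fun k => F (g' k))]
      refine Finset.sum_congr rfl fun k _ => ?_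
      simp [hg']
    · intro k hk
      rw [Finset.mem_range] at hk
      simp [hg', hk, hF]
  rw [← key _ (norm_zero_fun B)]
  refine norm_le_tsum B hh (hle.mono fun x hx => ?_)
  rw [key (fun u => ‖u x‖ₑ) (by simp)]
  exact hx

theorem norm_const_mul_le {c : ℝ≥0} {h g : Rd d → ℂ} (hh : AEStronglyMeasurable h volume)
    (hle : ∀ᵐ x, ‖h x‖ₑ ≤ c * ‖g x‖ₑ) : B.space.norm h ≤ c * B.space.norm g := by
  rcases eq_or_lt_of_le (le_top : B.space.norm g ≤ ⊤) with htop | hlt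
  · rcases eq_or_ne c 0 with rfl | hc
    -- Since 0 * ⊤ = 0 in `ℝ≥0∞`, the norm of `h` must genuinely vanish here, which holds because h
    -- = 0 almost everywhere.
    · refine (norm_mono B (h := 0) hh (hle.mono fun x hx => ?_)).trans ?_
      · simpa using hx
      · simp [norm_zero_fun B]
    · rw [htop, ENNReal.mul_top (by simpa using hc)]
      exact le_top
  obtain ⟨e, he, hn⟩ := exists_of_norm_lt_top B hlt
  have he' : B.incl (((c : ℝ) : ℂ) • e) =ᵐ[volume] fun x => ((c : ℝ) : ℂ) * g x := by
    rw [map_smul]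
    filter_upwards [AEEqFun.coeFn_smul ((c : ℝ) : ℂ) (B.incl e), he] with x h1 h2
    rw [h1, Pi.smul_apply, h2, smul_eq_mul]
  refine (norm_mono B (h := fun x => ((c : ℝ) : ℂ) * g x) hh (hle.mono fun x hx => ?_)).trans ?_
  · rw [← enorm_le_iff_norm_le]
    simpa [enorm_mul, enorm_eq_nnnorm] using hx
  · rw [space_norm_eq B he', enorm_smul, hn]
    simp [enorm_eq_nnnorm]

end Space

section Space

variable {E : Type*} [NormedAddCommGroup E] [NormedSpace ℂ E] [CompleteSpace E]
variable (B : SolidTIBF d E)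

/-! ### Local averages -/

theorem exists_bump (ρ : ℝ) : ∃ k : Rd d → ℝ, Continuous k ∧ HasCompactSupport k ∧
    (∀ x, 0 ≤ k x) ∧ ∀ x, ‖x‖ ≤ ρ → k x = 1 := by
  have h0 : 0 < max ρ 0 + 1 := by positivity
  set b : ContDiffBump (0 : Rd d) := ⟨max ρ 0 + 1, max ρ 0 + 2, h0, by linarith⟩
  refine ⟨b, b.continuous, b.hasCompactSupport, fun x => b.nonneg, fun x hx => ?_⟩
  refine b.one_of_mem_closedBall (mem_closedBall_zero_iff.2 ?_)
  change ‖x‖ ≤ max ρ 0 + 1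
  have := le_max_left ρ 0
  linarith

/-- Ball averages of elements of `E` are dominated by elements of `E`. -/
theorem exists_average_dominating (e : E) (ρ : ℝ) : ∃ e' : E,
    ∀ᵐ x, ∫⁻ y in Metric.closedBall x ρ, ‖B.incl e y‖ₑ ≤ ‖B.incl e' x‖ₑ := by
  -- Solidity puts |e| in E, and its convolution with a continuous bump equal to 1 on the ball of
  -- radius ρ dominates the ball average.
  obtain ⟨k, hk, hkc, hk0, hk1⟩ := exists_bump (d := d) ρ
  have hm : AEStronglyMeasurable (fun x => ((‖B.incl e x‖ : ℝ) : ℂ)) volume :=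
    Complex.continuous_ofReal.comp_aestronglyMeasurable (B.incl e).aestronglyMeasurable.norm
  have hle : ∀ᵐ x, ‖((‖B.incl e x‖ : ℝ) : ℂ)‖ ≤ ‖B.incl e x‖ := .of_forall fun x => by simp
  have hloc := (B.locallyIntegrable e).mono hm hle
  obtain ⟨e₂, he₂, -⟩ := B.solid e _ hloc hle
  have hκ : HasCompactSupport fun x => ((k x : ℝ) : ℂ) :=
    hkc.comp_left (g := fun t : ℝ => (t : ℂ)) Complex.ofReal_zero
  have hκc : Continuous fun x => ((k x : ℝ) : ℂ) := Complex.continuous_ofReal.comp hk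
  obtain ⟨e₃, he₃⟩ := B.conv_mem e₂ _ hκc hκ
  refine ⟨e₃, ?_⟩
  filter_upwards [he₃] with x hx
  rw [hx]
  have h1 : conv (B.incl e₂) (fun x => ((k x : ℝ) : ℂ)) x =
      ((∫ t, ‖B.incl e t‖ * k (x - t) : ℝ) : ℂ) := by
    rw [conv_apply, ← integral_complex_ofReal]
    refine integral_congr_ae ?_
    filter_upwards [he₂] with t ht
    rw [ht, Complex.ofReal_mul]
  have hlocn : LocallyIntegrable (fun t => ‖B.incl e t‖) volume :=
    (B.locallyIntegrable e).mono (B.incl e).aestronglyMeasurable.norm (.of_forall fun x => by simp)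
  have hint : Integrable fun t => ‖B.incl e t‖ * k (x - t) :=
    hkc.convolutionExists_right (ContinuousLinearMap.mul ℝ ℝ) hlocn hk x
  have hnn : ∀ t, 0 ≤ ‖B.incl e t‖ * k (x - t) := fun t => mul_nonneg (norm_nonneg _) (hk0 _)
  have h2 : ‖((∫ t, ‖B.incl e t‖ * k (x - t) : ℝ) : ℂ)‖ₑ =
      ∫⁻ t, ENNReal.ofReal (‖B.incl e t‖ * k (x - t)) := by
    rw [← ofReal_norm, Complex.norm_real, Real.norm_of_nonneg (integral_nonneg hnn),
      ofReal_integral_eq_lintegral_ofReal hint (.of_forall hnn)]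
  rw [h1, h2]
  refine le_trans ?_ (setLIntegral_le_lintegral (Metric.closedBall x ρ) _)
  refine setLIntegral_mono' measurableSet_closedBall fun t ht => ?_
  rw [hk1, mul_one, ofReal_norm]
  rwa [mem_closedBall_iff_norm'] at ht

/-- The axiom E * C_c ⊆ E gives membership only; the norm bound follows by contradiction. Given g_k
of norm at most 1 whose averages h_k have norm above 4^k, one element e dominates Σ 2^{-k}|g_k|, and
some e' in E dominates the averages of |e|. Then |h_k| ≤ 2^k |e'|, so 2^k ≤ ‖e'‖ for all k. -/
theorem exists_average_le (ρ : ℝ) : ∃ C : ℝ≥0, ∀ g h : Rd d → ℂ,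
    AEStronglyMeasurable h volume →
    (∀ x, ‖h x‖ₑ ≤ ∫⁻ y in Metric.closedBall x ρ, ‖g y‖ₑ) →
    B.space.norm h ≤ C * B.space.norm g := by
  have hunit : ∃ C : ℝ≥0, ∀ g h : Rd d → ℂ, AEStronglyMeasurable h volume →
      (∀ x, ‖h x‖ₑ ≤ ∫⁻ y in Metric.closedBall x ρ, ‖g y‖ₑ) →
      B.space.norm g ≤ 1 → B.space.norm h ≤ C := by
    by_contra! hcon
    choose g h hm hle hg hh using fun k : ℕ => hcon (4 ^ k)
    have hgm : ∀ k, AEStronglyMeasurable (g k) volume := fun k =>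
      aestronglyMeasurable_of_norm_lt_top B ((hg k).trans_lt ENNReal.one_lt_top)
    set g' : ℕ → Rd d → ℂ := fun k x => (2 : ℂ)⁻¹ ^ k * g k x
    have hen : ∀ k x, ‖g' k x‖ₑ = ((2⁻¹ : ℝ≥0) ^ k : ℝ≥0) * ‖g k x‖ₑ := by
      intro k x
      rw [enorm_mul, enorm_eq_nnnorm ((2 : ℂ)⁻¹ ^ k), nnnorm_pow, nnnorm_inv]
      simp
    have hsum : ∑' k, B.space.norm (g' k) < ⊤ := by
      refine lt_of_le_of_lt (ENNReal.tsum_le_tsum (g := fun k => (2⁻¹ : ℝ≥0∞) ^ k) fun k => ?_) ?_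
      · refine (norm_const_mul_le B (c := (2⁻¹ : ℝ≥0) ^ k) (g := g k) ((hgm k).const_mul _)
          (.of_forall fun x => (hen k x).le)).trans ?_
        refine (mul_le_mul_right (hg k) _).trans (le_of_eq ?_)
        rw [mul_one, ENNReal.coe_pow, ENNReal.coe_inv two_ne_zero, ENNReal.coe_ofNat]
      · rw [ENNReal.tsum_geometric_two]
        exact ENNReal.ofNat_lt_top
    obtain ⟨e, he, -⟩ := exists_dominating B hsum
    obtain ⟨e', he'⟩ := exists_average_dominating B e ρ
    have hk : ∀ k, ((2 : ℝ≥0∞)) ^ k ≤ ‖e'‖ₑ := by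
      intro k
      have h1 : B.space.norm (h k) ≤ ((2 : ℝ≥0) ^ k : ℝ≥0) * B.space.norm (B.incl e') := by
        refine norm_const_mul_le B (hm k) ?_
        filter_upwards [he'] with x hx
        refine le_trans ?_ (mul_le_mul_right hx _)
        refine (hle k x).trans ?_
        rw [← lintegral_const_mul' _ _ ENNReal.coe_ne_top]
        refine lintegral_mono_ae (ae_restrict_of_ae ?_)
        filter_upwards [he] with y hy
        have h2 := (ENNReal.le_tsum k).trans hy
        rw [hen] at h2
        refine le_trans (le_of_eq ?_) (mul_le_mul_right h2 _)
        rw [← mul_assoc, ← ENNReal.coe_mul, ← mul_pow]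
        simp
      rw [space_norm_eq B (ae_eq_refl _)] at h1
      have h2 := (hh k).trans_le h1
      have h3 : (((4 : ℝ≥0) ^ k : ℝ≥0) : ℝ≥0∞) = (2 : ℝ≥0∞) ^ k * 2 ^ k := by
        rw [← mul_pow]
        norm_num
      rw [h3, ENNReal.coe_pow, ENNReal.coe_ofNat] at h2
      exact (ENNReal.mul_le_mul_iff_right (by simp) (by simp)).1 h2.le
    have hlim : Filter.Tendsto (fun k : ℕ => (2 : ℝ≥0∞) ^ k) Filter.atTop (nhds ⊤) :=
      ENNReal.tendsto_pow_atTop_nhds_top_iff.2 (by norm_num)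
    exact absurd (le_of_tendsto' hlim hk) (not_le.2 enorm_lt_top)
  obtain ⟨C, hC⟩ := hunit
  refine ⟨C + 1, fun g h hm hle => ?_⟩
  rcases eq_or_lt_of_le (le_top : B.space.norm g ≤ ⊤) with htop | hlt
  · rw [htop, ENNReal.mul_top (by simp)]
    exact le_top
  obtain ⟨e, he, hn⟩ := exists_of_norm_lt_top B hlt
  -- The unit ball bound extends by homogeneity after division by ‖e‖, so e = 0 is treated apart.
  rcases eq_or_ne e 0 with rfl | hne
  · have hg0 : ∀ᵐ x, g x = 0 := by
      rw [map_zero] at he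
      filter_upwards [he, AEEqFun.coeFn_zero (α := Rd d) (β := ℂ) (μ := volume)] with x h1 h2
      rw [← h1, h2]
      rfl
    have hh0 : ∀ x, h x = 0 := by
      intro x
      have h1 : ∫⁻ y in Metric.closedBall x ρ, ‖g y‖ₑ = 0 := by
        rw [lintegral_congr_ae (g := fun _ => 0) (ae_restrict_of_ae
          (hg0.mono fun y hy => by simp [hy])), lintegral_zero]
      have := hle x
      rw [h1] at this
      simpa using this
    have : h = 0 := funext hh0
    rw [this, norm_zero_fun]
    exact zero_le
  · have ha : ‖e‖₊ ≠ 0 := by simpa using hne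
    set s : ℂ := (((‖e‖₊⁻¹ : ℝ≥0) : ℝ) : ℂ)
    have hs : ‖s‖ₑ = ((‖e‖₊⁻¹ : ℝ≥0) : ℝ≥0∞) := by
      simp [s, enorm_eq_nnnorm]
    have h1 := hC (fun x => s * g x) (fun x => s * h x) (hm.const_mul _) (fun x => by
        simp_rw [enorm_mul]
        rw [lintegral_const_mul' _ _ (by rw [hs]; exact ENNReal.coe_ne_top)]
        exact mul_le_mul_right (hle x) _) (by
        refine (norm_const_mul_le B (c := ‖e‖₊⁻¹) (g := g)
          ((aestronglyMeasurable_of_norm_lt_top B hlt).const_mul _)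
          (.of_forall fun x => by rw [enorm_mul, hs])).trans ?_
        rw [← hn, enorm_eq_nnnorm, ← ENNReal.coe_mul, inv_mul_cancel₀ ha, ENNReal.coe_one])
    have h2 := norm_const_mul_le B (c := ‖e‖₊) (h := h) (g := fun x => s * h x) hm
      (.of_forall fun x => by
        rw [enorm_mul, hs, ← mul_assoc, ← ENNReal.coe_mul, mul_inv_cancel₀ ha, ENNReal.coe_one,
          one_mul])
    refine h2.trans ?_
    rw [← hn, enorm_eq_nnnorm, mul_comm]
    gcongr
    refine h1.trans ?_
    rw [ENNReal.coe_add]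
    exact le_self_add

/-- Averages of a nonzero element of E over large balls have a positive lower bound on K and are
dominated by an element of E, a multiple of which dominates g. -/
theorem norm_lt_top_of_bounded {K : Set (Rd d)} (hK : IsCompact K) {g : Rd d → ℂ}
    (hg : AEStronglyMeasurable g volume) {M : ℝ} (hM : ∀ x ∈ K, ‖g x‖ ≤ M)
    (hs : ∀ x ∉ K, g x = 0) : B.space.norm g < ⊤ := by
  obtain ⟨e, he⟩ := B.nontrivial
  obtain ⟨R, hR⟩ := hK.isBounded.subset_closedBall 0
  have hpos : ∃ n : ℕ, ∫⁻ y in Metric.closedBall (0 : Rd d) n, ‖B.incl e y‖ₑ ≠ 0 := by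
    by_contra! hcon
    apply he
    apply B.incl_injective
    rw [map_zero]
    refine AEEqFun.ext ?_
    have h1 : ∀ n : ℕ, ∀ᵐ y, y ∈ Metric.closedBall (0 : Rd d) n → B.incl e y = 0 := by
      intro n
      rw [← ae_restrict_iff' measurableSet_closedBall]
      have := (lintegral_eq_zero_iff' (B.incl e).aestronglyMeasurable.enorm.restrict).1 (hcon n)
      filter_upwards [this] with y hy
      simpa using hy
    filter_upwards [ae_all_iff.2 h1, AEEqFun.coeFn_zero (α := Rd d) (β := ℂ) (μ := volume)]
      with y hy h0
    obtain ⟨n, hn⟩ := exists_nat_ge ‖y‖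
    rw [hy n (mem_closedBall_zero_iff.2 hn), h0]
    rfl
  obtain ⟨n, hn⟩ := hpos
  set c := ∫⁻ y in Metric.closedBall (0 : Rd d) n, ‖B.incl e y‖ₑ with hc
  have hcfin : c ≠ ⊤ := by
    obtain ⟨C, hC⟩ := exists_lintegral_incl_le B (isCompact_closedBall (0 : Rd d) n)
    exact ((hC e).trans_lt (ENNReal.mul_lt_top ENNReal.coe_lt_top enorm_lt_top)).ne
  -- With this radius the ball about any point of K contains the ball of radius n about 0, where e
  -- has positive mass c.
  obtain ⟨e', he'⟩ := exists_average_dominating B e (R + n)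
  have hle : ∀ᵐ x, ‖g x‖ₑ ≤ ((M.toNNReal * c.toNNReal⁻¹ : ℝ≥0) : ℝ≥0∞) * ‖B.incl e' x‖ₑ := by
    filter_upwards [he'] with x hx
    by_cases hxK : x ∈ K
    · have hsub : Metric.closedBall (0 : Rd d) n ⊆ Metric.closedBall x (R + n) := by
        refine Metric.closedBall_subset_closedBall' ?_
        have := hR hxK
        rw [mem_closedBall_zero_iff] at this
        rw [dist_comm, dist_zero_right]
        linarith
      have h1 : c ≤ ‖B.incl e' x‖ₑ := (lintegral_mono_set hsub).trans hx
      have h2 : ‖g x‖ₑ ≤ M.toNNReal := by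
        rw [← ofReal_norm]
        exact ENNReal.ofReal_le_ofReal (hM x hxK)
      refine h2.trans ?_
      refine le_trans ?_ (mul_le_mul_right h1 _)
      rw [← ENNReal.coe_toNNReal hcfin, ← ENNReal.coe_mul, ENNReal.toNNReal_coe,
        inv_mul_cancel_right₀]
      simp [ENNReal.toNNReal_eq_zero_iff, hn, hcfin]
    · rw [hs x hxK]
      simp
  refine (norm_const_mul_le B hg hle).trans_lt ?_
  rw [space_norm_eq B (ae_eq_refl _)]
  exact ENNReal.mul_lt_top ENNReal.coe_lt_top enorm_lt_top

/-! ### The semi-local space -/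

theorem norm_indicator_le_slNorm {R : ℝ} (hR : 0 < R) (g : Rd d → ℂ) :
    B.space.norm ((Metric.closedBall 0 R).indicator g) ≤ B.slNorm g :=
  le_iSup₂ (f := fun (R : ℝ) (_ : 0 < R) =>
    B.space.norm ((Metric.closedBall 0 R).indicator g)) R hR

theorem slNorm_le_tsum {h : Rd d → ℂ} {g : ℕ → Rd d → ℂ} (hh : AEStronglyMeasurable h volume)
    (hle : ∀ᵐ x, ‖h x‖ₑ ≤ ∑' k, ‖g k x‖ₑ) : B.slNorm h ≤ ∑' k, B.slNorm (g k) := by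
  refine iSup₂_le fun R hR => ?_
  refine (norm_le_tsum B (hh.indicator measurableSet_closedBall) (hle.mono fun x hx => ?_)).trans
    (ENNReal.tsum_le_tsum fun k => norm_indicator_le_slNorm B hR (g k))
  by_cases hxR : x ∈ Metric.closedBall (0 : Rd d) R
  · simpa [Set.indicator_of_mem hxR] using hx
  · simp [Set.indicator_of_notMem hxR]

theorem slNorm_le_sum {ι : Type*} (s : Finset ι) {h : Rd d → ℂ} {g : ι → Rd d → ℂ}
    (hh : AEStronglyMeasurable h volume) (hle : ∀ᵐ x, ‖h x‖ₑ ≤ ∑ k ∈ s, ‖g k x‖ₑ) :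
    B.slNorm h ≤ ∑ k ∈ s, B.slNorm (g k) := by
  refine iSup₂_le fun R hR => ?_
  refine (norm_le_sum B s (hh.indicator measurableSet_closedBall) (hle.mono fun x hx => ?_)).trans
    (Finset.sum_le_sum fun k _ => norm_indicator_le_slNorm B hR (g k))
  by_cases hxR : x ∈ Metric.closedBall (0 : Rd d) R
  · simpa [Set.indicator_of_mem hxR] using hx
  · simp [Set.indicator_of_notMem hxR]

theorem slNorm_const_mul_le {c : ℝ≥0} {h g : Rd d → ℂ} (hh : AEStronglyMeasurable h volume)
    (hle : ∀ᵐ x, ‖h x‖ₑ ≤ c * ‖g x‖ₑ) : B.slNorm h ≤ c * B.slNorm g := by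
  refine iSup₂_le fun R hR => ?_
  refine (norm_const_mul_le B (hh.indicator measurableSet_closedBall)
    (hle.mono fun x hx => ?_)).trans (mul_le_mul_right (norm_indicator_le_slNorm B hR g) _)
  by_cases hxR : x ∈ Metric.closedBall (0 : Rd d) R
  · simpa [Set.indicator_of_mem hxR] using hx
  · simp [Set.indicator_of_notMem hxR]

theorem exists_slNorm_average_le {ρ : ℝ} (hρ : 0 ≤ ρ) : ∃ C : ℝ≥0, ∀ g h : Rd d → ℂ,
    AEStronglyMeasurable h volume →
    (∀ x, ‖h x‖ₑ ≤ ∫⁻ y in Metric.closedBall x ρ, ‖g y‖ₑ) →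
    B.slNorm h ≤ C * B.slNorm g := by
  obtain ⟨C, hC⟩ := exists_average_le B ρ
  refine ⟨C, fun g h hm hle => iSup₂_le fun R hR => ?_⟩
  -- Averages at points of the ball of radius R see g only on the ball of radius R + ρ.
  refine (hC ((Metric.closedBall 0 (R + ρ)).indicator g) _
    (hm.indicator measurableSet_closedBall) fun x => ?_).trans
    (mul_le_mul_right (norm_indicator_le_slNorm B (by positivity) g) _)
  by_cases hxR : x ∈ Metric.closedBall (0 : Rd d) R
  · rw [Set.indicator_of_mem hxR]
    refine (hle x).trans (setLIntegral_mono' measurableSet_closedBall fun y hy => ?_)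
    rw [Set.indicator_of_mem]
    rw [mem_closedBall_zero_iff] at hxR ⊢
    rw [mem_closedBall_iff_norm] at hy
    have := norm_add_le (y - x) x
    rw [sub_add_cancel] at this
    linarith
  · simp [Set.indicator_of_notMem hxR]

theorem exists_lintegral_le_slNorm {K : Set (Rd d)} (hK : IsCompact K) :
    ∃ C : ℝ≥0, ∀ g : Rd d → ℂ, ∫⁻ x in K, ‖g x‖ₑ ≤ C * B.slNorm g := by
  obtain ⟨C, hC⟩ := exists_lintegral_le B hK
  obtain ⟨R, hR⟩ := hK.isBounded.subset_closedBall 0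
  refine ⟨C, fun g => ?_⟩
  refine le_trans (le_of_eq ?_) ((hC ((Metric.closedBall 0 (max R 1)).indicator g)).trans
    (mul_le_mul_right (norm_indicator_le_slNorm B (by positivity) g) _))
  refine setLIntegral_congr_fun hK.measurableSet fun x hx => ?_
  beta_reduce
  rw [Set.indicator_of_mem]
  exact Metric.closedBall_subset_closedBall (le_max_left _ _) (hR hx)

/-- A finite supremum puts every truncation of g to a ball in E. Hence g is a pointwise limit of
measurable functions, and local integrability and membership of 1_K g follow. -/
theorem semiLocal_mem_iff {g : Rd d → ℂ} : B.semiLocal.Mem g ↔ B.slNorm g < ⊤ := by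
  refine ⟨fun h => h.2.2, fun h => ?_⟩
  have hball : ∀ n : ℕ,
      B.space.norm ((Metric.closedBall 0 ((n : ℝ) + 1)).indicator g) < ⊤ := fun n =>
    (norm_indicator_le_slNorm B (by positivity) g).trans_lt h
  have hmeas : AEStronglyMeasurable g volume := by
    refine aestronglyMeasurable_of_tendsto_ae (u := Filter.atTop)
      (f := fun n : ℕ => (Metric.closedBall (0 : Rd d) ((n : ℝ) + 1)).indicator g)
      (fun n => aestronglyMeasurable_of_norm_lt_top B (hball n)) (.of_forall fun x => ?_)
    refine tendsto_const_nhds.congr' ?_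
    obtain ⟨n, hn⟩ := exists_nat_ge ‖x‖
    filter_upwards [Filter.eventually_ge_atTop n] with m hm
    rw [Set.indicator_of_mem]
    rw [mem_closedBall_zero_iff]
    have : (n : ℝ) ≤ m := by exact_mod_cast hm
    linarith
  refine ⟨?_, fun K hK => ?_, h⟩
  · rw [locallyIntegrable_iff]
    intro K hK
    obtain ⟨C, hC⟩ := exists_lintegral_le_slNorm B hK
    exact ⟨hmeas.restrict, (hC g).trans_lt (ENNReal.mul_lt_top ENNReal.coe_lt_top h)⟩
  · rw [space_mem_iff]
    obtain ⟨R, hR⟩ := hK.isBounded.subset_closedBall 0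
    refine lt_of_le_of_lt (norm_mono B (hmeas.indicator hK.measurableSet)
      (.of_forall fun x => ?_))
      ((norm_indicator_le_slNorm B (R := max R 1) (by positivity) g).trans_lt h)
    refine norm_indicator_le_of_subset ?_ _ _
    exact hR.trans (Metric.closedBall_subset_closedBall (le_max_left _ _))

end Space

/-! ### Weight function systems -/

section Weights

variable {w v : ℕ → Rd d → ℝ}

theorem IsWeightSystem.mono_of_le (hw : IsWeightSystem w) {n m : ℕ} (h : n ≤ m) (x : Rd d) :
    w n x ≤ w m x :=
  monotone_nat_of_le_succ (f := fun n => w n x) (fun n => hw.mono n x) h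

theorem IsWeightSystem.pos (hw : IsWeightSystem w) (n : ℕ) (x : Rd d) : 0 < w n x :=
  zero_lt_one.trans_le (hw.one_le n x)

theorem WeakModerate.exists_le (hw : WeakModerate w) (R : ℝ) (n : ℕ) :
    ∃ m, n ≤ m ∧ ∃ C : ℝ, 0 < C ∧ ∀ x y : Rd d, ‖y - x‖ ≤ R → w n y ≤ C * w m x := by
  have key : ∀ k : ℕ, ∃ m, n ≤ m ∧ ∃ C : ℝ, 0 < C ∧
      ∀ x y : Rd d, ‖y - x‖ ≤ k + 1 → w n y ≤ C * w m x := by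
    intro k
    induction k with
    | zero =>
      obtain ⟨m, hm, C, hC, h⟩ := hw n
      refine ⟨m, hm, C, hC, fun x y hxy => ?_⟩
      have := h x (y - x) (by simpa using hxy)
      rwa [add_sub_cancel] at this
    | succ k ih =>
      obtain ⟨m, hm, C, hC, h⟩ := ih
      obtain ⟨m', hm', C', hC', h'⟩ := hw m
      refine ⟨m', hm.trans hm', C * C', by positivity, fun x y hxy => ?_⟩
      have hk : (0 : ℝ) < k + 2 := by positivity
      push_cast at hxy
      -- The point z divides the segment from x to y into a piece of length at most 1, handled by
      -- (wM), and one of length at most k + 1, handled by induction.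
      set z := x + ((k : ℝ) + 2)⁻¹ • (y - x)
      have h1 : ‖y - z‖ ≤ k + 1 := by
        have : y - z = (((k : ℝ) + 1) * ((k : ℝ) + 2)⁻¹) • (y - x) := by
          have e : ((k : ℝ) + 1) * ((k : ℝ) + 2)⁻¹ = 1 - ((k : ℝ) + 2)⁻¹ := by
            field_simp
            ring
          rw [e, sub_smul, one_smul]
          simp only [z]
          abel
        rw [this, norm_smul, Real.norm_of_nonneg (by positivity), mul_assoc]
        refine mul_le_of_le_one_right (by positivity) ?_
        rw [inv_mul_le_iff₀ hk]
        linarith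
      have h2 : ‖((k : ℝ) + 2)⁻¹ • (y - x)‖ ≤ 1 := by
        rw [norm_smul, Real.norm_of_nonneg (by positivity), inv_mul_le_iff₀ hk]
        linarith
      rw [mul_assoc]
      exact (h z y h1).trans (mul_le_mul_of_nonneg_left (h' x _ h2) hC.le)
  obtain ⟨k, hk⟩ := exists_nat_ge R
  obtain ⟨m, hm, C, hC, h⟩ := key k
  exact ⟨m, hm, C, hC, fun x y hxy => h x y (by linarith)⟩

variable {E : Type*} [NormedAddCommGroup E] [NormedSpace ℂ E] [CompleteSpace E]
variable (B : SolidTIBF d E)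

/-- The norm of `g * (w_n / v_m)` in the semi-local space. -/
def wsl (w v : ℕ → Rd d → ℝ) (n m : ℕ) (g : Rd d → ℂ) : ℝ≥0∞ :=
  B.slNorm fun x => g x * ((w n x / v m x : ℝ) : ℂ)

theorem aestronglyMeasurable_weight (hw : IsWeightSystem w) (hv : IsWeightSystem v) (n m : ℕ)
    {g : Rd d → ℂ} (hg : AEStronglyMeasurable g volume) :
    AEStronglyMeasurable (fun x => g x * ((w n x / v m x : ℝ) : ℂ)) volume :=
  hg.mul (Complex.measurable_ofReal.comp_aemeasurable
    ((hw.measurable n).div (hv.measurable m))).aestronglyMeasurable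

theorem wsl_le_sum (hw : IsWeightSystem w) (hv : IsWeightSystem v) (n m : ℕ)
    {ι : Type*} (s : Finset ι) {h : Rd d → ℂ} {g : ι → Rd d → ℂ}
    (hh : AEStronglyMeasurable h volume) (hle : ∀ x, ‖h x‖ₑ ≤ ∑ k ∈ s, ‖g k x‖ₑ) :
    wsl B w v n m h ≤ ∑ k ∈ s, wsl B w v n m (g k) := by
  refine slNorm_le_sum B s (aestronglyMeasurable_weight hw hv n m hh) (.of_forall fun x => ?_)
  simp_rw [enorm_mul, ← Finset.sum_mul]
  exact mul_le_mul_left (hle x) _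

theorem wsl_le_tsum (hw : IsWeightSystem w) (hv : IsWeightSystem v) (n m : ℕ)
    {h : Rd d → ℂ} {g : ℕ → Rd d → ℂ}
    (hh : AEStronglyMeasurable h volume) (hle : ∀ x, ‖h x‖ₑ ≤ ∑' k, ‖g k x‖ₑ) :
    wsl B w v n m h ≤ ∑' k, wsl B w v n m (g k) := by
  refine slNorm_le_tsum B (aestronglyMeasurable_weight hw hv n m hh) (.of_forall fun x => ?_)
  simp_rw [enorm_mul, ENNReal.tsum_mul_right]
  exact mul_le_mul_left (hle x) _

theorem wsl_const_mul_le (hw : IsWeightSystem w) (hv : IsWeightSystem v) {n m : ℕ} {c : ℝ≥0}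
    {h g : Rd d → ℂ} (hh : AEStronglyMeasurable h volume) (hle : ∀ x, ‖h x‖ₑ ≤ c * ‖g x‖ₑ) :
    wsl B w v n m h ≤ c * wsl B w v n m g := by
  refine slNorm_const_mul_le B (aestronglyMeasurable_weight hw hv n m hh) (.of_forall fun x => ?_)
  simp_rw [enorm_mul, ← mul_assoc]
  exact mul_le_mul_left (hle x) _

theorem norm_weight (hw : IsWeightSystem w) (hv : IsWeightSystem v) (n m : ℕ) (x : Rd d) :
    ‖((w n x / v m x : ℝ) : ℂ)‖ = w n x / v m x := by
  rw [Complex.norm_real, Real.norm_of_nonneg (div_nonneg (hw.pos n x).le (hv.pos m x).le)]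

theorem wsl_mono_index (hw : IsWeightSystem w) (hv : IsWeightSystem v) {n n' m m' : ℕ}
    (hn : n ≤ n') (hm : m' ≤ m) {g : Rd d → ℂ} (hg : AEStronglyMeasurable g volume) :
    wsl B w v n m g ≤ wsl B w v n' m' g := by
  have := slNorm_const_mul_le B (c := 1) (h := fun x => g x * ((w n x / v m x : ℝ) : ℂ))
    (g := fun x => g x * ((w n' x / v m' x : ℝ) : ℂ))
    (aestronglyMeasurable_weight hw hv n m hg) (.of_forall fun x => by
      rw [ENNReal.coe_one, one_mul, enorm_le_iff_norm_le, norm_mul, norm_mul,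
        norm_weight hw hv, norm_weight hw hv]
      have h1 := hw.mono_of_le hn x
      have h2 := hv.mono_of_le hm x
      have h3 := hv.pos m' x
      have h4 := hw.pos n' x
      gcongr)
  rwa [ENNReal.coe_one, one_mul] at this

theorem lintegral_weight_lt_top (hw : IsWeightSystem w) (hv : IsWeightSystem v) (n m : ℕ)
    {g : Rd d → ℂ} (hg : Continuous g) {K : Set (Rd d)} (hK : IsCompact K) :
    ∫⁻ x in K, ‖g x * ((w n x / v m x : ℝ) : ℂ)‖ₑ < ⊤ := by
  obtain ⟨M, hM⟩ := hK.exists_bound_of_continuousOn hg.continuousOn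
  obtain ⟨C, hC⟩ := hw.locallyBounded n K hK
  refine lt_of_le_of_lt (setLIntegral_mono' hK.measurableSet (g := fun _ => ENNReal.ofReal (M * C))
    fun x hx => ?_) ?_
  · rw [← ofReal_norm, norm_mul, norm_weight hw hv]
    refine ENNReal.ofReal_le_ofReal ?_
    have h1 := hM x hx
    have h2 : w n x / v m x ≤ C :=
      (div_le_self (hw.pos n x).le (hv.one_le m x)).trans (hC x hx)
    have h3 : 0 ≤ w n x / v m x := div_nonneg (hw.pos n x).le (hv.pos m x).le
    exact mul_le_mul h1 h2 h3 ((norm_nonneg _).trans h1)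
  · rw [setLIntegral_const]
    exact ENNReal.mul_lt_top ENNReal.ofReal_lt_top hK.measure_lt_top

theorem measurable_lintegral_closedBall {F : Rd d → ℝ≥0∞} (hF : AEMeasurable F volume) (ρ : ℝ) :
    Measurable fun x => ∫⁻ y in Metric.closedBall x ρ, F y := by
  have h1 : ∀ x, ∫⁻ y in Metric.closedBall x ρ, F y =
      ∫⁻ y, {p : Rd d × Rd d | dist p.2 p.1 ≤ ρ}.indicator (fun p => hF.mk F p.2) (x, y) := by
    intro x
    rw [lintegral_congr_ae (ae_restrict_of_ae hF.ae_eq_mk),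
      ← lintegral_indicator measurableSet_closedBall]
    rfl
  simp_rw [h1]
  refine Measurable.lintegral_prod_right' (Measurable.indicator
    (hF.measurable_mk.comp measurable_snd) ?_)
  exact (isClosed_le (by fun_prop) continuous_const).measurableSet

/-- Weighted semi-local bounds for functions that are controlled by local suprema. -/
theorem exists_wsl_le_of_sup (hw : IsWeightSystem w) (hv : IsWeightSystem v)
    (hwM : WeakModerate w) (hvM : WeakModerate v) {R : ℝ} (hR : 0 ≤ R) (n : ℕ) :
    ∃ n', n ≤ n' ∧ ∀ m, ∃ m', m ≤ m' ∧ ∃ C : ℝ≥0, ∀ {ι : Type} (s : Finset ι)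
      (u : ι → Rd d → ℂ) (_ : ∀ i, ContDiff ℝ ∞ (u i)) (G : Rd d → ℂ) (A : ℝ≥0),
      AEStronglyMeasurable G volume →
      (∀ (x : Rd d) (M : ℝ), 0 ≤ M → (∀ i ∈ s, ∀ z, ‖z - x‖ ≤ R → ‖u i z‖ ≤ M) →
        ‖G x‖ ≤ A * M) →
      wsl B w v n m' G ≤ A * C * ∑ i ∈ s, ∑ k ∈ listsLE d d, wsl B w v n' m (dl k (u i)) := by
  have hρ : 0 ≤ R + d := by positivity
  -- The ball of radius R + d about x contains the Sobolev balls of radius d about all z with |z -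
  -- x| ≤ R. The index n' is fixed before m because in the applications m is chosen in terms of n'.
  obtain ⟨n', hn', C₁, hC₁, h₁⟩ := hwM.exists_le (R + d) n
  refine ⟨n', hn', fun m => ?_⟩
  obtain ⟨m', hm', C₂, hC₂, h₂⟩ := hvM.exists_le (R + d) m
  obtain ⟨C₃, hC₃⟩ := exists_slNorm_average_le B hρ
  refine ⟨m', hm', sobolevConst d * (C₁ * C₂).toNNReal * C₃, fun {ι} s u hu G A hG hle => ?_⟩
  -- The plan is to dominate G w_n / v_{m'} by ball averages H of the weighted derivatives g, to
  -- which the averaging bound applies.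
  set g : ι → List (Fin d) → Rd d → ℂ :=
    fun i k x => dl k (u i) x * ((w n' x / v m x : ℝ) : ℂ)
  set I : ι → List (Fin d) → Rd d → ℝ≥0∞ :=
    fun i k x => ∫⁻ y in Metric.closedBall x (R + d), ‖g i k y‖ₑ
  have hgm : ∀ i k, AEStronglyMeasurable (g i k) volume := fun i k =>
    aestronglyMeasurable_weight hw hv n' m (contDiff_dl (hu i) k).continuous.aestronglyMeasurable
  have hIfin : ∀ i k x, I i k x < ⊤ := fun i k x =>
    lintegral_weight_lt_top hw hv n' m (contDiff_dl (hu i) k).continuous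
      (isCompact_closedBall x (R + d))
  have hIm : ∀ i k, Measurable (I i k) := fun i k =>
    measurable_lintegral_closedBall (hgm i k).enorm (R + d)
  set H : ι → List (Fin d) → Rd d → ℂ := fun i k x => (((I i k x).toReal : ℝ) : ℂ)
  have hHe : ∀ i k x, ‖H i k x‖ₑ = I i k x := by
    intro i k x
    rw [← ofReal_norm, Complex.norm_real, Real.norm_of_nonneg ENNReal.toReal_nonneg,
      ENNReal.ofReal_toReal (hIfin i k x).ne]
  have hHn : ∀ i k, B.slNorm (H i k) ≤ C₃ * wsl B w v n' m (dl k (u i)) := fun i k =>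
    hC₃ _ _ (Complex.measurable_ofReal.comp (hIm i k).ennreal_toReal).aestronglyMeasurable
      fun x => (hHe i k x).le
  -- The weight at x passes under the integral over y: w_n(x) ≤ C₁ w_{n'}(y) and v_m(y) ≤ C₂
  -- v_{m'}(x).
  have hcmp : ∀ x i k, ‖((w n x / v m' x : ℝ) : ℂ)‖ₑ *
      ∫⁻ y in Metric.closedBall x (R + d), ‖dl k (u i) y‖ₑ ≤ (C₁ * C₂).toNNReal * I i k x := by
    intro x i k
    rw [← lintegral_const_mul' _ _ enorm_ne_top, ← lintegral_const_mul' _ _ ENNReal.coe_ne_top]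
    refine setLIntegral_mono' measurableSet_closedBall fun y hy => ?_
    rw [mem_closedBall_iff_norm] at hy
    have hwy := h₁ y x (by rwa [norm_sub_rev])
    have hvy := h₂ x y hy
    simp only [g]
    rw [enorm_mul, mul_comm ‖dl k (u i) y‖ₑ, ← mul_assoc]
    gcongr
    rw [← ofReal_norm, ← ofReal_norm, norm_weight hw hv, norm_weight hw hv,
      ← ENNReal.ofReal.eq_1, ← ENNReal.ofReal_mul (by positivity)]
    refine ENNReal.ofReal_le_ofReal ?_
    have := hv.pos m y
    have := hv.pos m' x
    rw [mul_div_assoc', div_le_div_iff₀ ‹_› ‹_›]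
    calc w n x * v m y ≤ (C₁ * w n' y) * (C₂ * v m' x) :=
          mul_le_mul hwy hvy (by positivity) (by have := hw.pos n' y; positivity)
      _ = _ := by ring
  have hpt : ∀ x, ‖G x * ((w n x / v m' x : ℝ) : ℂ)‖ₑ ≤
      ((A * (sobolevConst d * (C₁ * C₂).toNNReal) : ℝ≥0) : ℝ≥0∞) *
        ‖∑ i ∈ s, ∑ k ∈ listsLE d d, H i k x‖ₑ := by
    intro x
    set J : ℝ≥0∞ := ∑ i ∈ s, sobolevConst d *
      ∑ k ∈ listsLE d d, ∫⁻ y in Metric.closedBall x (R + d), ‖dl k (u i) y‖ₑ with hJ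
    have hJfin : J ≠ ⊤ := by
      refine (ENNReal.sum_lt_top.2 fun i _ => ENNReal.mul_lt_top (by simp)
        (ENNReal.sum_lt_top.2 fun k _ => ?_)).ne
      have hc := (contDiff_dl (hu i) k).continuous
      exact (hc.continuousOn.integrableOn_compact (isCompact_closedBall x (R + d))).2
    have hG1 : ‖G x‖ ≤ A * J.toReal := by
      refine hle x _ ENNReal.toReal_nonneg fun i hi z hz => ?_
      rw [← ENNReal.ofReal_le_iff_le_toReal hJfin, ofReal_norm]
      refine (enorm_le_lintegral_ball (hu i) z).trans ?_
      refine le_trans ?_ (Finset.single_le_sum (f := fun i => (sobolevConst d : ℝ≥0∞) *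
        ∑ k ∈ listsLE d d, ∫⁻ y in Metric.closedBall x (R + d), ‖dl k (u i) y‖ₑ)
        (fun _ _ => zero_le) hi)
      refine mul_le_mul_right (Finset.sum_le_sum fun k _ => lintegral_mono_set ?_) _
      refine Metric.closedBall_subset_closedBall' ?_
      rw [dist_eq_norm]
      linarith
    have hG2 : ‖G x‖ₑ ≤ A * J := by
      rw [← ofReal_norm]
      refine (ENNReal.ofReal_le_ofReal hG1).trans ?_
      rw [ENNReal.ofReal_mul A.coe_nonneg, ENNReal.ofReal_toReal hJfin]
      simp
    have hsum : ‖∑ i ∈ s, ∑ k ∈ listsLE d d, H i k x‖ₑ =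
        ∑ i ∈ s, ∑ k ∈ listsLE d d, I i k x := by
      simp only [H]
      have : ∑ i ∈ s, ∑ k ∈ listsLE d d, (((I i k x).toReal : ℝ) : ℂ) =
          (((∑ i ∈ s, ∑ k ∈ listsLE d d, I i k x).toReal : ℝ) : ℂ) := by
        rw [ENNReal.toReal_sum fun i _ =>
          (ENNReal.sum_lt_top.2 fun k _ => hIfin i k x).ne]
        push_cast
        refine Finset.sum_congr rfl fun i _ => ?_
        rw [ENNReal.toReal_sum fun k _ => (hIfin i k x).ne]
        push_cast
        rfl
      rw [this, ← ofReal_norm, Complex.norm_real, Real.norm_of_nonneg ENNReal.toReal_nonneg,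
        ENNReal.ofReal_toReal]
      exact (ENNReal.sum_lt_top.2 fun i _ => ENNReal.sum_lt_top.2 fun k _ => hIfin i k x).ne
    rw [hsum, enorm_mul, mul_comm]
    refine (mul_le_mul_right hG2 _).trans ?_
    rw [mul_left_comm, ENNReal.coe_mul, mul_assoc]
    refine mul_le_mul_right ?_ _
    rw [hJ, Finset.mul_sum, ENNReal.coe_mul, mul_assoc, Finset.mul_sum, Finset.mul_sum]
    refine Finset.sum_le_sum fun i _ => ?_
    rw [mul_left_comm]
    refine mul_le_mul_right ?_ _
    rw [Finset.mul_sum, Finset.mul_sum]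
    exact Finset.sum_le_sum fun k _ => hcmp x i k
  have hHm : ∀ i k, AEStronglyMeasurable (H i k) volume := fun i k =>
    (Complex.measurable_ofReal.comp (hIm i k).ennreal_toReal).aestronglyMeasurable
  refine (slNorm_const_mul_le B (aestronglyMeasurable_weight hw hv n m' hG)
    (.of_forall hpt)).trans ?_
  have hS : B.slNorm (fun x => ∑ i ∈ s, ∑ k ∈ listsLE d d, H i k x) ≤
      ∑ i ∈ s, ∑ k ∈ listsLE d d, B.slNorm (H i k) := by
    have hm1 : ∀ i, AEStronglyMeasurable (fun x => ∑ k ∈ listsLE d d, H i k x) volume :=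
      fun i => Finset.aestronglyMeasurable_fun_sum _ fun k _ => hHm i k
    refine (slNorm_le_sum B s (g := fun i x => ∑ k ∈ listsLE d d, H i k x)
      (Finset.aestronglyMeasurable_fun_sum _ fun i _ => hm1 i)
      (.of_forall fun x => enorm_sum_le _ _)).trans (Finset.sum_le_sum fun i _ => ?_)
    exact slNorm_le_sum B _ (hm1 i) (.of_forall fun x => enorm_sum_le _ _)
  calc _ ≤ ((A * (sobolevConst d * (C₁ * C₂).toNNReal) : ℝ≥0) : ℝ≥0∞) *
        ∑ i ∈ s, ∑ k ∈ listsLE d d, (C₃ * wsl B w v n' m (dl k (u i))) := by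
        gcongr
        exact hS.trans (Finset.sum_le_sum fun i _ => Finset.sum_le_sum fun k _ => hHn i k)
    _ = _ := by
        simp_rw [← Finset.mul_sum]
        push_cast
        ring

/-- Local uniform bounds by weighted semi-local norms. -/
theorem exists_enorm_le_wsl (hw : IsWeightSystem w) (hv : IsWeightSystem v) (n m : ℕ) (R : ℝ) :
    ∃ C : ℝ≥0, ∀ {u : Rd d → ℂ} (_ : ContDiff ℝ ∞ u) (x : Rd d), ‖x‖ ≤ R →
      ‖u x‖ₑ ≤ C * ∑ k ∈ listsLE d d, wsl B w v n m (dl k u) := by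
  obtain ⟨C, hC⟩ := exists_lintegral_le_slNorm B (isCompact_closedBall (0 : Rd d) (R + d))
  obtain ⟨Q, hQ⟩ := hv.locallyBounded m _ (isCompact_closedBall (0 : Rd d) (R + d))
  refine ⟨sobolevConst d * (Q.toNNReal * C), fun {u} hu x hx => ?_⟩
  refine (enorm_le_lintegral_ball hu x).trans ?_
  rw [ENNReal.coe_mul, mul_assoc, ENNReal.coe_natCast]
  refine mul_le_mul_right ?_ _
  rw [Finset.mul_sum]
  refine Finset.sum_le_sum fun k _ => ?_
  rw [ENNReal.coe_mul, mul_assoc]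
  refine le_trans ?_ (mul_le_mul_right (hC _) _)
  rw [← lintegral_const_mul' _ _ ENNReal.coe_ne_top]
  refine (lintegral_mono_set (t := Metric.closedBall 0 (R + d)) ?_).trans
    (setLIntegral_mono' measurableSet_closedBall fun y hy => ?_)
  · refine Metric.closedBall_subset_closedBall' ?_
    rw [dist_zero_right]
    linarith
  · have h1 := hQ y hy
    have h2 := hv.pos m y
    have h3 := hw.one_le n y
    rw [enorm_mul, mul_left_comm]
    -- On this ball 1 ≤ Q w_n / v_m, because w_n ≥ 1 and v_m ≤ Q.
    refine le_mul_of_one_le_right zero_le ?_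
    rw [← ofReal_norm, norm_weight hw hv, ← ENNReal.ofReal.eq_1,
      ← ENNReal.ofReal_mul (h2.le.trans h1), ENNReal.one_le_ofReal, mul_div_assoc',
      le_div_iff₀ h2, one_mul]
    nlinarith

end Weights

section Main

variable {w v : ℕ → Rd d → ℝ}
variable {E : Type*} [NormedAddCommGroup E] [NormedSpace ℂ E] [CompleteSpace E]
variable (B : SolidTIBF d E)

/-! ### Bounded sets and the class of multipliers -/

theorem iSup_multiDeriv_le_iff {g : Rd d → ℂ} (hg : ContDiff ℝ ∞ g) (n m : ℕ) (M : ℝ≥0∞) :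
    B.semiLocal.normCn n (fun x => w n x / v m x) g ≤ M ↔
      ∀ l : List (Fin d), l.length ≤ n → wsl B w v n m (dl l g) ≤ M := by
  unfold FunSpace.normCn
  rw [iSup₂_le_iff]
  constructor
  · intro h l hl
    rw [dl_eq_multiDeriv hg]
    exact h (listIndex l) (by rwa [sum_listIndex])
  · intro h α hα
    have := h (indexList α) (by rwa [length_indexList])
    rwa [← multiDeriv_eq_dl] at this

theorem boundedCn_iff {S : Set (Rd d → ℂ)} (hS : ∀ g ∈ S, ContDiff ℝ ∞ g) (n m : ℕ) :
    B.semiLocal.BoundedCn n (fun x => w n x / v m x) S ↔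
      ∃ M : ℝ≥0, ∀ g ∈ S, ∀ l : List (Fin d), l.length ≤ n → wsl B w v n m (dl l g) ≤ M := by
  constructor
  · rintro ⟨-, M, hM⟩
    exact ⟨M, fun g hg => (iSup_multiDeriv_le_iff B (hS g hg) n m M).1 (hM g hg)⟩
  · rintro ⟨M, hM⟩
    refine ⟨fun g hg => ⟨(hS g hg).of_le (by exact_mod_cast le_top), fun α hα => ?_⟩,
      M, fun g hg => (iSup_multiDeriv_le_iff B (hS g hg) n m M).2 (hM g hg)⟩
    rw [semiLocal_mem_iff, multiDeriv_eq_dl]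
    exact (hM g hg _ (by rwa [length_indexList])).trans_lt ENNReal.coe_lt_top

/-- Smooth functions all of whose derivatives lie in weighted semi-local spaces. -/
def IsMultiplier (w v : ℕ → Rd d → ℝ) (F : Rd d → ℂ) : Prop :=
  ContDiff ℝ ∞ F ∧ ∀ n, ∃ m, ∀ l : List (Fin d), l.length ≤ n → wsl B w v n m (dl l F) < ⊤

/-! ### Convergence of smooth functions -/

theorem coordForm_sub (c c' : Fin d → ℂ) : coordForm c - coordForm c' = coordForm (c - c') := by
  ext v
  simp [coordForm_apply, mul_sub]

/-- Geometric increments make every derivative converge locally uniformly. The limits are then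
derivatives of one another, so `contDiff_of_family` shows that the limit is smooth. -/
theorem exists_smooth_limit {g : ℕ → Rd d → ℂ} (hg : ∀ j, ContDiff ℝ ∞ (g j))
    (hb : ∀ (l : List (Fin d)) (R : ℝ), ∃ C : ℝ, ∀ j x, ‖x‖ ≤ R →
      ‖dl l (g (j + 1)) x - dl l (g j) x‖ ≤ C * (1 / 2) ^ j) :
    ∃ F : Rd d → ℂ, ContDiff ℝ ∞ F ∧ (∀ l x,
      Filter.Tendsto (fun j => dl l (g j) x) Filter.atTop (nhds (dl l F x))) ∧
      ∀ R : ℝ, ∃ C : ℝ, ∀ j x, ‖x‖ ≤ R → ‖g j x - F x‖ ≤ C * (1 / 2) ^ j := by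
  choose C hC using hb
  have hlim : ∀ l x, ∃ a, Filter.Tendsto (fun j => dl l (g j) x) Filter.atTop (nhds a) := by
    intro l x
    refine cauchySeq_tendsto_of_complete
      (cauchySeq_of_le_geometric (1 / 2) (C l ‖x‖) (by norm_num) fun j => ?_)
    rw [dist_comm, dist_eq_norm]
    exact hC l ‖x‖ j x le_rfl
  choose G hG using hlim
  have hrate : ∀ l R j x, ‖x‖ ≤ R → ‖dl l (g j) x - G l x‖ ≤ 2 * C l R * (1 / 2) ^ j := by
    intro l R j x hx
    have := dist_le_of_le_geometric_of_tendsto (1 / 2) (C l R) (by norm_num)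
      (f := fun j => dl l (g j) x) (fun j => by
        rw [dist_comm, dist_eq_norm]
        exact hC l R j x hx) (hG l x) j
    rw [dist_eq_norm] at this
    refine this.trans (le_of_eq ?_)
    ring
  have hfam : ∀ l x, HasFDerivAt (G l) (coordForm fun i => G (i :: l) x) x := by
    intro l x
    refine hasFDerivAt_of_tendstoLocallyUniformlyOn (l := Filter.atTop) isOpen_univ
      (f := fun j => dl l (g j)) (f' := fun j x => coordForm fun i => dl (i :: l) (g j) x)
      (g' := fun x => coordForm fun i => G (i :: l) x) ?_
      (fun j y _ => hasFDerivAt_coordForm (contDiff_dl (hg j) l) y) (fun y _ => hG l y)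
      (Set.mem_univ x)
    rw [Metric.tendstoLocallyUniformlyOn_iff]
    intro ε hε y _
    refine ⟨Metric.ball 0 (‖y‖ + 1), mem_nhdsWithin_of_mem_nhds
      (Metric.isOpen_ball.mem_nhds (by simp)), ?_⟩
    have h0 : Filter.Tendsto (fun j : ℕ => (∑ i, 2 * C (i :: l) (‖y‖ + 1)) * (1 / 2 : ℝ) ^ j)
        Filter.atTop (nhds 0) := by
      simpa using (tendsto_pow_atTop_nhds_zero_of_lt_one (r := (1 / 2 : ℝ))
        (by norm_num) (by norm_num)).const_mul (∑ i, 2 * C (i :: l) (‖y‖ + 1))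
    filter_upwards [h0.eventually (gt_mem_nhds hε)] with j hj z hz
    rw [dist_comm, dist_eq_norm, coordForm_sub]
    refine (norm_coordForm_le _).trans_lt (lt_of_le_of_lt ?_ hj)
    rw [Finset.sum_mul]
    exact Finset.sum_le_sum fun i _ => hrate (i :: l) _ j z (mem_ball_zero_iff.1 hz).le
  have hdl : ∀ l, dl l (G []) = G l := by
    intro l
    have := dl_family hfam l []
    rwa [List.append_nil] at this
  refine ⟨G [], contDiff_of_family hfam [], fun l x => ?_, fun R => ⟨2 * C [] R, ?_⟩⟩
  · rw [hdl]
    exact hG l x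
  · exact fun j x hx => hrate [] R j x hx

/-! ### From mollifications to the multiplier class -/

/-- With η_j = Σ_ℓ χ^ℓ_j * ψ^ℓ_j, the vanishing moments of ψ^ℓ bound f * η_j by local suprema of L
further derivatives of f * χ^ℓ_j, times 2^{-jL}. The growth factor c_j passes through unchanged. -/
theorem exists_dilate_bound (hw : IsWeightSystem w) (hv : IsWeightSystem v)
    (hwM : WeakModerate w) (hvM : WeakModerate v) (f : Distr d) {χ : Fin 2 → Test d} {c : ℕ → ℝ≥0}
    (hb : ∀ n, ∃ m, ∃ M : ℝ≥0, ∀ (j : ℕ) (ℓ : Fin 2) (l : List (Fin d)), l.length ≤ n →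
      wsl B w v n m (dl l (distConv f (dilate j (χ ℓ)))) ≤ c j * M)
    {L : ℕ} {ψ : Fin 2 → Test d} (hψ : ∀ ℓ, VanishingMoments L (ψ ℓ)) {η : Test d}
    (hη : ⇑η = conv (χ 0) (ψ 0) + conv (χ 1) (ψ 1)) (n : ℕ) :
    ∃ m, ∃ M : ℝ≥0, ∀ (j : ℕ) (l : List (Fin d)), l.length ≤ n →
      wsl B w v n m (dl l (distConv f (dilate j η))) ≤ (c j * ((2 ^ j)⁻¹ ^ L) * M : ℝ≥0) := by
  choose A R hA0 hR0 hA using fun ℓ =>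
    exists_norm_conv_dilate_le_of_vanishingMoments L (hψ ℓ)
  obtain ⟨n', hn', hkey⟩ := exists_wsl_le_of_sup B hw hv hwM hvM
    (add_nonneg (hR0 0) (hR0 1)) n
  -- The n derivatives of the claim, L for the moments and d for the Sobolev inequality; n' is the
  -- weight index.
  obtain ⟨m, M, hM⟩ := hb (max n' (n + L + d))
  obtain ⟨m', hm', C, hC⟩ := hkey m
  set s : Finset (Fin 2 × List (Fin d)) := Finset.univ ×ˢ listsEQ d L
  refine ⟨m', (A 0 + A 1).toNNReal * C * (s.card * ((listsLE d d).card * M)), fun j l hl => ?_⟩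
  set u : Fin 2 → Rd d → ℂ := fun ℓ => dl l (distConv f (dilate j (χ ℓ)))
  have hu : ∀ ℓ, ContDiff ℝ ∞ (u ℓ) := fun ℓ => contDiff_dl (contDiff_distConv f _) l
  have hG : dl l (distConv f (dilate j η)) = ∑ ℓ, conv (u ℓ) (dilate j (ψ ℓ)) := by
    rw [distConv_dilate_factor f j hη, dl_sum]
    · refine Finset.sum_congr rfl fun ℓ _ => ?_
      rw [dl_conv_left (contDiff_distConv f _) (smooth_test _) (dilate j (ψ ℓ)).hasCompactSupport]
    · exact fun ℓ => contDiff_conv (contDiff_distConv f _).continuous.locallyIntegrable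
        (smooth_test _) (dilate j (ψ ℓ)).hasCompactSupport
  have hA01 : 0 ≤ A 0 + A 1 := add_nonneg (hA0 0) (hA0 1)
  have h1 := hC s (fun p => dl p.2 (u p.1)) (fun p => contDiff_dl (hu p.1) p.2)
    (dl l (distConv f (dilate j η))) ((A 0 + A 1).toNNReal * (2 ^ j)⁻¹ ^ L)
    (contDiff_dl (contDiff_distConv f _) l).continuous.aestronglyMeasurable (by
      intro x K hK hle
      rw [hG, Finset.sum_apply, Fin.sum_univ_two]
      have h2 : ∀ ℓ, ‖conv (u ℓ) (dilate j (ψ ℓ)) x‖ ≤ A ℓ * K * ((2 : ℝ) ^ j)⁻¹ ^ L := by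
        intro ℓ
        refine hA ℓ j (hu ℓ) x K hK fun l' hl' z hz => ?_
        refine hle (ℓ, l') (Finset.mem_product.2 ⟨Finset.mem_univ _, mem_listsEQ.2 hl'⟩) z
          (hz.trans ?_)
        have := hR0 0
        have := hR0 1
        fin_cases ℓ <;> simp [*]
      refine (norm_add_le _ _).trans ((add_le_add (h2 0) (h2 1)).trans (le_of_eq ?_))
      push_cast
      rw [Real.coe_toNNReal _ hA01]
      ring)
  refine h1.trans ?_
  have h3 : ∀ p ∈ s, ∀ k ∈ listsLE d d, wsl B w v n' m (dl k (dl p.2 (u p.1))) ≤ c j * M := by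
    intro p hp k hk
    refine (wsl_mono_index B hw hv (le_max_left _ (n + L + d)) le_rfl
      (contDiff_dl (contDiff_dl (hu p.1) p.2) k).continuous.aestronglyMeasurable).trans ?_
    simp only [u, ← dl_append]
    refine hM j p.1 _ ?_
    have h4 := mem_listsLE.1 hk
    have h5 := mem_listsEQ.1 (Finset.mem_product.1 hp).2
    refine le_trans ?_ (le_max_right _ _)
    simp only [List.length_append]
    omega
  have h4 : ∑ p ∈ s, ∑ k ∈ listsLE d d, wsl B w v n' m (dl k (dl p.2 (u p.1))) ≤
      s.card * ((listsLE d d).card * (c j * M)) := by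
    refine (Finset.sum_le_card_nsmul _ _ _ fun p hp => ?_).trans (by rw [nsmul_eq_mul])
    exact (Finset.sum_le_card_nsmul _ _ _ fun k hk => h3 p hp k hk).trans (by rw [nsmul_eq_mul])
  refine (mul_le_mul_right h4 _).trans (le_of_eq ?_)
  push_cast
  ring

theorem isMultiplier_of_bounded (hw : IsWeightSystem w) (hv : IsWeightSystem v)
    (hwM : WeakModerate w) (hvM : WeakModerate v) (f : Distr d) {χ : Fin 2 → Test d}
    (hχ : HasMDFP χ) {r : ℝ}
    (hb : ∀ n, ∃ m, ∃ M : ℝ≥0, ∀ (j : ℕ) (ℓ : Fin 2) (l : List (Fin d)), l.length ≤ n →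
      wsl B w v n m (dl l (distConv f (dilate j (χ ℓ)))) ≤
        ((2 : ℝ≥0) ^ (r * j) : ℝ≥0) * M) :
    ∃ F : Rd d → ℂ, IsMultiplier B w v F ∧ ∀ θ : Test d, f θ = ∫ x, F x * θ x := by
  obtain ⟨K, -, -, hL⟩ := hχ
  -- This gives 2^{rj} 2^{-jL} ≤ 2^{-j}. The choice precedes any n, so that one sequence f * φ⁰_j
  -- works for all norms.
  obtain ⟨L, hrL⟩ := exists_nat_ge (r + 1)
  obtain ⟨φ, ψ, hφψ, hlap, hφ1, hφ, hψ⟩ := hL L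
  set g : ℕ → Rd d → ℂ := fun j => distConv f (dilate j (φ 0)) with hgdef
  have hg : ∀ j, ContDiff ℝ ∞ (g j) := fun j => contDiff_distConv f _
  have hrate : ∀ j : ℕ, (2 : ℝ≥0) ^ (r * j) * ((2 ^ j)⁻¹ ^ L) ≤ (2⁻¹) ^ j := by
    intro j
    have e1 : ((2 : ℝ≥0) ^ j)⁻¹ ^ L = (2 : ℝ≥0) ^ (-(L * j : ℝ)) := by
      rw [NNReal.rpow_neg, ← Nat.cast_mul, NNReal.rpow_natCast, inv_pow, ← pow_mul, mul_comm]
    have e2 : (2⁻¹ : ℝ≥0) ^ j = (2 : ℝ≥0) ^ (-(j : ℝ)) := by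
      rw [NNReal.rpow_neg, NNReal.rpow_natCast, inv_pow]
    rw [e1, e2, ← NNReal.rpow_add two_ne_zero]
    refine NNReal.rpow_le_rpow_of_exponent_le one_le_two ?_
    have : (0 : ℝ) ≤ j := Nat.cast_nonneg j
    nlinarith
  have hstart : ∀ n, ∃ m, ∀ l : List (Fin d), l.length ≤ n → wsl B w v n m (dl l (g 0)) < ⊤ := by
    intro n
    -- The functions φ^ℓ need no vanishing moments: L = 0 yields no decay, but only the scale j = 0
    -- is used.
    obtain ⟨m, M, h⟩ := exists_dilate_bound B hw hv hwM hvM f hb (L := 0) (ψ := φ)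
      (fun ℓ α hα => absurd hα (Nat.not_lt_zero _)) hφ n
    exact ⟨m, fun l hl => (h 0 l hl).trans_lt ENNReal.coe_lt_top⟩
  have hstep : ∀ n, ∃ m, ∃ M : ℝ≥0, ∀ (j : ℕ) (l : List (Fin d)), l.length ≤ n →
      wsl B w v n m (dl l (g (j + 1) - g j)) ≤ ((2⁻¹) ^ j * M : ℝ≥0) := by
    intro n
    obtain ⟨m, M, h⟩ := exists_dilate_bound B hw hv hwM hvM f hb (fun ℓ => (hφψ ℓ).2.2.1) hψ (n + 2)
    -- The factor d counts the terms of the Laplacian, whose two derivatives account for n + 2. The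
    -- factor 4^{-j} is only bounded by 1; the decay comes from the moments.
    refine ⟨m, d * M, fun j l hl => ?_⟩
    set u := distConv f (dilate j (ψ 0))
    have hu : ContDiff ℝ ∞ u := contDiff_distConv f _
    have hd : ContDiff ℝ ∞ (g (j + 1) - g j) := (hg _).sub (hg _)
    have h1 : g (j + 1) - g j = ((4 : ℂ) ^ j)⁻¹ • ∑ i, dl [i, i] u := by
      simp only [hgdef]
      rw [distConv_dilate_succ f hlap, add_sub_cancel_left]
    have h2 : dl l (g (j + 1) - g j) = ((4 : ℂ) ^ j)⁻¹ • ∑ i, dl (l ++ [i, i]) u := by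
      have hs : ContDiff ℝ ∞ (∑ i, dl [i, i] u) := by
        have : ContDiff ℝ ∞ fun x => ∑ i, dl [i, i] u x :=
          ContDiff.sum fun i _ => contDiff_dl hu [i, i]
        convert this using 1
        ext; simp
      rw [h1, dl_const_smul hs, dl_sum _ fun i => contDiff_dl hu [i, i]]
      simp_rw [dl_append]
    refine (wsl_le_sum B hw hv n m Finset.univ (g := fun i => dl (l ++ [i, i]) u)
      (contDiff_dl hd l).continuous.aestronglyMeasurable fun x => ?_).trans ?_
    · rw [h2, Pi.smul_apply, Finset.sum_apply, enorm_smul]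
      refine le_trans ?_ (enorm_sum_le _ _)
      refine mul_le_of_le_one_left zero_le ?_
      rw [← ofReal_norm, ENNReal.ofReal_le_one, norm_inv, norm_pow]
      refine inv_le_one_of_one_le₀ (one_le_pow₀ ?_)
      norm_num
    · refine (Finset.sum_le_card_nsmul _ _ ((2⁻¹ ^ j * M : ℝ≥0) : ℝ≥0∞) fun i _ => ?_).trans ?_
      · refine (wsl_mono_index B hw hv (Nat.le_add_right n 2) le_rfl
          (contDiff_dl hu _).continuous.aestronglyMeasurable).trans
          ((h j _ (by simpa using hl)).trans ?_)
        rw [ENNReal.coe_le_coe]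
        exact mul_le_mul_left (hrate j) _
      · rw [nsmul_eq_mul, Finset.card_univ, Fintype.card_fin]
        refine le_of_eq ?_
        push_cast
        ring
  obtain ⟨F, hF, hFlim, hFrate⟩ := exists_smooth_limit hg (by
    intro l R
    obtain ⟨m, M, hM⟩ := hstep (d + l.length)
    obtain ⟨C, hC⟩ := exists_enorm_le_wsl B hw hv (d + l.length) m R
    refine ⟨C * ((listsLE d d).card * M), fun j x hx => ?_⟩
    have hs : ContDiff ℝ ∞ (g (j + 1) - g j) := (hg _).sub (hg _)
    have h1 := hC (contDiff_dl hs l) x hx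
    have h2 : ∑ k ∈ listsLE d d, wsl B w v (d + l.length) m (dl k (dl l (g (j + 1) - g j))) ≤
        (listsLE d d).card * ((2⁻¹) ^ j * M : ℝ≥0) := by
      refine (Finset.sum_le_card_nsmul _ _ _ fun k hk => ?_).trans (by rw [nsmul_eq_mul])
      rw [← dl_append]
      refine hM j _ ?_
      rw [List.length_append]
      exact Nat.add_le_add_right (mem_listsLE.1 hk) _
    have h3 := h1.trans (mul_le_mul_right h2 _)
    have h4 : (C : ℝ≥0∞) * ((listsLE d d).card * ((2⁻¹) ^ j * M : ℝ≥0)) =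
        ((C * ((listsLE d d).card * M) * 2⁻¹ ^ j : ℝ≥0) : ℝ≥0∞) := by
      push_cast
      ring
    rw [dl_sub (hg _) (hg _), Pi.sub_apply, h4, enorm_eq_nnnorm, ENNReal.coe_le_coe, ← NNReal.coe_le_coe] at h3
    simpa using h3)
  refine ⟨F, ⟨hF, fun n => ?_⟩, fun θ => ?_⟩
  · obtain ⟨m₁, h₁⟩ := hstart n
    obtain ⟨m₂, M, h₂⟩ := hstep n
    refine ⟨max m₁ m₂, fun l hl => ?_⟩
    -- The terms of the telescoping series for the derivative of F, preceded by the contribution of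
    -- the scale j = 0.
    set a : ℕ → Rd d → ℂ := fun k => Nat.casesOn k (dl l (g 0)) fun k => dl l (g (k + 1) - g k)
    have hsum : ∀ j x, ‖dl l (g j) x‖ₑ ≤ ∑ k ∈ Finset.range (j + 1), ‖a k x‖ₑ := by
      intro j x
      induction j with
      | zero => simp [a]
      | succ j ih =>
        rw [Finset.sum_range_succ]
        have : dl l (g (j + 1)) x = dl l (g j) x + a (j + 1) x := by
          simp only [a]
          rw [dl_sub (hg _) (hg _), Pi.sub_apply, add_sub_cancel]
        rw [this]
        exact (enorm_add_le _ _).trans (add_le_add_left ih _)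
    have hle : ∀ x, ‖dl l F x‖ₑ ≤ ∑' k, ‖a k x‖ₑ := fun x =>
      le_of_tendsto' (hFlim l x).enorm fun j => (hsum j x).trans (ENNReal.sum_le_tsum _)
    refine (wsl_le_tsum B hw hv n (max m₁ m₂) (contDiff_dl hF l).continuous.aestronglyMeasurable
      hle).trans_lt ?_
    rw [tsum_eq_zero_add' ENNReal.summable]
    refine ENNReal.add_lt_top.2 ⟨?_, ?_⟩
    · exact (wsl_mono_index B hw hv le_rfl (le_max_left _ _)
        (contDiff_dl (hg 0) l).continuous.aestronglyMeasurable).trans_lt (h₁ l hl)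
    · have hd : ∀ k, ContDiff ℝ ∞ (g (k + 1) - g k) := fun k => (hg _).sub (hg _)
      refine lt_of_le_of_lt (ENNReal.tsum_le_tsum fun k =>
        (wsl_mono_index B hw hv le_rfl (le_max_right m₁ m₂)
          (contDiff_dl (hd k) l).continuous.aestronglyMeasurable).trans
          (h₂ k l hl)) ?_
      simp_rw [ENNReal.coe_mul, ENNReal.tsum_mul_right]
      refine ENNReal.mul_lt_top ?_ ENNReal.coe_lt_top
      simp_rw [ENNReal.coe_pow, ENNReal.coe_inv two_ne_zero, ENNReal.coe_ofNat]
      rw [ENNReal.tsum_geometric_two]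
      exact ENNReal.ofNat_lt_top
  · refine tendsto_nhds_unique (tendsto_integral_distConv f hφ1 θ) ?_
    obtain ⟨S, hS0, hS⟩ := exists_support_bound θ
    obtain ⟨C, hC⟩ := hFrate S
    have hint : ∀ {u : Rd d → ℂ}, ContDiff ℝ ∞ u → Integrable fun x => u x * θ x := fun hu =>
      (hu.continuous.mul θ.continuous).integrable_of_hasCompactSupport
        θ.hasCompactSupport.mul_left
    rw [tendsto_iff_norm_sub_tendsto_zero]
    refine squeeze_zero (fun _ => norm_nonneg _) (g := fun j =>
      (∫ x, C * ‖θ x‖) * (1 / 2 : ℝ) ^ j) (fun j => ?_) ?_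
    · rw [← integral_sub (hint (hg j)) (hint hF), ← integral_mul_const]
      refine norm_integral_le_of_norm_le (((θ.continuous.integrable_of_hasCompactSupport
        θ.hasCompactSupport).norm.const_mul _).mul_const _) (.of_forall fun x => ?_)
      rw [← sub_mul, norm_mul]
      by_cases hx : θ x = 0
      · simp [hx]
      · refine (mul_le_mul_of_nonneg_right (hC j x (hS x hx)) (norm_nonneg _)).trans
          (le_of_eq ?_)
        ring
    · simpa using (tendsto_pow_atTop_nhds_zero_of_lt_one (r := (1 / 2 : ℝ))
        (by norm_num) (by norm_num)).const_mul (∫ x, C * ‖θ x‖)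

end Main

section Sufficiency

variable {w v : ℕ → Rd d → ℝ}
variable {E : Type*} [NormedAddCommGroup E] [NormedSpace ℂ E] [CompleteSpace E]
variable (B : SolidTIBF d E)

/-! ### Products of semi-local functions and functions vanishing at infinity -/

/-- This is E_sl · L⁰ ⊆ E. With balls outside which |h| ≤ 2^{-k}, the product is dominated by a
series of truncations of g with summable coefficients, each truncation having norm at most `B.slNorm
g`. -/
theorem norm_mul_lt_top {g h : Rd d → ℂ} (hg : B.slNorm g < ⊤) (hh : (Lzero d).Mem h) :
    B.space.norm (fun x => g x * h x) < ⊤ := by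
  have hgm : AEStronglyMeasurable g volume :=
    ((semiLocal_mem_iff B).2 hg).1.aestronglyMeasurable
  obtain ⟨hL, h0⟩ := hh
  have hR : ∀ k : ℕ, ∃ R : ℝ, 0 < R ∧ (k : ℝ) ≤ R ∧
      ∀ᵐ x, x ∉ Metric.closedBall (0 : Rd d) R → ‖h x‖ₑ ≤ ((2⁻¹ ^ k : ℝ≥0) : ℝ≥0∞) := by
    intro k
    obtain ⟨K, hK, hKx⟩ := h0 (2⁻¹ ^ k) (by positivity)
    obtain ⟨R, hR⟩ := hK.isBounded.subset_closedBall 0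
    refine ⟨max R (k + 1), lt_max_of_lt_right (by positivity),
      le_max_of_le_right (by linarith), hKx.mono fun x hx hxR => ?_⟩
    rw [enorm_eq_nnnorm, ENNReal.coe_le_coe, ← NNReal.coe_le_coe]
    have := hx fun hxK => hxR (Metric.closedBall_subset_closedBall (le_max_left _ _) (hR hxK))
    simpa using this
  choose R hR0 hRk hR using hR
  set M : ℝ≥0 := (eLpNorm h ⊤ volume).toNNReal
  have hM : ∀ᵐ x, ‖h x‖ₑ ≤ (M : ℝ≥0∞) := by
    rw [ENNReal.coe_toNNReal hL.2.ne, eLpNorm_exponent_top]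
    exact ae_le_eLpNormEssSup
  -- The shift by one matters: if k + 1 is the first index whose ball contains x, then x lies
  -- outside ball k and |h(x)| ≤ 2^{-k}. On ball 0 only the global bound M is available.
  set c : ℕ → ℝ≥0 := fun k => Nat.casesOn k M fun k => 2⁻¹ ^ k
  set a : ℕ → Rd d → ℂ := fun k x =>
    (((c k : ℝ≥0) : ℝ) : ℂ) * (Metric.closedBall 0 (R k)).indicator g x
  have hc : ∀ k x, ‖a k x‖ₑ = c k * ‖(Metric.closedBall 0 (R k)).indicator g x‖ₑ := by
    intro k x
    simp only [a]
    rw [enorm_mul, ← ofReal_norm ((c k : ℝ) : ℂ), Complex.norm_real,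
      Real.norm_of_nonneg (c k).coe_nonneg, ENNReal.ofReal_coe_nnreal]
  refine lt_of_le_of_lt (norm_le_tsum B (g := a) (hgm.mul hL.1) ?_) ?_
  · filter_upwards [hM, ae_all_iff.2 hR] with x hx1 hx2
    have hex : ∃ k, x ∈ Metric.closedBall (0 : Rd d) (R k) := by
      obtain ⟨k, hk⟩ := exists_nat_ge ‖x‖
      exact ⟨k, mem_closedBall_zero_iff.2 (hk.trans (hRk k))⟩
    classical
    refine le_trans ?_ (ENNReal.le_tsum (Nat.find hex))
    rw [hc, Set.indicator_of_mem (Nat.find_spec hex), enorm_mul, mul_comm]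
    refine mul_le_mul_left ?_ _
    rcases hk : Nat.find hex with - | k
    · exact hx1
    · refine hx2 k (Nat.find_min hex ?_)
      omega
  · have h1 : ∀ k, B.space.norm (a k) ≤ c k * B.slNorm g := fun k =>
      (norm_const_mul_le B (((hgm.indicator measurableSet_closedBall)).const_mul _)
        (.of_forall fun x => (hc k x).le)).trans
        (mul_le_mul_right (norm_indicator_le_slNorm B (hR0 k) g) _)
    refine lt_of_le_of_lt (ENNReal.tsum_le_tsum h1) ?_
    rw [ENNReal.tsum_mul_right]
    refine ENNReal.mul_lt_top ?_ hg
    rw [tsum_eq_zero_add' ENNReal.summable]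
    refine ENNReal.add_lt_top.2 ⟨ENNReal.coe_lt_top, ?_⟩
    simp only [c]
    simp_rw [ENNReal.coe_pow, ENNReal.coe_inv two_ne_zero, ENNReal.coe_ofNat]
    rw [ENNReal.tsum_geometric_two]
    exact ENNReal.ofNat_lt_top

/-! ### Derivatives of products of multipliers with elements of Ḃ_𝒱 -/

theorem memInfty_iff {X : FunSpace d} {φ : Rd d → ℂ} :
    X.MemInfty w φ ↔ ContDiff ℝ ∞ φ ∧
      ∀ (n : ℕ) (l : List (Fin d)), l.length ≤ n → X.Mem fun x => dl l φ x * (w n x : ℂ) := by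
  constructor
  · refine fun h => ⟨h.contDiff, fun n l hl => ?_⟩
    rw [dl_eq_multiDeriv h.contDiff]
    exact (h n).2 _ (by rwa [sum_listIndex])
  · rintro ⟨h1, h2⟩ n
    refine ⟨h1.of_le (by exact_mod_cast le_top), fun α hα => ?_⟩
    rw [multiDeriv_eq_dl]
    exact h2 n _ (by rwa [length_indexList])

theorem Lzero_mem_mono {g h : Rd d → ℂ} (hg : AEStronglyMeasurable g volume)
    (hle : ∀ x, ‖g x‖ ≤ ‖h x‖) (hh : (Lzero d).Mem h) : (Lzero d).Mem g := by
  refine ⟨hh.1.of_le hg (.of_forall hle), fun ε hε => ?_⟩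
  obtain ⟨K, hK, hKx⟩ := hh.2 ε hε
  exact ⟨K, hK, hKx.mono fun x hx hxK => (hle x).trans (hx hxK)⟩

theorem aestronglyMeasurable_mul_weight (hw : IsWeightSystem w) (n : ℕ)
    {g : Rd d → ℂ} (hg : AEStronglyMeasurable g volume) :
    AEStronglyMeasurable (fun x => g x * (w n x : ℂ)) volume :=
  hg.mul (Complex.measurable_ofReal.comp_aemeasurable (hw.measurable n)).aestronglyMeasurable

theorem norm_mul_weight_mono (hw : IsWeightSystem w) {n m : ℕ} (h : n ≤ m) (g : Rd d → ℂ)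
    (x : Rd d) : ‖g x * (w n x : ℂ)‖ ≤ ‖g x * (w m x : ℂ)‖ := by
  rw [norm_mul, norm_mul, Complex.norm_real, Complex.norm_real,
    Real.norm_of_nonneg (hw.pos n x).le, Real.norm_of_nonneg (hw.pos m x).le]
  exact mul_le_mul_of_nonneg_left (hw.mono_of_le h x) (norm_nonneg _)

theorem memInfty_partialDeriv (hv : IsWeightSystem v) {φ : Rd d → ℂ}
    (hφ : (Lzero d).MemInfty v φ) (i : Fin d) : (Lzero d).MemInfty v (partialDeriv i φ) := by
  obtain ⟨h1, h2⟩ := memInfty_iff.1 hφ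
  refine memInfty_iff.2 ⟨contDiff_partialDeriv h1 i, fun n l hl => ?_⟩
  have h3 := h2 (n + 1) (l ++ [i]) (by simpa using hl)
  rw [dl_append] at h3
  exact Lzero_mem_mono (aestronglyMeasurable_mul_weight hv n
    (contDiff_dl (contDiff_partialDeriv h1 i) l).continuous.aestronglyMeasurable)
    (norm_mul_weight_mono hv n.le_succ _) h3

theorem IsMultiplier.partialDeriv (hw : IsWeightSystem w) (hv : IsWeightSystem v) {F : Rd d → ℂ}
    (hF : IsMultiplier B w v F) (i : Fin d) : IsMultiplier B w v (partialDeriv i F) := by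
  refine ⟨contDiff_partialDeriv hF.1 i, fun n => ?_⟩
  obtain ⟨m, hm⟩ := hF.2 (n + 1)
  refine ⟨m, fun l hl => ?_⟩
  have h3 := hm (l ++ [i]) (by simpa using hl)
  rw [dl_append] at h3
  exact (wsl_mono_index B hw hv n.le_succ le_rfl
    (contDiff_dl (contDiff_partialDeriv hF.1 i) l).continuous.aestronglyMeasurable).trans_lt h3

theorem space_norm_add_le {g h : Rd d → ℂ} (hm : AEStronglyMeasurable (fun x => g x + h x) volume) :
    B.space.norm (fun x => g x + h x) ≤ B.space.norm g + B.space.norm h := by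
  have := norm_le_sum B Finset.univ (g := ![g, h]) hm (.of_forall fun x => by
    simpa using enorm_add_le (g x) (h x))
  simpa using this

/-- Multipliers and Ḃ_𝒱 are both stable under ∂_i, so peeling off the innermost derivative and using
the product rule reduces to order zero. There F φ w_n = (F w_n / v_m)(φ v_m) is a product of E_sl
and L⁰ factors. -/
theorem norm_dl_mul_lt_top (hw : IsWeightSystem w) (hv : IsWeightSystem v) {F φ : Rd d → ℂ}
    (hF : IsMultiplier B w v F) (hφ : (Lzero d).MemInfty v φ) (n : ℕ) (l : List (Fin d)) :
    B.space.norm (fun x => dl l (F * φ) x * (w n x : ℂ)) < ⊤ := by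
  induction l using List.reverseRecOn generalizing F φ with
  | nil =>
    obtain ⟨m, hm⟩ := hF.2 n
    have h1 := (memInfty_iff.1 hφ).2 m [] (Nat.zero_le _)
    refine lt_of_eq_of_lt ?_ (norm_mul_lt_top B (hm [] (Nat.zero_le _)) h1)
    congr 1
    ext x
    have : (v m x : ℂ) ≠ 0 := by exact_mod_cast (hv.pos m x).ne'
    simp only [dl_nil, Pi.mul_apply]
    push_cast
    field_simp
  | append_singleton l i ih =>
    have hφs := hφ.contDiff
    have h1 := ih (hF.partialDeriv B hw hv i) hφ
    have h2 := ih hF (memInfty_partialDeriv hv hφ i)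
    have hs1 : ContDiff ℝ ∞ (MollifierOM.partialDeriv i F * φ) :=
      (contDiff_partialDeriv hF.1 i).mul hφs
    have hs2 : ContDiff ℝ ∞ (F * MollifierOM.partialDeriv i φ) :=
      hF.1.mul (contDiff_partialDeriv hφs i)
    rw [dl_append, dl_cons, dl_nil, partialDeriv_mul hF.1 hφs, dl_add hs1 hs2]
    simp_rw [Pi.add_apply, add_mul]
    refine (space_norm_add_le B ?_).trans_lt (ENNReal.add_lt_top.2 ⟨h1, h2⟩)
    exact (aestronglyMeasurable_of_norm_lt_top B h1).add (aestronglyMeasurable_of_norm_lt_top B h2)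

theorem memOM_of_isMultiplier (hw : IsWeightSystem w) (hv : IsWeightSystem v) {f : Distr d}
    {F : Rd d → ℂ} (hF : IsMultiplier B w v F) (hf : ∀ θ : Test d, f θ = ∫ x, F x * θ x) :
    MemOM B v w f := by
  refine fun φ hφ => ⟨F * φ, memInfty_iff.2 ⟨hF.1.mul hφ.contDiff, fun n l _ => ?_⟩, fun θ => ?_⟩
  · exact (space_mem_iff B).2 (norm_dl_mul_lt_top B hw hv hF hφ n l)
  · rw [hf]
    refine integral_congr_ae (.of_forall fun x => ?_)
    change F x * (φ x * θ x) = F x * φ x * θ x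
    ring

/-! ### Mollifications of a multiplier -/

theorem distConv_eq_conv {f : Distr d} {F : Rd d → ℂ}
    (hf : ∀ θ : Test d, f θ = ∫ x, F x * θ x) (φ : Test d) : distConv f φ = conv F φ :=
  funext fun x => hf (reflTranslate x φ)

theorem exists_bound_of_isMultiplier (hw : IsWeightSystem w) (hv : IsWeightSystem v)
    (hwM : WeakModerate w) (hvM : WeakModerate v) {f : Distr d}
    {F : Rd d → ℂ} (hF : IsMultiplier B w v F) (hf : ∀ θ : Test d, f θ = ∫ x, F x * θ x)
    (φ : Test d) (n : ℕ) : ∃ m, ∃ M : ℝ≥0, ∀ (j : ℕ) (l : List (Fin d)), l.length ≤ n →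
      wsl B w v n m (dl l (distConv f (dilate j φ))) ≤ M := by
  obtain ⟨A, R, hA0, hR0, hA⟩ := exists_norm_conv_dilate_le φ
  obtain ⟨n', hn', hkey⟩ := exists_wsl_le_of_sup B hw hv hwM hvM hR0 n
  -- The n derivatives fall on F, and the Sobolev inequality takes d more.
  obtain ⟨m, hm⟩ := hF.2 (max n' (n + d))
  obtain ⟨m', hm', C, hC⟩ := hkey m
  set Q : ℝ≥0∞ := ∑ l ∈ listsLE d n, ∑ k ∈ listsLE d d, wsl B w v n' m (dl k (dl l F)) with hQ
  have hQfin : Q < ⊤ := by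
    refine ENNReal.sum_lt_top.2 fun l hl => ENNReal.sum_lt_top.2 fun k hk => ?_
    refine (wsl_mono_index B hw hv (le_max_left n' (n + d)) le_rfl
      (contDiff_dl (contDiff_dl hF.1 l) k).continuous.aestronglyMeasurable).trans_lt ?_
    rw [← dl_append]
    refine hm _ ?_
    have h4 := mem_listsLE.1 hk
    have h5 := mem_listsLE.1 hl
    refine le_trans ?_ (le_max_right _ _)
    rw [List.length_append]
    omega
  refine ⟨m', A.toNNReal * C * Q.toNNReal, fun j l hl => ?_⟩
  have hG : dl l (distConv f (dilate j φ)) = conv (dl l F) (dilate j φ) := by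
    rw [distConv_eq_conv hf, dl_conv_left hF.1 (smooth_test _) (dilate j φ).hasCompactSupport]
  have h1 := hC {()} (fun _ => dl l F) (fun _ => contDiff_dl hF.1 l)
    (dl l (distConv f (dilate j φ))) A.toNNReal
    (contDiff_dl (contDiff_distConv f _) l).continuous.aestronglyMeasurable (by
      intro x M hM hle
      rw [hG, Real.coe_toNNReal _ hA0]
      exact hA j _ x M fun z hz => hle () (by simp) z hz)
  rw [Finset.sum_singleton] at h1
  refine h1.trans ?_
  rw [ENNReal.coe_mul, ENNReal.coe_toNNReal hQfin.ne, ENNReal.coe_mul]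
  refine mul_le_mul_right ?_ _
  exact Finset.single_le_sum (f := fun l => ∑ k ∈ listsLE d d, wsl B w v n' m (dl k (dl l F)))
    (fun _ _ => zero_le) (mem_listsLE.2 hl)

end Sufficiency

section Necessity

variable {w v : ℕ → Rd d → ℝ}

/-! ### Slowly decreasing elements of `Ḃ_𝒱` -/

/-- The index of the annulus `ρ k ≤ ‖x‖ < ρ (k + 1)` containing `x`. -/
theorem exists_annulusIndex {ρ : ℕ → ℝ} (h0 : ρ 0 = 0) (hρ : ∀ k, ρ k + 1 ≤ ρ (k + 1)) :
    ∃ κ : Rd d → ℕ, Measurable κ ∧ ∀ x, ρ (κ x) ≤ ‖x‖ ∧ ‖x‖ < ρ (κ x + 1) := by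
  classical
  have hge : ∀ k : ℕ, (k : ℝ) ≤ ρ k := by
    intro k
    induction k with
    | zero => simp [h0]
    | succ k ih =>
      push_cast
      linarith [hρ k]
  have hex : ∀ x : Rd d, ∃ k, ‖x‖ < ρ (k + 1) := by
    intro x
    obtain ⟨k, hk⟩ := exists_nat_gt ‖x‖
    exact ⟨k, hk.trans_le ((hge k).trans (by linarith [hρ k]))⟩
  refine ⟨fun x => Nat.find (hex x), measurable_find hex fun k =>
    measurableSet_lt measurable_norm measurable_const, fun x => ⟨?_, Nat.find_spec (hex x)⟩⟩
  change ρ (Nat.find (hex x)) ≤ ‖x‖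
  rcases hk : Nat.find (hex x) with - | k
  · rw [h0]
    exact norm_nonneg x
  · exact not_lt.1 (Nat.find_min (hex x) (m := k) (by omega))

theorem exists_smooth_kernel : ∃ θ : Rd d → ℝ, ContDiff ℝ ∞ θ ∧ HasCompactSupport θ ∧
    (∀ x, 0 ≤ θ x) ∧ (∀ x, θ x ≠ 0 → ‖x‖ ≤ 1) ∧ ∫ x, θ x = 1 := by
  set b : ContDiffBump (0 : Rd d) := ⟨1 / 2, 1, by norm_num, by norm_num⟩
  refine ⟨b.normed volume, b.contDiff_normed, b.hasCompactSupport_normed,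
    fun x => b.nonneg_normed x, fun x hx => ?_, b.integral_normed⟩
  have h1 : x ∈ Function.support (b.normed volume) := hx
  rw [b.support_normed_eq] at h1
  exact (mem_ball_zero_iff.1 h1).le

/-- The function is a mollification of a_k / v_k on the k-th annulus, with a_k = 1/(k + 1). Since k
grows to infinity it decays against every v_n, and (wM) controls the effect of mollifying. The lower
bounds c and μ do not depend on the annuli, which can therefore be adapted to a given function
afterwards. -/
theorem exists_slowly_decreasing (hv : IsWeightSystem v) (hvM : WeakModerate v) :
    ∃ (c : ℕ → ℝ≥0) (μ : ℕ → ℕ), (∀ k, 0 < c k) ∧ ∀ ρ : ℕ → ℝ, ρ 0 = 0 →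
      (∀ k, ρ k + 1 ≤ ρ (k + 1)) → ∃ φ : Rd d → ℂ, (Lzero d).MemInfty v φ ∧
        ∀ k x, ρ k ≤ ‖x‖ → ‖x‖ < ρ (k + 1) → c k / v (μ k) x ≤ ‖φ x‖ := by
  choose m hm C hC hle using fun n => hvM.exists_le 1 n
  set a : ℕ → ℝ := fun k => ((k : ℝ) + 1)⁻¹ with ha
  have ha0 : ∀ k, 0 < a k := fun k => by positivity
  have ha1 : ∀ k, a k ≤ 1 := fun k => inv_le_one_of_one_le₀ (by simp)
  have hanti : Antitone a := fun i j hij => by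
    simp only [ha]
    gcongr
  -- The index is k + 1 because the unit ball about a point of annulus k may reach annulus k + 1,
  -- but no further since every annulus has width at least 1.
  refine ⟨fun k => (a (k + 1) / C (k + 1)).toNNReal, fun k => m (k + 1), fun k =>
    Real.toNNReal_pos.2 (div_pos (ha0 _) (hC _)), fun ρ h0 hρ => ?_⟩
  have hmono : Monotone ρ := monotone_nat_of_le_succ fun k => by linarith [hρ k]
  obtain ⟨κ, hκm, hκ⟩ := exists_annulusIndex (d := d) h0 hρ
  have hκge : ∀ k x, ρ k ≤ ‖x‖ → k ≤ κ x := by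
    intro k x hx
    by_contra hlt
    have := hmono (show κ x + 1 ≤ k by omega)
    linarith [(hκ x).2]
  have hκle : ∀ k x, ‖x‖ < ρ (k + 1) → κ x ≤ k := by
    intro k x hx
    by_contra hlt
    have := hmono (show k + 1 ≤ κ x by omega)
    linarith [(hκ x).1]
  set σ : Rd d → ℝ := fun x => a (κ x) / v (κ x) x
  have hσ0 : ∀ x, 0 ≤ σ x := fun x => div_nonneg (ha0 _).le (hv.pos _ x).le
  have hσ1 : ∀ x, σ x ≤ 1 := fun x =>
    (div_le_self (ha0 _).le (hv.one_le _ x)).trans (ha1 _)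
  have hσm : AEMeasurable σ volume := by
    refine ⟨fun x => a (κ x) / (hv.measurable (κ x)).mk _ x, ?_, ?_⟩
    · have h1 : Measurable fun p : ℕ × Rd d => a p.1 / (hv.measurable p.1).mk _ p.2 :=
        measurable_from_prod_countable_right fun n =>
          (hv.measurable n).measurable_mk.const_div (a n)
      exact h1.comp (hκm.prodMk measurable_id)
    · filter_upwards [ae_all_iff.2 fun n => (hv.measurable n).ae_eq_mk] with x hx
      simp only [σ]
      rw [hx]
  set S : Rd d → ℂ := fun x => (σ x : ℂ)
  have hSn : ∀ x, ‖S x‖ = σ x := fun x => by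
    simp only [S]
    rw [Complex.norm_real, Real.norm_of_nonneg (hσ0 x)]
  have hSl : LocallyIntegrable S volume := by
    refine (memLp_top_of_bound (Complex.measurable_ofReal.comp_aemeasurable
      hσm).aestronglyMeasurable 1 (.of_forall fun x => ?_)).locallyIntegrable le_top
    exact (hSn x).trans_le (hσ1 x)
  obtain ⟨θ, hθs, hθc, hθ0, hθ1, hθi⟩ := exists_smooth_kernel (d := d)
  set Θ : Rd d → ℂ := fun x => (θ x : ℂ)
  have hΘs : ContDiff ℝ ∞ Θ := Complex.ofRealCLM.contDiff.comp hθs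
  have hΘc : HasCompactSupport Θ := hθc.comp_left (g := fun t : ℝ => (t : ℂ)) (by simp)
  refine ⟨conv S Θ, memInfty_iff.2 ⟨contDiff_conv hSl hΘs hΘc, fun n l _ => ?_⟩, ?_⟩
  · have hds := contDiff_dl (contDiff_conv hSl hΘs hΘc) l
    obtain ⟨A, R, hA0, hR0, hA⟩ := exists_norm_conv_le (contDiff_dl hΘs l).continuous
      (hasCompactSupport_dl hΘc l)
    obtain ⟨M, hM, Q, hQ, hvQ⟩ := hvM.exists_le R n
    -- Far out, all z within R of x have annulus index at least K ≥ M, so σ(z) ≤ a_K / v_M(z) ≤ Q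
    -- a_K / v_n(x).
    have hdecay : ∀ K, M ≤ K → ∀ x, ρ K + R ≤ ‖x‖ →
        ‖dl l (conv S Θ) x * (v n x : ℂ)‖ ≤ A * Q * a K := by
      intro K hK x hx
      have hvx := hv.pos n x
      rw [norm_mul, Complex.norm_real, Real.norm_of_nonneg hvx.le, dl_conv hSl hΘs hΘc]
      have h1 := hA S x (Q * a K / v n x) fun z hz => by
        rw [hSn]
        have hzK : K ≤ κ z := by
          refine hκge K z ?_
          have := norm_sub_norm_le x z
          rw [norm_sub_rev] at this
          linarith
        have h2 := hvQ z x (by rwa [norm_sub_rev])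
        have h3 := hv.mono_of_le (hK.trans hzK) z
        have h4 := hv.pos (κ z) z
        simp only [σ]
        rw [div_le_div_iff₀ h4 hvx]
        calc a (κ z) * v n x ≤ a K * (Q * v (κ z) z) :=
              mul_le_mul (hanti hzK) (h2.trans (mul_le_mul_of_nonneg_left h3 hQ.le)) hvx.le
                (ha0 K).le
          _ = _ := by ring
      calc _ ≤ A * (Q * a K / v n x) * v n x := mul_le_mul_of_nonneg_right h1 hvx.le
        _ = _ := by field_simp
    have hm : AEStronglyMeasurable (fun x => dl l (conv S Θ) x * (v n x : ℂ)) volume :=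
      aestronglyMeasurable_mul_weight hv n hds.continuous.aestronglyMeasurable
    refine ⟨?_, fun ε hε => ?_⟩
    · obtain ⟨D, hD⟩ := (isCompact_closedBall (0 : Rd d) (ρ M + R)).exists_bound_of_continuousOn
        hds.continuous.continuousOn
      obtain ⟨V, hV⟩ := hv.locallyBounded n _ (isCompact_closedBall (0 : Rd d) (ρ M + R))
      refine memLp_top_of_bound hm (max (D * V) (A * Q * a M)) (.of_forall fun x => ?_)
      rcases le_total (ρ M + R) ‖x‖ with hx | hx
      · exact (hdecay M le_rfl x hx).trans (le_max_right _ _)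
      · refine le_trans ?_ (le_max_left _ _)
        rw [norm_mul, Complex.norm_real, Real.norm_of_nonneg (hv.pos n x).le]
        have hx' := mem_closedBall_zero_iff.2 hx
        exact mul_le_mul (hD x hx') (hV x hx') (hv.pos n x).le ((norm_nonneg _).trans (hD x hx'))
    · have hlim : Filter.Tendsto (fun k => A * Q * a k) Filter.atTop (nhds 0) := by
        have h2 : Filter.Tendsto a Filter.atTop (nhds 0) := by
          have := tendsto_one_div_add_atTop_nhds_zero_nat (𝕜 := ℝ)
          simpa only [one_div] using this
        simpa using h2.const_mul (A * Q)
      obtain ⟨K, hKM, hK⟩ := ((Filter.eventually_ge_atTop M).and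
        (hlim.eventually (gt_mem_nhds hε))).exists
      refine ⟨Metric.closedBall 0 (ρ K + R), isCompact_closedBall _ _, .of_forall fun x hx => ?_⟩
      rw [mem_closedBall_zero_iff, not_le] at hx
      exact (hdecay K hKM x hx.le).trans hK.le
  · intro k x _ hx2
    have hval : conv S Θ x = ((∫ z, σ z * θ (x - z) : ℝ) : ℂ) := by
      rw [conv_apply, ← integral_complex_ofReal]
      simp [S, Θ]
    rw [hval, Complex.norm_real, Real.coe_toNNReal _ (div_pos (ha0 _) (hC _)).le]
    refine le_trans ?_ (le_abs_self _)
    have hθx : Integrable fun z => θ (x - z) :=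
      (hθs.continuous.integrable_of_hasCompactSupport hθc).comp_sub_left x
    have hone : ∫ z, θ (x - z) = 1 := by
      rw [integral_sub_left_eq_self (fun z => θ z) volume x, hθi]
    calc a (k + 1) / C (k + 1) / v (m (k + 1)) x
        = ∫ z, a (k + 1) / C (k + 1) / v (m (k + 1)) x * θ (x - z) := by
          rw [integral_const_mul, hone, mul_one]
      _ ≤ ∫ z, σ z * θ (x - z) := by
          refine integral_mono (hθx.const_mul _) (hθx.bdd_mul (c := 1)
            hσm.aestronglyMeasurable (.of_forall fun z => ?_)) fun z => ?_
          · rw [Real.norm_of_nonneg (hσ0 z)]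
            exact hσ1 z
          · by_cases hz : θ (x - z) = 0
            · simp [hz]
            · refine mul_le_mul_of_nonneg_right ?_ (hθ0 _)
              have hxz := hθ1 _ hz
              have hκz : κ z ≤ k + 1 := by
                refine hκle (k + 1) z ?_
                have := norm_sub_norm_le z x
                rw [norm_sub_rev] at this
                linarith [hρ (k + 1)]
              have h2 := hle (k + 1) x z (by rwa [norm_sub_rev])
              have h3 := hv.mono_of_le hκz z
              have h4 := hv.pos (κ z) z
              simp only [σ]
              rw [div_div]
              exact div_le_div₀ (ha0 _).le (hanti hκz) h4 (h3.trans h2)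

variable {E : Type*} [NormedAddCommGroup E] [NormedSpace ℂ E] [CompleteSpace E]
variable (B : SolidTIBF d E)

/-! ### The gliding hump -/

/-- On the inner ball the weighted function is bounded, so its truncation there has finite norm. The
infinite semi-local norm must come from outside, where a large enough annulus captures any
prescribed amount. -/
theorem exists_annulus_norm_ge (hw : IsWeightSystem w) (hv : IsWeightSystem v) {n m : ℕ}
    {G : Rd d → ℂ} (hG : Continuous G) (h : wsl B w v n m G = ⊤) (r : ℝ) (T : ℝ≥0) :
    ∃ R : ℝ, r + 1 ≤ R ∧ (T : ℝ≥0∞) ≤ B.space.norm ({x : Rd d | r ≤ ‖x‖ ∧ ‖x‖ < R}.indicator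
      fun x => G x * ((w n x / v m x : ℝ) : ℂ)) := by
  set g : Rd d → ℂ := fun x => G x * ((w n x / v m x : ℝ) : ℂ) with hg
  have hgm : AEStronglyMeasurable g volume :=
    aestronglyMeasurable_weight hw hv n m hG.aestronglyMeasurable
  have hfin : B.space.norm ((Metric.closedBall 0 r).indicator g) < ⊤ := by
    obtain ⟨D, hD⟩ := (isCompact_closedBall (0 : Rd d) r).exists_bound_of_continuousOn
      hG.continuousOn
    obtain ⟨V, hV⟩ := hw.locallyBounded n _ (isCompact_closedBall (0 : Rd d) r)
    refine norm_lt_top_of_bounded B (isCompact_closedBall (0 : Rd d) r)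
      (hgm.indicator measurableSet_closedBall) (M := D * V) (fun x hx => ?_)
      (fun x hx => Set.indicator_of_notMem hx _)
    rw [Set.indicator_of_mem hx, hg, norm_mul, norm_weight hw hv]
    refine mul_le_mul (hD x hx) ?_ (div_nonneg (hw.pos n x).le (hv.pos m x).le)
      ((norm_nonneg _).trans (hD x hx))
    exact (div_le_self (hw.pos n x).le (hv.one_le m x)).trans (hV x hx)
  have h1 : (T : ℝ≥0∞) + B.space.norm ((Metric.closedBall 0 r).indicator g) < B.slNorm g := by
    rw [show B.slNorm g = ⊤ from h]
    exact ENNReal.add_lt_top.2 ⟨ENNReal.coe_lt_top, hfin⟩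
  obtain ⟨R, hR⟩ := lt_iSup_iff.1 h1
  obtain ⟨hR0, hR⟩ := lt_iSup_iff.1 hR
  refine ⟨max r R + 1, by linarith [le_max_left r R], ?_⟩
  set s : Set (Rd d) := {x : Rd d | r ≤ ‖x‖ ∧ ‖x‖ < max r R + 1}
  have hs : MeasurableSet s :=
    (measurableSet_le measurable_const measurable_norm).inter
      (measurableSet_lt measurable_norm measurable_const)
  have h2 : B.space.norm ((Metric.closedBall 0 R).indicator g) ≤
      B.space.norm (s.indicator g) + B.space.norm ((Metric.closedBall 0 r).indicator g) := by
    have := norm_le_sum B Finset.univ (h := (Metric.closedBall 0 R).indicator g)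
      (g := ![s.indicator g, (Metric.closedBall 0 r).indicator g])
      (hgm.indicator measurableSet_closedBall) (.of_forall fun x => ?_)
    · simpa using this
    · simp only [Fin.sum_univ_two, Matrix.cons_val_zero, Matrix.cons_val_one]
      by_cases hx : x ∈ Metric.closedBall (0 : Rd d) R
      · rw [Set.indicator_of_mem hx]
        rw [mem_closedBall_zero_iff] at hx
        rcases le_total r ‖x‖ with hr | hr
        · have hxs : x ∈ s := ⟨hr, by linarith [le_max_right r R]⟩
          rw [Set.indicator_of_mem hxs]
          exact le_self_add
        · rw [Set.indicator_of_mem (mem_closedBall_zero_iff.2 hr)]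
          exact le_add_self
      · rw [Set.indicator_of_notMem hx, enorm_zero]
        exact zero_le
  exact (ENNReal.add_lt_add_iff_right hfin.ne).1 (hR.trans_le h2) |>.le

/-- Otherwise annuli are chosen inductively so that on the k-th one G w_n / v_{μ_k} has norm at
least k / c_k. The associated φ satisfies |φ| ≥ c_k / v_{μ_k} there, so G φ w_n has norm at least k
for every k. -/
theorem exists_wsl_lt_top (hw : IsWeightSystem w) (hv : IsWeightSystem v) (hvM : WeakModerate v)
    (n : ℕ) {G : Rd d → ℂ} (hG : Continuous G)
    (h : ∀ φ : Rd d → ℂ, (Lzero d).MemInfty v φ →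
      B.space.norm (fun x => G x * φ x * (w n x : ℂ)) < ⊤) :
    ∃ m, wsl B w v n m G < ⊤ := by
  by_contra! hcon
  have htop : ∀ m, wsl B w v n m G = ⊤ := fun m => top_le_iff.1 (hcon m)
  obtain ⟨c, μ, hc, hφ⟩ := exists_slowly_decreasing hv hvM
  choose S hS1 hS2 using fun (k : ℕ) (r : ℝ) =>
    exists_annulus_norm_ge B hw hv hG (htop (μ k)) r ((c k)⁻¹ * k)
  set ρ : ℕ → ℝ := fun k => Nat.rec 0 S k
  obtain ⟨φ, hφ1, hφ2⟩ := hφ ρ rfl fun k => hS1 k (ρ k)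
  have hlt := h φ hφ1
  have hk : ∀ k : ℕ, (k : ℝ≥0∞) ≤ B.space.norm (fun x => G x * φ x * (w n x : ℂ)) := by
    intro k
    have h1 : ((((c k)⁻¹ * k : ℝ≥0)) : ℝ≥0∞) ≤
        ((c k)⁻¹ : ℝ≥0) * B.space.norm (fun x => G x * φ x * (w n x : ℂ)) := by
      refine (hS2 k (ρ k)).trans (norm_const_mul_le B ?_ (.of_forall fun x => ?_))
      · exact (aestronglyMeasurable_weight hw hv n (μ k) hG.aestronglyMeasurable).indicator
          ((measurableSet_le measurable_const measurable_norm).inter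
            (measurableSet_lt measurable_norm measurable_const))
      · by_cases hx : x ∈ {x : Rd d | ρ k ≤ ‖x‖ ∧ ‖x‖ < S k (ρ k)}
        · rw [Set.indicator_of_mem hx, enorm_eq_nnnorm, enorm_eq_nnnorm, ← ENNReal.coe_mul,
            ENNReal.coe_le_coe, ← NNReal.coe_le_coe]
          push_cast
          have h2 := hφ2 k x hx.1 hx.2
          have h3 := hw.pos n x
          have h4 := hv.pos (μ k) x
          have h5 : (0 : ℝ) < c k := hc k
          simp only [norm_mul, norm_div, Complex.norm_real]
          rw [Real.norm_of_nonneg h3.le, Real.norm_of_nonneg h4.le]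
          rw [le_inv_mul_iff₀ h5]
          calc (c k : ℝ) * (‖G x‖ * (w n x / v (μ k) x))
              = ‖G x‖ * (c k / v (μ k) x) * w n x := by ring
            _ ≤ _ := by gcongr
        · rw [Set.indicator_of_notMem hx, enorm_zero]
          exact zero_le
    rw [ENNReal.coe_mul] at h1
    exact (ENNReal.mul_le_mul_iff_right (by simpa using (hc k).ne')
      ENNReal.coe_ne_top).1 h1
  obtain ⟨k, hk'⟩ := ENNReal.exists_nat_gt hlt.ne
  exact absurd (hk k) (not_le.2 hk')

/-! ### Multipliers are smooth functions -/

/-- A slowly decreasing φ₀ is bounded below on each annulus, hence nowhere zero. Thus f = g₀ / φ₀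
with g₀ = f · φ₀ smooth, and every other product f · φ must be the function F φ. -/
theorem MemOM.exists_smooth (hv : IsWeightSystem v) (hvM : WeakModerate v) {f : Distr d}
    (hf : MemOM B v w f) : ∃ F : Rd d → ℂ, ContDiff ℝ ∞ F ∧
      (∀ θ : Test d, f θ = ∫ x, F x * θ x) ∧
      ∀ φ : Rd d → ℂ, (Lzero d).MemInfty v φ → ∀ (n : ℕ) (l : List (Fin d)), l.length ≤ n →
        B.space.norm (fun x => dl l (F * φ) x * (w n x : ℂ)) < ⊤ := by
  obtain ⟨c, μ, hc, hφ⟩ := exists_slowly_decreasing hv hvM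
  obtain ⟨φ₀, hφ₀, hφ₀'⟩ := hφ (fun k => k) (by simp) (fun k => by simp)
  have hne : ∀ x, φ₀ x ≠ 0 := by
    intro x
    rw [← norm_pos_iff]
    refine lt_of_lt_of_le ?_ (hφ₀' ⌊‖x‖⌋₊ x (Nat.floor_le (norm_nonneg x)) ?_)
    · exact div_pos (hc _) (hv.pos _ x)
    · push_cast
      exact Nat.lt_floor_add_one _
  obtain ⟨g₀, hg₀, hfg₀⟩ := hf φ₀ hφ₀
  have hφ₀s := hφ₀.contDiff
  have hFs : ContDiff ℝ ∞ fun x => g₀ x * (φ₀ x)⁻¹ := hg₀.contDiff.mul (hφ₀s.inv hne)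
  have hfF : ∀ θ : Test d, f θ = ∫ x, g₀ x * (φ₀ x)⁻¹ * θ x := by
    intro θ
    have hθ : smoothMul φ₀ hφ₀s (smoothMul (fun x => (φ₀ x)⁻¹) (hφ₀s.inv hne) θ) = θ := by
      ext x
      change φ₀ x * ((φ₀ x)⁻¹ * θ x) = θ x
      rw [mul_inv_cancel_left₀ (hne x)]
    rw [← hθ, hfg₀, hθ]
    refine integral_congr_ae (.of_forall fun x => ?_)
    exact (mul_assoc _ _ _).symm
  refine ⟨_, hFs, hfF, fun φ hφ n l hl => ?_⟩
  obtain ⟨g, hg, hfg⟩ := hf φ hφ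
  have hFφ : ContDiff ℝ ∞ ((fun x => g₀ x * (φ₀ x)⁻¹) * φ) := hFs.mul hφ.contDiff
  -- Two continuous functions defining the same distribution agree everywhere.
  have heq : (fun x => g₀ x * (φ₀ x)⁻¹) * φ = g := by
    refine (Continuous.ae_eq_iff_eq volume hFφ.continuous hg.contDiff.continuous).1 ?_
    refine ae_eq_of_integral_contDiff_smul_eq hFφ.continuous.locallyIntegrable
      hg.contDiff.continuous.locallyIntegrable fun u hu hcu => ?_
    set U : Test d := mkTest (fun x => (u x : ℂ)) (Complex.ofRealCLM.contDiff.comp hu)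
      (hcu.comp_left (g := fun t : ℝ => (t : ℂ)) (by simp))
    have h1 := (hfF _).symm.trans (hfg U)
    refine Eq.trans ?_ (h1.trans ?_)
    · refine integral_congr_ae (.of_forall fun x => ?_)
      change u x • (g₀ x * (φ₀ x)⁻¹ * φ x) = g₀ x * (φ₀ x)⁻¹ * (φ x * (u x : ℂ))
      rw [Complex.real_smul]
      ring
    · refine integral_congr_ae (.of_forall fun x => ?_)
      change g x * (u x : ℂ) = u x • g x
      rw [Complex.real_smul, mul_comm]
  rw [heq]
  exact (space_mem_iff B).1 ((memInfty_iff.1 hg).2 n l hl)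

/-- The product rule read backwards, (∂_i F) φ = ∂_i(F φ) - F ∂_i φ, transfers the property from F
to its derivatives. The first term uses order n + 1 and w_n ≤ w_{n+1}. -/
theorem norm_dl_mul_lt_top_of_mul (hw : IsWeightSystem w) (hv : IsWeightSystem v) {F : Rd d → ℂ}
    (hF : ContDiff ℝ ∞ F)
    (h : ∀ φ : Rd d → ℂ, (Lzero d).MemInfty v φ → ∀ (n : ℕ) (l : List (Fin d)), l.length ≤ n →
        B.space.norm (fun x => dl l (F * φ) x * (w n x : ℂ)) < ⊤) (k : List (Fin d))
    (φ : Rd d → ℂ) (hφ : (Lzero d).MemInfty v φ) (n : ℕ) (l : List (Fin d)) (hl : l.length ≤ n) :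
    B.space.norm (fun x => dl l (dl k F * φ) x * (w n x : ℂ)) < ⊤ := by
  induction k generalizing φ n l with
  | nil => exact h φ hφ n l hl
  | cons i k ih =>
    have hk := contDiff_dl hF k
    have hφs := hφ.contDiff
    have hs1 : ContDiff ℝ ∞ (dl k F * φ) := hk.mul hφs
    have hs2 : ContDiff ℝ ∞ (dl k F * partialDeriv i φ) := hk.mul (contDiff_partialDeriv hφs i)
    have h1 := ih φ hφ (n + 1) (l ++ [i]) (by simpa using hl)
    have h2 := ih _ (memInfty_partialDeriv hv hφ i) n l hl
    have heq : dl (i :: k) F * φ = partialDeriv i (dl k F * φ) - dl k F * partialDeriv i φ := by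
      rw [partialDeriv_mul hk hφs, dl_cons, add_sub_cancel_right]
    rw [heq, dl_sub (contDiff_partialDeriv hs1 i) hs2]
    rw [dl_append, dl_cons, dl_nil] at h1
    have hm1 := aestronglyMeasurable_mul_weight hw n
      (contDiff_dl (contDiff_partialDeriv hs1 i) l).continuous.aestronglyMeasurable
    have h1' := (norm_mono B hm1 (.of_forall (norm_mul_weight_mono hw n.le_succ _))).trans_lt h1
    have h2' : B.space.norm (fun x => -(dl l (dl k F * partialDeriv i φ) x * (w n x : ℂ))) < ⊤ :=
      (norm_mono B (aestronglyMeasurable_of_norm_lt_top B h2).neg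
        (.of_forall fun x => (norm_neg _).le)).trans_lt h2
    simp_rw [Pi.sub_apply, sub_mul, sub_eq_add_neg]
    exact (space_norm_add_le B (hm1.add (aestronglyMeasurable_of_norm_lt_top B h2'))).trans_lt
      (ENNReal.add_lt_top.2 ⟨h1', h2'⟩)

theorem MemOM.exists_isMultiplier (hw : IsWeightSystem w) (hv : IsWeightSystem v)
    (hvM : WeakModerate v) {f : Distr d} (hf : MemOM B v w f) :
    ∃ F : Rd d → ℂ, IsMultiplier B w v F ∧ ∀ θ : Test d, f θ = ∫ x, F x * θ x := by
  obtain ⟨F, hF, hfF, h⟩ := hf.exists_smooth B hv hvM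
  refine ⟨F, ⟨hF, fun n => ?_⟩, hfF⟩
  choose m hm using fun l : List (Fin d) => exists_wsl_lt_top B hw hv hvM n
    (contDiff_dl hF l).continuous fun φ hφ =>
      norm_dl_mul_lt_top_of_mul B hw hv hF h l φ hφ n [] (Nat.zero_le _)
  -- A single m serves the finitely many derivatives of order at most n, since enlarging m decreases
  -- the norm.
  refine ⟨(listsLE d n).sup m, fun l hl => ?_⟩
  exact (wsl_mono_index B hw hv le_rfl (Finset.le_sup (mem_listsLE.2 hl))
    (contDiff_dl hF l).continuous.aestronglyMeasurable).trans_lt (hm l)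

end Necessity

/-! ### Rescaling by powers of two -/

section Equivalence

variable {w v : ℕ → Rd d → ℝ}
variable {E : Type*} [NormedAddCommGroup E] [NormedSpace ℂ E] [CompleteSpace E]
variable (B : SolidTIBF d E)

theorem contDiff_real_smul (t : ℝ) {u : Rd d → ℂ} (hu : ContDiff ℝ ∞ u) :
    ContDiff ℝ ∞ (t • u) :=
  contDiff_const.smul hu

theorem wsl_dl_smul_le (hw : IsWeightSystem w) (hv : IsWeightSystem v) {n m : ℕ} (t : ℝ)
    {u : Rd d → ℂ} (hu : ContDiff ℝ ∞ u) (l : List (Fin d)) :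
    wsl B w v n m (dl l (t • u)) ≤ ‖t‖₊ * wsl B w v n m (dl l u) := by
  have h1 : t • u = (t : ℂ) • u := by
    ext x
    simp
  have h2 : dl l (t • u) = (t : ℂ) • dl l u := by rw [h1, dl_const_smul hu]
  refine wsl_const_mul_le B hw hv
    (contDiff_dl (contDiff_real_smul t hu) l).continuous.aestronglyMeasurable fun x => ?_
  rw [h2, Pi.smul_apply, enorm_smul]
  refine mul_le_mul_left (le_of_eq ?_) _
  rw [enorm_eq_nnnorm, Complex.nnnorm_real]

theorem wsl_dl_le_of_smul (hw : IsWeightSystem w) (hv : IsWeightSystem v) {n m : ℕ} (s : ℝ)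
    {u : Rd d → ℂ} (hu : ContDiff ℝ ∞ u) {l : List (Fin d)} {M : ℝ≥0}
    (h : wsl B w v n m (dl l ((2 : ℝ) ^ (-s) • u)) ≤ M) :
    wsl B w v n m (dl l u) ≤ ((2 : ℝ≥0) ^ s : ℝ≥0) * M := by
  have h0 : (0 : ℝ) < 2 ^ s := Real.rpow_pos_of_pos two_pos s
  have h1 : (2 : ℝ) ^ s • (2 : ℝ) ^ (-s) • u = u := by
    rw [smul_smul, Real.rpow_neg two_pos.le, mul_inv_cancel₀ h0.ne', one_smul]
  have h2 : ‖(2 : ℝ) ^ s‖₊ = (2 : ℝ≥0) ^ s := by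
    ext
    rw [coe_nnnorm, Real.norm_of_nonneg h0.le]
    simp
  have h3 := wsl_dl_smul_le B hw hv (n := n) (m := m) ((2 : ℝ) ^ s)
    (contDiff_real_smul ((2 : ℝ) ^ (-s)) hu) l
  rw [h1, h2] at h3
  exact h3.trans (mul_le_mul_right h _)

theorem wsl_dl_smul_le_of_le (hw : IsWeightSystem w) (hv : IsWeightSystem v) {n m : ℕ} {s : ℝ}
    (hs : 0 ≤ s) {u : Rd d → ℂ} (hu : ContDiff ℝ ∞ u) (l : List (Fin d)) :
    wsl B w v n m (dl l ((2 : ℝ) ^ (-s) • u)) ≤ wsl B w v n m (dl l u) := by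
  refine (wsl_dl_smul_le B hw hv _ hu l).trans (mul_le_of_le_one_left zero_le ?_)
  rw [ENNReal.coe_le_one_iff, ← NNReal.coe_le_coe, coe_nnnorm,
    Real.norm_of_nonneg (Real.rpow_nonneg two_pos.le _)]
  exact Real.rpow_le_one_of_one_le_of_nonpos one_le_two (by linarith)

end Equivalence

end MollifierOM


end

/-! ### The equivalence of the four conditions -/

theorem theoremt {d : ℕ} {E : Type*} [NormedAddCommGroup E] [NormedSpace ℂ E] [CompleteSpace E]
    (B : MollifierOM.SolidTIBF d E)
    (v w : ℕ → MollifierOM.Rd d → ℝ)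
    (hv : MollifierOM.IsWeightSystem v) (hw : MollifierOM.IsWeightSystem w)
    (hvM : MollifierOM.WeakModerate v) (hwM : MollifierOM.WeakModerate w)
    (χ : Fin 2 → MollifierOM.Test d) (hχ : MollifierOM.HasMDFP χ)
    (f : MollifierOM.Distr d) :
    List.TFAE [
      -- (i)
      MollifierOM.MemOM B v w f,
      -- (ii)
      ∀ (φ : MollifierOM.Test d) (n : ℕ), ∃ m : ℕ,
        B.semiLocal.BoundedCn n (fun x => w n x / v m x)
          {g | ∃ j : ℕ, g = MollifierOM.distConv f (MollifierOM.dilate j φ)},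
      -- (iii)
      ∀ φ : MollifierOM.Test d, ∃ r : ℝ, 0 < r ∧ ∀ n : ℕ, ∃ m : ℕ,
        B.semiLocal.BoundedCn n (fun x => w n x / v m x)
          {g | ∃ j : ℕ, g = (2 : ℝ) ^ (-(r * j)) •
            MollifierOM.distConv f (MollifierOM.dilate j φ)},
      -- (iv)
      ∃ r : ℝ, 0 < r ∧ ∀ n : ℕ, ∃ m : ℕ,
        B.semiLocal.BoundedCn n (fun x => w n x / v m x)
          {g | ∃ (j : ℕ) (ℓ : Fin 2), g = (2 : ℝ) ^ (-(r * j)) •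
            MollifierOM.distConv f (MollifierOM.dilate j (χ ℓ))}] := by
  open MollifierOM in
  have hs := fun (j : ℕ) (φ : Test d) => contDiff_distConv f (dilate j φ)
  tfae_have 1 → 2 := by
    intro h φ n
    obtain ⟨F, hF, hfF⟩ := h.exists_isMultiplier B hw hv hvM
    obtain ⟨m, M, hM⟩ := exists_bound_of_isMultiplier B hw hv hwM hvM hF hfF φ n
    refine ⟨m, (boundedCn_iff B ?_ n m).2 ⟨M, ?_⟩⟩
    · rintro g ⟨j, rfl⟩
      exact hs j φ
    · rintro g ⟨j, rfl⟩
      exact hM j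
  tfae_have 2 → 3 := by
    refine fun h φ => ⟨1, one_pos, fun n => ?_⟩
    obtain ⟨m, hm⟩ := h φ n
    refine ⟨m, (boundedCn_iff B ?_ n m).2 ?_⟩
    · rintro g ⟨j, rfl⟩
      exact contDiff_real_smul _ (hs j φ)
    · obtain ⟨M, hM⟩ := (boundedCn_iff B (by rintro g ⟨j, rfl⟩; exact hs j φ) n m).1 hm
      refine ⟨M, ?_⟩
      rintro g ⟨j, rfl⟩ l hl
      exact (wsl_dl_smul_le_of_le B hw hv (by positivity) (hs j φ) l).trans (hM _ ⟨j, rfl⟩ l hl)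
  tfae_have 3 → 4 := by
    intro h
    choose r hr hrb using fun ℓ => h (χ ℓ)
    -- The sum dominates both exponents; the surplus factor 2^{-r_{ℓ'} j} ≤ 1 does no harm. In the
    -- same way the sums of the indices m and of the bounds M serve both windows.
    refine ⟨r 0 + r 1, add_pos (hr 0) (hr 1), fun n => ?_⟩
    choose m hm using fun ℓ => hrb ℓ n
    choose M hM using fun ℓ => (boundedCn_iff B (by
      rintro g ⟨j, rfl⟩
      exact contDiff_real_smul _ (hs j (χ ℓ))) n (m ℓ)).1 (hm ℓ)
    refine ⟨m 0 + m 1, (boundedCn_iff B ?_ n _).2 ⟨M 0 + M 1, ?_⟩⟩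
    · rintro g ⟨j, ℓ, rfl⟩
      exact contDiff_real_smul _ (hs j (χ ℓ))
    · rintro g ⟨j, ℓ, rfl⟩ l hl
      have key : ∀ (ℓ ℓ' : Fin 2), m ℓ ≤ m 0 + m 1 → M ℓ ≤ M 0 + M 1 → r 0 + r 1 = r ℓ + r ℓ' →
          wsl B w v n (m 0 + m 1)
            (dl l ((2 : ℝ) ^ (-((r 0 + r 1) * j)) • distConv f (dilate j (χ ℓ)))) ≤
            (M 0 + M 1 : ℝ≥0) := by
        intro ℓ ℓ' hmℓ hMℓ hrℓ
        have h1 : (2 : ℝ) ^ (-((r 0 + r 1) * j)) • distConv f (dilate j (χ ℓ)) =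
            (2 : ℝ) ^ (-(r ℓ' * j)) • (2 : ℝ) ^ (-(r ℓ * j)) • distConv f (dilate j (χ ℓ)) := by
          rw [smul_smul, ← Real.rpow_add two_pos, hrℓ]
          congr 2
          ring
        have h2 := contDiff_real_smul ((2 : ℝ) ^ (-(r ℓ * j))) (hs j (χ ℓ))
        rw [h1]
        refine (wsl_dl_smul_le_of_le B hw hv (mul_nonneg (hr ℓ').le j.cast_nonneg) h2 l).trans ?_
        refine (wsl_mono_index B hw hv le_rfl hmℓ
          (contDiff_dl h2 l).continuous.aestronglyMeasurable).trans ?_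
        exact (hM ℓ _ ⟨j, rfl⟩ l hl).trans (ENNReal.coe_le_coe.2 hMℓ)
      fin_cases ℓ
      · exact key 0 1 (Nat.le_add_right _ _) le_self_add rfl
      · exact key 1 0 (Nat.le_add_left _ _) le_add_self (add_comm _ _)
  tfae_have 4 → 1 := by
    rintro ⟨r, hr, h⟩
    obtain ⟨F, hF, hfF⟩ := isMultiplier_of_bounded B hw hv hwM hvM f hχ (r := r) fun n => by
      obtain ⟨m, hm⟩ := h n
      obtain ⟨M, hM⟩ := (boundedCn_iff B (by
        rintro g ⟨j, ℓ, rfl⟩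
        exact contDiff_real_smul _ (hs j (χ ℓ))) n m).1 hm
      exact ⟨m, M, fun j ℓ l hl =>
        wsl_dl_le_of_smul B hw hv (r * j) (hs j (χ ℓ)) (hM _ ⟨j, ℓ, rfl⟩ l hl)⟩
    exact memOM_of_isMultiplier B hw hv hF hfF
  tfae_finish
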